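/- Let $G=\mu_3\rtimes\mathbb{Z}/2\mathbb{Z}$ over $\mathbb{Z}[1/2]$, where $\mathbb{Z}/2\mathbb{Z}=\{1,\sigma\}$ acts on $\mu_3$ by inversion. All schemes are over $\mathbb{Z}[1/2]$, and morphisms in the stacks below are isomorphisms over base change. Let $\mathcal{Y}$ be the stack whose objects over a scheme $T$ are the sequences $\chi=(\mathcal{L},\mathcal{F},\alpha,\beta,\langle-,-\rangle)$, where $\mathcal{L}$ is an invertible sheaf on $T$, $\mathcal{F}$ is a locally free sheaf of rank $2$, and $$\alpha\colon\mathcal{L}\otimes\mathcal{F}\to\mathcal{F},\qquad \beta\colon\mathrm{Sym}^2\mathcal{F}\to\mathcal{F},\qquad \langle-,-\rangle\colon\det\mathcal{F}\to\mathcal{L}$$ are $\mathcal{O}_T$-linear. Put $m=\tfrac12\operatorname{tr}\bigl(\mathcal{L}^{2}\otimes\mathcal{F}\xrightarrow{\mathrm{id}\otimes\alpha}\mathcal{L}\otimes\mathcal{F}\xrightarrow{\alpha}\mathcal{F}\bigr)\colon\mathcal{L}^{2}\to\mathcal{O}_T$, and let $(-,-)$ be the composite $$\mathcal{F}\otimes\mathcal{F}\simeq\mathcal{F}^\vee\otimes\det\mathcal{F}\otimes\mathcal{F}\xrightarrow{\mathrm{id}\otimes\langle-,-\rangle\otimes\mathrm{id}}\mathcal{F}^\vee\otimes\mathcal{L}\otimes\mathcal{F}\xrightarrow{\mathrm{id}\otimes\alpha}\mathcal{F}^\vee\otimes\mathcal{F}\to\mathcal{O}_T,$$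 where the isomorphism $\mathcal{F}\simeq\mathcal{F}^\vee\otimes\det\mathcal{F}$ is given in a basis $y,z$ by $y\mapsto -z^*\otimes(y\wedge z)$, $z\mapsto y^*\otimes(y\wedge z)$. Put $\gamma=(-,-)+\langle-,-\rangle$ and $\gamma'=(-,-)-\langle-,-\rangle$, maps $\mathcal{F}\otimes\mathcal{F}\to\mathcal{O}_T\oplus\mathcal{L}$. Write $\hat\alpha\colon\mathcal{F}\otimes\mathcal{L}\to\mathcal{F}$ for $\alpha$ with the factors of the source swapped. Let $\mathrm{LRings}^G$ be the stack of locally free sheaves of finite rank with a coaction of $G$, an equivariant multiplication (not necessarily commutative or associative) and an invariant unit. Let $G\text{-}\mathrm{Cov}$ be its substack of $G$-covers, viewed as sheaves of algebras: the commutative and associative objects which are, fppf locally, isomorphic to the regular representation $\mathcal{O}_T[G]$ as sheaves with a coaction of $G$. For $\chi\in\mathcal{Y}$ let $\mathcal{A}_\chi=\mathcal{O}_T\oplus\mathcal{L}\oplus\mathcal{F}_1\oplus\mathcal{F}_2$ with $\mathcal{F}_1=\mathcal{F}_2=\mathcal{F}$. The coaction of $G$ is such that $\mathcal{O}_T\oplus\mathcal{L},\mathcal{F}_1,\mathcal{F}_2$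 are the parts of $\mu_3$-degree $0,1,2$, and $\sigma$ acts as $\mathrm{id}$ on $\mathcal{O}_T$, as $-\mathrm{id}$ on $\mathcal{L}$, and exchanges $\mathcal{F}_1$ and $\mathcal{F}_2$ by $\mathrm{id}_{\mathcal{F}}$. The unit is $1\in\mathcal{O}_T$, and the multiplication is given by $$\mathcal{L}^2\xrightarrow{m}\mathcal{O}_T,\quad \mathcal{L}\otimes\mathcal{F}_1\xrightarrow{\alpha}\mathcal{F}_1,\quad \mathcal{L}\otimes\mathcal{F}_2\xrightarrow{-\alpha}\mathcal{F}_2,\quad \mathcal{F}_1\otimes\mathcal{L}\xrightarrow{\hat\alpha}\mathcal{F}_1,\quad \mathcal{F}_2\otimes\mathcal{L}\xrightarrow{-\hat\alpha}\mathcal{F}_2,$$ $$\mathcal{F}_1\otimes\mathcal{F}_1\xrightarrow{\beta}\mathcal{F}_2,\quad \mathcal{F}_2\otimes\mathcal{F}_2\xrightarrow{\beta}\mathcal{F}_1,\quad \mathcal{F}_1\otimes\mathcal{F}_2\xrightarrow{\gamma}\mathcal{O}_T\oplus\mathcal{L},\quad \mathcal{F}_2\otimes\mathcal{F}_1\xrightarrow{\gamma'}\mathcal{O}_T\oplus\mathcal{L}.$$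 **Theorem.** The map of stacks $\mathcal{Y}\to\mathrm{LRings}^G$, $\chi\mapsto\mathcal{A}_\chi$ (on morphisms, $(a,b)\mapsto\mathrm{id}\oplus a\oplus b\oplus b$), is well defined and fully faithful. It induces an equivalence between $G\text{-}\mathrm{Cov}$ and each of the following two substacks of $\mathcal{Y}$, which coincide. 1. The substack of the $\chi$ which satisfy the following relations whenever a local generator $t$ of $\mathcal{L}$ and a local basis of $\mathcal{F}$ are given, where $t$ is used to regard $\alpha$ as a map $\mathcal{F}\to\mathcal{F}$, $\langle-,-\rangle$ as a map to $\mathcal{O}_T$, and $m$ as the function $m(t\otimes t)$: for all local sections $u,v,w$ of $\mathcal{F}$, $$\alpha^2=m\,\mathrm{id}_{\mathcal{F}},\qquad \langle\alpha(u),v\rangle=\langle\alpha(v),u\rangle,\qquad \alpha(\beta(u\otimes v))=-\beta(u\otimes\alpha(v)),$$ $$\beta(\beta(u\otimes v)\otimes w)=\langle\alpha(w),v\rangle u+\langle v,w\rangle\alpha(u),\qquad \langle u,\beta(v\otimes w)\rangle=\langle w,\beta(u\otimes v)\rangle.$$ 2. The substack of the $\chi$ for which the following five diagrams commute, that is, the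 following pairs of composite maps are equal: - $\mathcal{L}\otimes\mathcal{L}\otimes\mathcal{F}\to\mathcal{F}$: $\ \alpha\circ(\mathrm{id}\otimes\alpha)$ and $m\otimes\mathrm{id}$; - $\mathcal{F}\otimes\mathcal{L}\otimes\mathcal{F}\to\mathcal{L}$: $\ \langle-,-\rangle\circ(\mathrm{id}\otimes\alpha)$ and $\langle-,-\rangle\circ(-\hat\alpha\otimes\mathrm{id})$; - $\mathcal{F}\otimes\mathcal{F}\otimes\mathcal{L}\to\mathcal{F}$: $\ \beta\circ(\mathrm{id}\otimes\hat\alpha)$ and $-\hat\alpha\circ(\beta\otimes\mathrm{id})$; - $\mathcal{F}\otimes\mathcal{F}\otimes\mathcal{F}\to\mathcal{F}$: $\ \beta\circ(\beta\otimes\mathrm{id})$ and $(\mathrm{id}\oplus(-\hat\alpha))\circ(\mathrm{id}\otimes\gamma')$; - $\mathcal{F}\otimes\mathcal{F}\otimes\mathcal{F}\to\mathcal{O}_T\oplus\mathcal{L}$: $\ \gamma\circ(\mathrm{id}\otimes\beta)$ and $\gamma'\circ(\beta\otimes\mathrm{id})$. -/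

import Mathlib

open CategoryTheory AlgebraicGeometry TopologicalSpace Opposite
open scoped TensorProduct

universe u

namespace SThreeCover

/-! ### The group scheme `G = μ₃ ⋊ ℤ/2` -/

/-- The Hopf algebra `𝒪(G)` of the group scheme `G = μ₃ ⋊ ℤ/2` over `ℤ`, where `ℤ/2` acts on `μ₃`
by inversion. The underlying scheme of `G` is the disjoint union, indexed by `a ∈ ℤ/2`, of two
copies of `μ₃ = Spec ℤ[ℤ/3]`, and the product is `(ζ, a) (ξ, b) = (ζ ξ ^ ((-1) ^ a), a + b)`.

The group scheme considered below is the base change of this one to `ℤ[1/2]`; for a sheaf of modules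
`M` on a scheme `T` over `ℤ[1/2]` the tensor product over `ℤ[1/2]` of `M` with the coordinate ring
of the base change is the tensor product over `ℤ` of `M` with `𝒪(G)`. -/
def CoordG : Type := ZMod 2 → AddMonoidAlgebra ℤ (ZMod 3)

namespace CoordG
noncomputable instance : CommRing CoordG :=
  inferInstanceAs (CommRing (ZMod 2 → AddMonoidAlgebra ℤ (ZMod 3)))

/-- The function on `G` which is the character `ζ ↦ ζ ^ k` on the component `a`. -/
noncomputable def e (a : ZMod 2) (k : ZMod 3) : CoordG :=
  Pi.single (M := fun _ => AddMonoidAlgebra ℤ (ZMod 3)) a (AddMonoidAlgebra.single k 1)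

/-- Restriction of functions to the component `a`. -/
noncomputable def restrict (a : ZMod 2) : CoordG →ₗ[ℤ] AddMonoidAlgebra ℤ (ZMod 3) :=
  LinearMap.proj (φ := fun _ : ZMod 2 => AddMonoidAlgebra ℤ (ZMod 3)) a

/-- Extension by zero of functions on the component `a`. -/
noncomputable def extend (a : ZMod 2) : AddMonoidAlgebra ℤ (ZMod 3) →ₗ[ℤ] CoordG :=
  LinearMap.single ℤ (fun _ : ZMod 2 => AddMonoidAlgebra ℤ (ZMod 3)) a

/-- The sign `(-1) ^ a`. -/
def sgn (a : ZMod 2) : ZMod 3 := if a = 0 then 1 else -1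

/-- The action of `a ∈ ℤ/2` on functions on `μ₃`, induced by `ξ ↦ ξ ^ ((-1) ^ a)`. -/
noncomputable def twist (a : ZMod 2) :
    AddMonoidAlgebra ℤ (ZMod 3) →ₗ[ℤ] AddMonoidAlgebra ℤ (ZMod 3) :=
  (AddMonoidAlgebra.mapDomainAlgHom ℤ ℤ (AddMonoidHom.mulLeft (sgn a))).toLinearMap

/-- The comultiplication is induced by the product `(ζ, a) (ξ, b) = (ζ ξ ^ ((-1) ^ a), a + b)` and the
counit is the evaluation at the neutral element. -/
noncomputable instance : CoalgebraStruct ℤ CoordG where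
  comul := ∑ a : ZMod 2, ∑ b : ZMod 2,
    TensorProduct.map (extend a) (extend b ∘ₗ twist a) ∘ₗ Coalgebra.comul ∘ₗ restrict (a + b)
  counit := Coalgebra.counit ∘ₗ restrict 0

theorem hom_ext {M : Type*} [AddCommMonoid M] [Module ℤ M] {f g : CoordG →ₗ[ℤ] M}
    (h : ∀ a k, f (e a k) = g (e a k)) : f = g := by
  refine LinearMap.pi_ext' (φ := fun _ : ZMod 2 => AddMonoidAlgebra ℤ (ZMod 3)) fun a => ?_
  refine AddMonoidAlgebra.lhom_ext' fun k => ?_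
  refine LinearMap.ext_ring ?_
  exact h a k

theorem restrict_e (a b : ZMod 2) (k : ZMod 3) :
    restrict b (e a k) = if b = a then AddMonoidAlgebra.single k 1 else 0 := by
  change (Pi.single a (AddMonoidAlgebra.single k 1) : ZMod 2 → AddMonoidAlgebra ℤ (ZMod 3)) b = _
  by_cases h : b = a
  · subst h; simp
  · simp [h]

theorem extend_single (a : ZMod 2) (k : ZMod 3) :
    extend a (AddMonoidAlgebra.single k 1) = e a k := rfl

theorem twist_single (a : ZMod 2) (k : ZMod 3) :
    twist a (AddMonoidAlgebra.single k 1) = AddMonoidAlgebra.single (sgn a * k) 1 := by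
  simp [twist]

theorem comul_e (c : ZMod 2) (k : ZMod 3) :
    Coalgebra.comul (R := ℤ) (e c k) = ∑ a : ZMod 2, e a k ⊗ₜ[ℤ] e (c - a) (sgn a * k) := by
  have h : ∀ a b : ZMod 2, (a + b = c) = (b = c - a) := by decide +revert
  simp only [CoalgebraStruct.comul, LinearMap.sum_apply, LinearMap.comp_apply, restrict_e]
  refine Finset.sum_congr rfl fun a _ => ?_
  rw [Finset.sum_eq_single (c - a)]
  · simp [TensorProduct.map_tmul, extend_single, twist_single]
  · intro b _ hb
    simp [h, hb]
  · simp

theorem counit_e (c : ZMod 2) (k : ZMod 3) :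
    Coalgebra.counit (R := ℤ) (e c k) = if c = 0 then 1 else 0 := by
  simp only [CoalgebraStruct.counit, LinearMap.comp_apply, restrict_e, eq_comm]
  split_ifs <;> simp

theorem restrict_ext {x y : CoordG} (h : ∀ c, restrict c x = restrict c y) : x = y := funext h

theorem restrict_mul (c : ZMod 2) (x y : CoordG) :
    restrict c (x * y) = restrict c x * restrict c y := rfl

theorem e_mul_e (a b : ZMod 2) (k l : ZMod 3) :
    e a k * e b l = if a = b then e a (k + l) else 0 := by
  refine restrict_ext fun c => ?_
  rw [restrict_mul, restrict_e, restrict_e]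
  split_ifs <;> simp_all [restrict_e, AddMonoidAlgebra.single_mul_single]

theorem one_eq : (1 : CoordG) = ∑ a : ZMod 2, e a 0 := by
  change (1 : ZMod 2 → AddMonoidAlgebra ℤ (ZMod 3)) =
    ∑ a : ZMod 2, Pi.single (M := fun _ => AddMonoidAlgebra ℤ (ZMod 3)) a 1
  exact (Finset.univ_sum_single _).symm

theorem sum_zmod2 {M : Type*} [AddCommMonoid M] (f : ZMod 2 → M) :
    ∑ a : ZMod 2, f a = f 0 + f 1 := Fin.sum_univ_two f

noncomputable instance : Coalgebra ℤ CoordG where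
  coassoc := by
    refine hom_ext fun c k => ?_
    simp only [LinearMap.comp_apply, LinearEquiv.coe_coe, comul_e, map_sum,
      LinearMap.rTensor_tmul, LinearMap.lTensor_tmul, TensorProduct.sum_tmul,
      TensorProduct.tmul_sum, TensorProduct.assoc_tmul]
    rw [Finset.sum_comm]
    refine Finset.sum_congr rfl fun a _ => ?_
    have h1 : ∀ c x : ZMod 2, c - (x + a) = c - a - x := by intros; ring
    have h2 : ∀ (a x : ZMod 2) (k : ZMod 3), sgn (x + a) * k = sgn x * (sgn a * k) := by decide
    rw [← Equiv.sum_comp (Equiv.addRight a)]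
    simp [h1, h2]
  rTensor_counit_comp_comul := by
    refine hom_ext fun c k => ?_
    simp [comul_e, counit_e, TensorProduct.ite_tmul, sgn]
  lTensor_counit_comp_comul := by
    refine hom_ext fun c k => ?_
    simp [comul_e, counit_e, TensorProduct.tmul_ite, sub_eq_zero]

noncomputable instance : Bialgebra ℤ CoordG where
  counit_one := by
    simp [one_eq, counit_e]
  mul_compr₂_counit := by
    refine hom_ext fun a k => hom_ext fun b l => ?_
    by_cases h : a = b
    · subst h; simp [e_mul_e, counit_e]
    · simp [e_mul_e, counit_e, h]
      grind
  comul_one := by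
    simp only [one_eq, map_sum, comul_e, Algebra.TensorProduct.one_def, TensorProduct.sum_tmul,
      TensorProduct.tmul_sum, mul_zero]
    rw [Finset.sum_comm]
    conv_rhs => rw [Finset.sum_comm]
    refine Finset.sum_congr rfl fun a _ => ?_
    exact Equiv.sum_comp (Equiv.subRight a) fun b => e a 0 ⊗ₜ[ℤ] e b 0
  mul_compr₂_comul := by
    refine hom_ext fun a k => hom_ext fun b l => ?_
    by_cases h : a = b
    · subst h
      simp [e_mul_e, comul_e, ← mul_add, TensorProduct.tmul_ite, TensorProduct.ite_tmul]
    · simp [e_mul_e, comul_e, h]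
      refine (Finset.sum_eq_zero fun x _ => Finset.sum_eq_zero fun y _ => ?_).symm
      by_cases hxy : y = x
      · subst hxy; simp [h]
      · simp [hxy]

/-- The map induced by the inverse `(ζ, a) ↦ (ζ ^ (-(-1) ^ a), a)` of `G`. -/
noncomputable def antipodeMap : CoordG →ₗ[ℤ] CoordG :=
  ∑ a : ZMod 2, extend a ∘ₗ
    (AddMonoidAlgebra.mapDomainAlgHom ℤ ℤ (AddMonoidHom.mulLeft (- sgn a))).toLinearMap ∘ₗ
      restrict a

theorem antipodeMap_e (a : ZMod 2) (k : ZMod 3) : antipodeMap (e a k) = e a (- sgn a * k) := by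
  simp only [antipodeMap, LinearMap.sum_apply, LinearMap.comp_apply, restrict_e]
  rw [Finset.sum_eq_single a]
  · simp [← extend_single]
  · intro b _ hb
    simp [hb]
  · simp

noncomputable instance : HopfAlgebra ℤ CoordG where
  antipode := antipodeMap
  mul_antipode_rTensor_comul := by
    refine hom_ext fun c k => ?_
    simp [comul_e, antipodeMap_e, e_mul_e, counit_e]
    have h0 : ∀ x : ZMod 2, x = 0 - x := by decide
    have h1 : ∀ x : ZMod 2, ¬ x = 1 - x := by decide
    have hc : c = 0 ∨ c = 1 := by decide +revert
    rcases hc with rfl | rfl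
    · simp only [← h0, if_true, one_eq]
    · simp [h1]
  mul_antipode_lTensor_comul := by
    refine hom_ext fun c k => ?_
    simp [comul_e, antipodeMap_e, e_mul_e, counit_e]
    have h0 : ∀ x : ZMod 2, x = 0 - x := by decide
    have h1 : ∀ x : ZMod 2, ¬ x = 1 - x := by decide
    have h2 : ∀ (x : ZMod 2) (k : ZMod 3), k + -(sgn x * (sgn x * k)) = 0 := by decide
    have hc : c = 0 ∨ c = 1 := by decide +revert
    rcases hc with rfl | rfl
    · simp only [← h0, if_true, one_eq, h2]
    · simp [h1]

end CoordG
/-! ### Sheaves of modules on schemes -/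

section Sheaves

variable {T T' T'' : Scheme.{u}}

/-- Restriction of sections of `𝒪_T`. -/
noncomputable def resO {U V : T.Opens} (h : V ≤ U) : Γ(T, U) →+* Γ(T, V) :=
  (T.presheaf.map (homOfLE h).op).hom

/-- Restriction of sections of a sheaf of modules. -/
noncomputable def res (M : T.Modules) {U V : T.Opens} (h : V ≤ U) : Γ(M, U) →ₗ[ℤ] Γ(M, V) :=
  (M.presheaf.map (homOfLE h).op).hom.toIntLinearMap

theorem resO_refl {U : T.Opens} (r : Γ(T, U)) : resO le_rfl r = r := by
  change T.presheaf.map (𝟙 _) r = r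
  simp

theorem resO_resO {U V W : T.Opens} (h : V ≤ U) (h' : W ≤ V) (r : Γ(T, U)) :
    resO h' (resO h r) = resO (h'.trans h) r := by
  change (T.presheaf.map _ ≫ T.presheaf.map _) r = T.presheaf.map _ r
  rw [← T.presheaf.map_comp]; rfl

theorem res_refl (M : T.Modules) {U : T.Opens} (x : Γ(M, U)) : res M le_rfl x = x := by
  change M.presheaf.map (𝟙 _) x = x
  simp

theorem res_res (M : T.Modules) {U V W : T.Opens} (h : V ≤ U) (h' : W ≤ V) (x : Γ(M, U)) :
    res M h' (res M h x) = res M (h'.trans h) x := by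
  change (M.presheaf.map _ ≫ M.presheaf.map _) x = M.presheaf.map _ x
  rw [← M.presheaf.map_comp]; rfl

theorem res_smul (M : T.Modules) {U V : T.Opens} (h : V ≤ U) (r : Γ(T, U)) (x : Γ(M, U)) :
    res M h (r • x) = resO h r • res M h x :=
  M.map_smul (homOfLE h) r x

/-- The sections `b` form a basis of `M` over `U`: they induce an isomorphism `𝒪_U ^ ι ≅ M|_U`. -/
def IsLocalBasis (M : T.Modules) {U : T.Opens} {ι : Type} [Fintype ι] (b : ι → Γ(M, U)) : Prop :=
  ∀ (V : T.Opens) (h : V ≤ U),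
    Function.Bijective fun c : ι → Γ(T, V) => ∑ i, c i • res M h (b i)

/-- Locally free sheaves of rank `n`. -/
def LocallyFreeOfRank (M : T.Modules) (n : ℕ) : Prop :=
  ∀ t : T, ∃ U : T.Opens, t ∈ U ∧ ∃ b : Fin n → Γ(M, U), IsLocalBasis M b

/-- Locally free sheaves of finite (not necessarily constant) rank. -/
def LocallyFree (M : T.Modules) : Prop :=
  ∀ t : T, ∃ U : T.Opens, t ∈ U ∧ ∃ (n : ℕ) (b : Fin n → Γ(M, U)), IsLocalBasis M b

theorem LocallyFreeOfRank.locallyFree {M : T.Modules} {n : ℕ} (h : LocallyFreeOfRank M n) :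
    LocallyFree M := fun t =>
  let ⟨U, hU, b, hb⟩ := h t
  ⟨U, hU, n, b, hb⟩

/-- A morphism of sheaves `M ⊗ N → P`, given as an `𝒪_T`-bilinear map of sheaves. -/
structure BilinMap (M N P : T.Modules) where
  app (U : T.Opens) : Γ(M, U) →ₗ[Γ(T, U)] Γ(N, U) →ₗ[Γ(T, U)] Γ(P, U)
  res_app (U V : T.Opens) (h : V ≤ U) (x : Γ(M, U)) (y : Γ(N, U)) :
    res P h (app U x y) = app V (res M h x) (res N h y)

/-- A section over `U` of the sheaf of endomorphisms of `F`. -/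
structure LocalEnd (F : T.Modules) (U : T.Opens) where
  app (V : T.Opens) (h : V ≤ U) : Γ(F, V) →ₗ[Γ(T, V)] Γ(F, V)
  res_app (V W : T.Opens) (h : V ≤ U) (h' : W ≤ V) (x : Γ(F, V)) :
    res F h' (app V h x) = app W (h'.trans h) (res F h' x)

/-- A local basis gives a basis of the module of sections. -/
noncomputable def IsLocalBasis.toBasis {M : T.Modules} {U : T.Opens} {ι : Type} [Fintype ι]
    {b : ι → Γ(M, U)} (hb : IsLocalBasis M b) : Module.Basis ι Γ(T, U) Γ(M, U) :=
  Module.Basis.ofEquivFun (LinearEquiv.ofBijective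
    (Fintype.linearCombination Γ(T, U) b) (by
      have := hb U le_rfl
      simp only [res_refl] at this
      exact this)).symm

/-- The section `a` is the trace of `φ`: its restriction to each open on which `F` has a basis is
the trace of the corresponding matrix. -/
def LocalEnd.IsTrace {F : T.Modules} {U : T.Opens} (φ : LocalEnd F U) (a : Γ(T, U)) : Prop :=
  ∀ (V : T.Opens) (h : V ≤ U), (∃ (n : ℕ) (b : Fin n → Γ(F, V)), IsLocalBasis F b) →
    resO h a = LinearMap.trace Γ(T, V) Γ(F, V) (φ.app V h)

theorem IsLocalBasis.restrict {M : T.Modules} {U V : T.Opens} {ι : Type} [Fintype ι]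
    {b : ι → Γ(M, U)} (hb : IsLocalBasis M b) (h : V ≤ U) :
    IsLocalBasis M fun i => res M h (b i) := fun W h' => by
  simp only [res_res]
  exact hb W (h'.trans h)

theorem IsLocalBasis.toBasis_apply {M : T.Modules} {U : T.Opens} {ι : Type} [Fintype ι]
    {b : ι → Γ(M, U)} (hb : IsLocalBasis M b) (i : ι) : hb.toBasis i = b i := by
  classical
  rw [IsLocalBasis.toBasis, Module.Basis.coe_ofEquivFun]
  change Fintype.linearCombination Γ(T, U) b (Pi.single i 1) = b i
  simp

theorem LocalEnd.resO_trace {F : T.Modules} {U V W : T.Opens} (φ : LocalEnd F U) (h : V ≤ U)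
    (h' : W ≤ V) {n : ℕ} {b : Fin n → Γ(F, V)} (hb : IsLocalBasis F b) :
    resO h' (LinearMap.trace Γ(T, V) Γ(F, V) (φ.app V h)) =
      LinearMap.trace Γ(T, W) Γ(F, W) (φ.app W (h'.trans h)) := by
  have key : ∀ (x : Γ(F, V)) (i : Fin n),
      (hb.restrict h').toBasis.repr (res F h' x) i = resO h' (hb.toBasis.repr x i) := by
    intro x i
    have hB : ∀ j, res F h' (b j) = (hb.restrict h').toBasis j := fun j =>
      ((hb.restrict h').toBasis_apply j).symm
    generalize (hb.restrict h').toBasis = B at hB ⊢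
    conv_lhs => rw [← hb.toBasis.sum_repr x]
    rw [map_sum]
    simp only [res_smul, hb.toBasis_apply, hB]
    rw [Module.Basis.repr_sum_self]
  rw [LinearMap.trace_eq_matrix_trace _ hb.toBasis,
    LinearMap.trace_eq_matrix_trace _ (hb.restrict h').toBasis]
  simp only [Matrix.trace, Matrix.diag_apply, LinearMap.toMatrix_apply, map_sum, ← key,
    IsLocalBasis.toBasis_apply, φ.res_app]

theorem LocalEnd.existsUnique_isTrace {F : T.Modules} (hF : LocallyFree F) {U : T.Opens}
    (φ : LocalEnd F U) : ∃! a : Γ(T, U), φ.IsTrace a := by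
  have hF' : ∀ t : U, ∃ W : T.Opens, W ≤ U ∧ t.1 ∈ W ∧
      ∃ (n : ℕ) (b : Fin n → Γ(F, W)), IsLocalBasis F b := fun t => by
    obtain ⟨W, htW, n, b, hb⟩ := hF t.1
    exact ⟨W ⊓ U, inf_le_right, ⟨htW, t.2⟩, n, _, hb.restrict inf_le_left⟩
  choose W hWU htW hW using hF'
  have hcov : U ≤ iSup W := fun t ht => Opens.mem_iSup.mpr ⟨⟨t, ht⟩, htW ⟨t, ht⟩⟩
  have glue : ∃! a : Γ(T, U), ∀ i, resO (hWU i) a =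
      LinearMap.trace Γ(T, W i) Γ(F, W i) (φ.app (W i) (hWU i)) :=
    T.sheaf.existsUnique_gluing' W U (fun i => homOfLE (hWU i)) hcov
    (fun i => LinearMap.trace Γ(T, W i) Γ(F, W i) (φ.app (W i) (hWU i))) (fun i j => by
      obtain ⟨n, b, hb⟩ := hW i
      obtain ⟨n', b', hb'⟩ := hW j
      exact (φ.resO_trace (hWU i) (inf_le_left : W i ⊓ W j ≤ W i) hb).trans
        (φ.resO_trace (hWU j) (inf_le_right : W i ⊓ W j ≤ W j) hb').symm)
  obtain ⟨a, ha, hu⟩ := glue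
  refine ⟨a, fun V h hV => ?_, fun a' ha' => hu a' fun i => ha' (W i) (hWU i) (hW i)⟩
  obtain ⟨n, b, hb⟩ := hV
  refine T.sheaf.eq_of_locally_eq' (fun i => W i ⊓ V) V (fun i => homOfLE inf_le_right)
    (fun t ht => Opens.mem_iSup.mpr ⟨⟨t, h ht⟩, htW ⟨t, h ht⟩, ht⟩) _ _ fun i => ?_
  obtain ⟨n', b', hb'⟩ := hW i
  change resO _ (resO h a) = resO _ _
  rw [φ.resO_trace h inf_le_right hb, resO_resO,
    ← φ.resO_trace (hWU i) (inf_le_left : W i ⊓ V ≤ W i) hb', ← resO_resO (hWU i) inf_le_left]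
  rw [ha i]

/-- The trace of an endomorphism of `F|_U`, for `F` locally free. -/
noncomputable def LocalEnd.trace {F : T.Modules} (hF : LocallyFree F) {U : T.Opens}
    (φ : LocalEnd F U) : Γ(T, U) :=
  (φ.existsUnique_isTrace hF).choose

end Sheaves

section Cartesian

variable {T T' T'' : Scheme.{u}}

/-- For `f : T' ⟶ T`, a morphism `M → f_* M'` of sheaves of modules over `T` such that the
corresponding morphism `f^* M → M'` is an isomorphism. This definition is used only when `M` is
locally free; then `f^* M → M'` is an isomorphism if and only if `M → f_* M'` maps local
bases to local bases. -/
structure CartMap (f : T' ⟶ T) (M : T.Modules) (M' : T'.Modules) where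
  hom : M ⟶ (Scheme.Modules.pushforward f).obj M'
  isLocalBasis (U : T.Opens) (n : ℕ) (b : Fin n → Γ(M, U)) (hb : IsLocalBasis M b) :
    IsLocalBasis M' (U := f ⁻¹ᵁ U) fun i => hom.app U (b i)

namespace CartMap

variable {f : T' ⟶ T} {g : T'' ⟶ T'} {M : T.Modules} {M' : T'.Modules} {M'' : T''.Modules}

/-- The action on sections. -/
noncomputable def app (φ : CartMap f M M') (U : T.Opens) : Γ(M, U) →ₗ[ℤ] Γ(M', f ⁻¹ᵁ U) :=
  (φ.hom.app U).hom.toIntLinearMap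

/-- The identity. -/
noncomputable def id (M : T.Modules) : CartMap (𝟙 T) M M where
  hom := (Scheme.Modules.pushforwardId T).inv.app M
  isLocalBasis _ _ _ hb := hb

/-- Composition. -/
noncomputable def comp (ψ : CartMap g M' M'') (φ : CartMap f M M') : CartMap (g ≫ f) M M'' where
  hom := φ.hom ≫ (Scheme.Modules.pushforward f).map ψ.hom ≫
    (Scheme.Modules.pushforwardComp g f).hom.app M''
  isLocalBasis U n b hb := ψ.isLocalBasis _ n _ (φ.isLocalBasis U n b hb)

theorem id_app (U : T.Opens) (x : Γ(M, U)) : (id M).app U x = x := rfl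

theorem comp_app (ψ : CartMap g M' M'') (φ : CartMap f M M') (U : T.Opens) (x : Γ(M, U)) :
    (comp ψ φ).app U x = ψ.app (f ⁻¹ᵁ U) (φ.app U x) := rfl

theorem heq_of_app {f₁ f₂ : T' ⟶ T} (h : f₁ = f₂) (φ : CartMap f₁ M M') (ψ : CartMap f₂ M M')
    (H : ∀ (U : T.Opens) (V : T'.Opens) (h₁ : V ≤ f₁ ⁻¹ᵁ U) (h₂ : V ≤ f₂ ⁻¹ᵁ U) (x : Γ(M, U)),
      res M' h₁ (φ.app U x) = res M' h₂ (ψ.app U x)) : HEq φ ψ := by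
  subst h
  obtain ⟨φ, hφ⟩ := φ
  obtain ⟨ψ, hψ⟩ := ψ
  have : φ = ψ := by
    ext U x
    have := H U _ le_rfl le_rfl x
    rwa [res_refl, res_refl] at this
  subst this
  rfl

end CartMap

end Cartesian

/-! ### Building data -/

/-- Objects over `T` of the stack of building data: an invertible sheaf `L`, a locally free sheaf
`F` of rank two and morphisms `α : L ⊗ F → F`, `β : Sym² F → F` (a symmetric bilinear map) and
`⟨-,-⟩ : det F = Λ² F → L` (an alternating bilinear map). -/
structure BuildingData (T : Scheme.{u}) where
  L : T.Modules
  F : T.Modules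
  rank_L : LocallyFreeOfRank L 1
  rank_F : LocallyFreeOfRank F 2
  α : BilinMap L F F
  β : BilinMap F F F
  β_symm (U : T.Opens) (u v : Γ(F, U)) : β.app U u v = β.app U v u
  pairing : BilinMap F F L
  pairing_self (U : T.Opens) (u : Γ(F, U)) : pairing.app U u u = 0

namespace BuildingData

variable {T T' T'' : Scheme.{u}}

/-- The endomorphism `w ↦ α (s ⊗ α (t ⊗ w))` of `F|_U`. -/
noncomputable def squareEnd (χ : BuildingData T) (U : T.Opens) (s t : Γ(χ.L, U)) :
    LocalEnd χ.F U where
  app V h := χ.α.app V (res χ.L h s) ∘ₗ χ.α.app V (res χ.L h t)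
  res_app V W h h' x := by simp [χ.α.res_app V W h', res_res]

/-- The map `m = (1/2) tr (α ∘ (id ⊗ α)) : L ⊗ L → 𝒪_T`. -/
noncomputable def m (χ : BuildingData T) (U : T.Opens) (s t : Γ(χ.L, U)) : Γ(T, U) :=
  Ring.inverse 2 * (χ.squareEnd U s t).trace χ.rank_F.locallyFree

/-- The endomorphism `w ↦ α (⟨w, u⟩ ⊗ v)` of `F|_U`, that is, the section of `F^∨ ⊗ F = End(F)`
which is the image of `u ⊗ v` under `F ⊗ F ≅ F^∨ ⊗ det F ⊗ F → F^∨ ⊗ L ⊗ F → F^∨ ⊗ F`. -/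
noncomputable def bracketEnd (χ : BuildingData T) (U : T.Opens) (u v : Γ(χ.F, U)) :
    LocalEnd χ.F U where
  app V h := (χ.α.app V).flip (res χ.F h v) ∘ₗ (χ.pairing.app V).flip (res χ.F h u)
  res_app V W h h' x := by simp [χ.α.res_app V W h', χ.pairing.res_app V W h', res_res]

/-- The map `(-,-) : F ⊗ F ≅ F^∨ ⊗ det F ⊗ F → F^∨ ⊗ L ⊗ F → F^∨ ⊗ F → 𝒪_T`. Here the first
isomorphism is the one induced by `F ⊗ F → det F`: in a basis `y, z` it maps `y` to
`- z^* ⊗ (y ∧ z)` and `z` to `y^* ⊗ (y ∧ z)`. The evaluation `F^∨ ⊗ F → 𝒪_T` is the trace. -/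
noncomputable def bracket (χ : BuildingData T) (U : T.Opens) (u v : Γ(χ.F, U)) : Γ(T, U) :=
  (χ.bracketEnd U u v).trace χ.rank_F.locallyFree

/-- Morphisms `χ' → χ` over `f : T' ⟶ T`, that is, isomorphisms `χ' ≅ f^* χ`. -/
structure Hom (f : T' ⟶ T) (χ' : BuildingData T') (χ : BuildingData T) where
  mapL : CartMap f χ.L χ'.L
  mapF : CartMap f χ.F χ'.F
  map_α (U : T.Opens) (s : Γ(χ.L, U)) (u : Γ(χ.F, U)) :
    mapF.app U (χ.α.app U s u) = χ'.α.app (f ⁻¹ᵁ U) (mapL.app U s) (mapF.app U u)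
  map_β (U : T.Opens) (u v : Γ(χ.F, U)) :
    mapF.app U (χ.β.app U u v) = χ'.β.app (f ⁻¹ᵁ U) (mapF.app U u) (mapF.app U v)
  map_pairing (U : T.Opens) (u v : Γ(χ.F, U)) :
    mapL.app U (χ.pairing.app U u v) = χ'.pairing.app (f ⁻¹ᵁ U) (mapF.app U u) (mapF.app U v)

/-- The identity. -/
noncomputable def Hom.id (χ : BuildingData T) : Hom (𝟙 T) χ χ where
  mapL := .id χ.L
  mapF := .id χ.F
  map_α _ _ _ := rfl
  map_β _ _ _ := rfl
  map_pairing _ _ _ := rfl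

/-- Composition. -/
noncomputable def Hom.comp {f : T' ⟶ T} {g : T'' ⟶ T'} {χ'' : BuildingData T''}
    {χ' : BuildingData T'} {χ : BuildingData T} (ψ : Hom g χ'' χ') (φ : Hom f χ' χ) :
    Hom (g ≫ f) χ'' χ where
  mapL := .comp ψ.mapL φ.mapL
  mapF := .comp ψ.mapF φ.mapF
  map_α U s u := by simp only [CartMap.comp_app, φ.map_α, ψ.map_α]; rfl
  map_β U u v := by simp only [CartMap.comp_app, φ.map_β, ψ.map_β]; rfl
  map_pairing U u v := by simp only [CartMap.comp_app, φ.map_pairing, ψ.map_pairing]; rfl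

theorem Hom.heq_of_eq {f₁ f₂ : T' ⟶ T} (h : f₁ = f₂) {χ' : BuildingData T'} {χ : BuildingData T}
    (φ : Hom f₁ χ' χ) (ψ : Hom f₂ χ' χ) (hL : HEq φ.mapL ψ.mapL) (hF : HEq φ.mapF ψ.mapF) :
    HEq φ ψ := by
  subst h
  cases φ
  cases ψ
  cases hL
  cases hF
  rfl

/-- The five relations, required to hold for all local generators `t` of `L` and all local bases
`y, z` of `F`; using `t`, we regard `α` as `u ↦ α (t ⊗ u)`, the pairing `⟨-,-⟩` as taking values
in functions, and `m` as the function `m (t ⊗ t)`. -/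
def SatisfiesRelations (χ : BuildingData T) : Prop :=
  ∀ (U : T.Opens) (t : Γ(χ.L, U)) (y z : Γ(χ.F, U))
    (ht : IsLocalBasis χ.L fun _ : Fin 1 => t) (_ : IsLocalBasis χ.F ![y, z]),
    let α : Γ(χ.F, U) → Γ(χ.F, U) := fun u => χ.α.app U t u
    let β : Γ(χ.F, U) → Γ(χ.F, U) → Γ(χ.F, U) := fun u v => χ.β.app U u v
    let pair : Γ(χ.F, U) → Γ(χ.F, U) → Γ(T, U) := fun u v =>
      ht.toBasis.repr (χ.pairing.app U u v) 0
    let m : Γ(T, U) := χ.m U t t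
    (∀ u, α (α u) = m • u) ∧
    (∀ u v, pair (α u) v = pair (α v) u) ∧
    (∀ u v, α (β u v) = -β u (α v)) ∧
    (∀ u v w, β (β u v) w = pair (α w) v • u + pair v w • α u) ∧
    (∀ u v w, pair u (β v w) = pair w (β u v))

/-- The map `γ = (-,-) + ⟨-,-⟩ : F ⊗ F → 𝒪_T ⊕ L`. -/
noncomputable def γ (χ : BuildingData T) (U : T.Opens) (u v : Γ(χ.F, U)) :
    Γ(T, U) × Γ(χ.L, U) := (χ.bracket U u v, χ.pairing.app U u v)

/-- The map `γ' = (-,-) - ⟨-,-⟩ : F ⊗ F → 𝒪_T ⊕ L`. -/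
noncomputable def γ' (χ : BuildingData T) (U : T.Opens) (u v : Γ(χ.F, U)) :
    Γ(T, U) × Γ(χ.L, U) := (χ.bracket U u v, -χ.pairing.app U u v)

/-- The commutativity of the five diagrams of sheaves, evaluated on tensors of local sections. -/
structure SatisfiesDiagrams (χ : BuildingData T) : Prop where
  /-- `L ⊗ L ⊗ F₁ → F₁` -/
  diagram_A (U : T.Opens) (s t : Γ(χ.L, U)) (u : Γ(χ.F, U)) :
    χ.α.app U s (χ.α.app U t u) = χ.m U s t • u
  /-- `F ⊗ L ⊗ F → L` -/
  diagram_symm (U : T.Opens) (u : Γ(χ.F, U)) (l : Γ(χ.L, U)) (v : Γ(χ.F, U)) :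
    χ.pairing.app U u (χ.α.app U l v) = χ.pairing.app U (-χ.α.app U l u) v
  /-- `F₁ ⊗ F₁ ⊗ L → F₂` -/
  diagram_C (U : T.Opens) (u v : Γ(χ.F, U)) (l : Γ(χ.L, U)) :
    χ.β.app U u (χ.α.app U l v) = -χ.α.app U l (χ.β.app U u v)
  /-- `F₂ ⊗ F₂ ⊗ F₁ → F₂` -/
  diagram_D (U : T.Opens) (u v w : Γ(χ.F, U)) :
    χ.β.app U (χ.β.app U u v) w = (χ.γ' U v w).1 • u + -χ.α.app U (χ.γ' U v w).2 u
  /-- `F₁ ⊗ F₁ ⊗ F₁ → 𝒪_T ⊕ L` -/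
  diagram_E (U : T.Opens) (u v w : Γ(χ.F, U)) :
    χ.γ U u (χ.β.app U v w) = χ.γ' U (χ.β.app U u v) w

end BuildingData

/-! ### Sheaves with a coaction of `G` -/

section Coaction

variable {T : Scheme.{u}}

/-- A coaction `M → M ⊗ 𝒪(G)` of `G` on a sheaf of modules. -/
structure Coaction (M : T.Modules) where
  app (U : T.Opens) : Γ(M, U) →ₗ[Γ(T, U)] Γ(M, U) ⊗[ℤ] CoordG
  res_app (U V : T.Opens) (h : V ≤ U) (x : Γ(M, U)) :
    (res M h).rTensor CoordG (app U x) = app V (res M h x)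
  coassoc (U : T.Opens) (x : Γ(M, U)) :
    TensorProduct.assoc ℤ Γ(M, U) CoordG CoordG
        (((app U).restrictScalars ℤ).rTensor CoordG (app U x)) =
      Coalgebra.comul.lTensor Γ(M, U) (app U x)
  counit (U : T.Opens) (x : Γ(M, U)) :
    TensorProduct.rid ℤ Γ(M, U) (Coalgebra.counit.lTensor Γ(M, U) (app U x)) = x

namespace Coaction

variable {M : T.Modules} (ρ : Coaction M)

/-- The induced coaction of the subgroup `μ₃`. -/
noncomputable def mu (U : T.Opens) (x : Γ(M, U)) :
    Γ(M, U) ⊗[ℤ] AddMonoidAlgebra ℤ (ZMod 3) :=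
  (CoordG.restrict 0).lTensor Γ(M, U) (ρ.app U x)

/-- The action of the element `σ ∈ ℤ/2 ⊆ G`, that is, of the identity `ζ = 1` of the component
`1 ∈ ℤ/2` of `G`. -/
noncomputable def sigma (U : T.Opens) (x : Γ(M, U)) : Γ(M, U) :=
  TensorProduct.rid ℤ Γ(M, U)
    ((Coalgebra.counit ∘ₗ CoordG.restrict 1).lTensor Γ(M, U) (ρ.app U x))

/-- `M` is isomorphic, as a sheaf with a coaction of `G`, to the regular representation
`𝒪_T[G] = 𝒪_T ⊗ 𝒪(G)`, with coaction `id ⊗ Δ`. -/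
def IsRegular : Prop :=
  ∃ e : ∀ U : T.Opens, Γ(M, U) ≃ₗ[Γ(T, U)] Γ(T, U) ⊗[ℤ] CoordG,
    (∀ (U V : T.Opens) (h : V ≤ U) (x : Γ(M, U)),
      (resO h).toAddMonoidHom.toIntLinearMap.rTensor CoordG (e U x) = e V (res M h x)) ∧
    ∀ (U : T.Opens) (x : Γ(M, U)),
      TensorProduct.assoc ℤ Γ(T, U) CoordG CoordG
          (((e U).toLinearMap.restrictScalars ℤ).rTensor CoordG (ρ.app U x)) =
        Coalgebra.comul.lTensor Γ(T, U) (e U x)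

end Coaction

end Coaction

/-- Locally free sheaves with a coaction of `G`, an equivariant multiplication (not necessarily
commutative or associative) and an invariant unit. -/
structure EquivariantAlgebra (T : Scheme.{u}) where
  sheaf : T.Modules
  locallyFree : LocallyFree sheaf
  coaction : Coaction sheaf
  mul : BilinMap sheaf sheaf sheaf
  one : Γ(sheaf, ⊤)
  one_mul (U : T.Opens) (x : Γ(sheaf, U)) : mul.app U (res sheaf le_top one) x = x
  mul_one (U : T.Opens) (x : Γ(sheaf, U)) : mul.app U x (res sheaf le_top one) = x
  /-- `A ⊗ A → A` is equivariant. -/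
  coaction_mul (U : T.Opens) (x y : Γ(sheaf, U)) :
    coaction.app U (mul.app U x y) =
      TensorProduct.map₂ ((mul.app U).restrictScalars₁₂ ℤ ℤ) (LinearMap.mul ℤ CoordG)
        (coaction.app U x) (coaction.app U y)
  coaction_one : coaction.app ⊤ one = one ⊗ₜ 1

namespace EquivariantAlgebra

variable {T T' T'' : Scheme.{u}}

/-- The unit section over `U`. -/
noncomputable def oneOn (A : EquivariantAlgebra T) (U : T.Opens) : Γ(A.sheaf, U) :=
  res A.sheaf le_top A.one

/-- Morphisms `A' → A` over `f : T' ⟶ T`, that is, isomorphisms `A' ≅ f^* A`. -/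
structure Hom (f : T' ⟶ T) (A' : EquivariantAlgebra T') (A : EquivariantAlgebra T) where
  map : CartMap f A.sheaf A'.sheaf
  map_coaction (U : T.Opens) (x : Γ(A.sheaf, U)) :
    (map.app U).rTensor CoordG (A.coaction.app U x) = A'.coaction.app (f ⁻¹ᵁ U) (map.app U x)
  map_mul (U : T.Opens) (x y : Γ(A.sheaf, U)) :
    map.app U (A.mul.app U x y) = A'.mul.app (f ⁻¹ᵁ U) (map.app U x) (map.app U y)
  map_one (U : T.Opens) : map.app U (A.oneOn U) = A'.oneOn (f ⁻¹ᵁ U)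

/-- The identity. -/
noncomputable def Hom.id (A : EquivariantAlgebra T) : Hom (𝟙 T) A A where
  map := .id A.sheaf
  map_coaction U x := by
    change (LinearMap.id : Γ(A.sheaf, U) →ₗ[ℤ] Γ(A.sheaf, U)).rTensor CoordG _ = _
    rw [LinearMap.rTensor_id]
    rfl
  map_mul _ _ _ := rfl
  map_one _ := rfl

/-- Composition. -/
noncomputable def Hom.comp {f : T' ⟶ T} {g : T'' ⟶ T'} {A'' : EquivariantAlgebra T''}
    {A' : EquivariantAlgebra T'} {A : EquivariantAlgebra T} (ψ : Hom g A'' A') (φ : Hom f A' A) :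
    Hom (g ≫ f) A'' A where
  map := .comp ψ.map φ.map
  map_coaction U x := by
    change (ψ.map.app (f ⁻¹ᵁ U) ∘ₗ φ.map.app U).rTensor CoordG _ = _
    rw [LinearMap.rTensor_comp, LinearMap.comp_apply, φ.map_coaction, ψ.map_coaction]
    rfl
  map_mul U x y := by simp only [CartMap.comp_app, φ.map_mul, ψ.map_mul]; rfl
  map_one U := by simp only [CartMap.comp_app, φ.map_one, ψ.map_one]; rfl

theorem Hom.heq_of_eq {f₁ f₂ : T' ⟶ T} (h : f₁ = f₂) {A' : EquivariantAlgebra T'}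
    {A : EquivariantAlgebra T} (φ : Hom f₁ A' A) (ψ : Hom f₂ A' A) (hm : HEq φ.map ψ.map) :
    HEq φ ψ := by
  subst h
  cases φ
  cases ψ
  cases hm
  rfl

/-- `A` is (the sheaf of algebras of) a `G`-cover of `T`: it is commutative and associative and,
locally in the fppf topology, it is isomorphic as a sheaf with a coaction of `G` to the regular
representation. -/
structure IsGCover (A : EquivariantAlgebra T) : Prop where
  mul_comm (U : T.Opens) (x y : Γ(A.sheaf, U)) : A.mul.app U x y = A.mul.app U y x
  mul_assoc (U : T.Opens) (x y z : Γ(A.sheaf, U)) :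
    A.mul.app U (A.mul.app U x y) z = A.mul.app U x (A.mul.app U y z)
  /-- There are an fppf cover `{f_i : T_i → T}` and pullbacks `f_i^* A ≅ M`, with their coactions,
  which are regular representations. -/
  exists_regular : ∃ 𝒰 : Scheme.Cover.{u} Scheme.fppfPrecoverage T, ∀ i : 𝒰.I₀,
    ∃ (M : (𝒰.X i).Modules) (ρ : Coaction M) (φ : CartMap (𝒰.f i) A.sheaf M),
      (∀ (U : T.Opens) (x : Γ(A.sheaf, U)),
        (φ.app U).rTensor CoordG (A.coaction.app U x) = ρ.app (𝒰.f i ⁻¹ᵁ U) (φ.app U x)) ∧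
      ρ.IsRegular

end EquivariantAlgebra

/-! ### The stacks over `ℤ[1/2]` -/

/-- The base scheme `Spec ℤ[1/2]`. -/
noncomputable abbrev base : Scheme.{u} :=
  Spec (CommRingCat.of (ULift.{u} (Localization.Away (2 : ℤ))))

/-- The stack `𝒴` of building data, as a category over the category of `ℤ[1/2]`-schemes. -/
structure StackY where
  scheme : Over base.{u}
  data : BuildingData scheme.left

/-- The stack of `G`-equivariant algebras, as a category over the category of
`ℤ[1/2]`-schemes. -/
structure StackLRings where
  scheme : Over base.{u}
  data : EquivariantAlgebra scheme.left

/-- Morphisms in the stack of building data. -/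
@[ext]
structure StackY.Hom (X Y : StackY.{u}) where
  scheme : X.scheme ⟶ Y.scheme
  data : BuildingData.Hom scheme.left X.data Y.data

/-- Morphisms in the stack of equivariant algebras. -/
@[ext]
structure StackLRings.Hom (X Y : StackLRings.{u}) where
  scheme : X.scheme ⟶ Y.scheme
  data : EquivariantAlgebra.Hom scheme.left X.data Y.data

noncomputable instance : Category StackY.{u} where
  Hom := StackY.Hom
  id X := ⟨𝟙 _, .id X.data⟩
  comp φ ψ := ⟨φ.scheme ≫ ψ.scheme, .comp φ.data ψ.data⟩
  id_comp φ := StackY.Hom.ext (Category.id_comp _) <|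
    BuildingData.Hom.heq_of_eq (congrArg CommaMorphism.left (Category.id_comp φ.scheme)) _ _
      (CartMap.heq_of_app (congrArg CommaMorphism.left (Category.id_comp φ.scheme)) _ _
        fun _ _ _ _ _ => rfl)
      (CartMap.heq_of_app (congrArg CommaMorphism.left (Category.id_comp φ.scheme)) _ _
        fun _ _ _ _ _ => rfl)
  comp_id φ := StackY.Hom.ext (Category.comp_id _) <|
    BuildingData.Hom.heq_of_eq (congrArg CommaMorphism.left (Category.comp_id φ.scheme)) _ _
      (CartMap.heq_of_app (congrArg CommaMorphism.left (Category.comp_id φ.scheme)) _ _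
        fun _ _ _ _ _ => rfl)
      (CartMap.heq_of_app (congrArg CommaMorphism.left (Category.comp_id φ.scheme)) _ _
        fun _ _ _ _ _ => rfl)
  assoc φ ψ θ := StackY.Hom.ext (Category.assoc _ _ _) <|
    BuildingData.Hom.heq_of_eq
      (congrArg CommaMorphism.left (Category.assoc φ.scheme ψ.scheme θ.scheme)) _ _
      (CartMap.heq_of_app
        (congrArg CommaMorphism.left (Category.assoc φ.scheme ψ.scheme θ.scheme)) _ _
        fun _ _ _ _ _ => rfl)
      (CartMap.heq_of_app
        (congrArg CommaMorphism.left (Category.assoc φ.scheme ψ.scheme θ.scheme)) _ _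
        fun _ _ _ _ _ => rfl)

noncomputable instance : Category StackLRings.{u} where
  Hom := StackLRings.Hom
  id X := ⟨𝟙 _, .id X.data⟩
  comp φ ψ := ⟨φ.scheme ≫ ψ.scheme, .comp φ.data ψ.data⟩
  id_comp φ := StackLRings.Hom.ext (Category.id_comp _) <|
    EquivariantAlgebra.Hom.heq_of_eq (congrArg CommaMorphism.left (Category.id_comp φ.scheme)) _ _
      (CartMap.heq_of_app (congrArg CommaMorphism.left (Category.id_comp φ.scheme)) _ _
        fun _ _ _ _ _ => rfl)
  comp_id φ := StackLRings.Hom.ext (Category.comp_id _) <|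
    EquivariantAlgebra.Hom.heq_of_eq (congrArg CommaMorphism.left (Category.comp_id φ.scheme)) _ _
      (CartMap.heq_of_app (congrArg CommaMorphism.left (Category.comp_id φ.scheme)) _ _
        fun _ _ _ _ _ => rfl)
  assoc φ ψ θ := StackLRings.Hom.ext (Category.assoc _ _ _) <|
    EquivariantAlgebra.Hom.heq_of_eq
      (congrArg CommaMorphism.left (Category.assoc φ.scheme ψ.scheme θ.scheme)) _ _
      (CartMap.heq_of_app
        (congrArg CommaMorphism.left (Category.assoc φ.scheme ψ.scheme θ.scheme)) _ _
        fun _ _ _ _ _ => rfl)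

/-- A morphism of stacks over `ℤ[1/2]` from building data to equivariant algebras: a functor which
does not change the underlying schemes and the underlying morphisms of schemes. -/
structure StackMap where
  obj (X : StackY.{u}) : EquivariantAlgebra X.scheme.left
  map {X Y : StackY.{u}} (φ : X ⟶ Y) :
    EquivariantAlgebra.Hom (StackY.Hom.scheme φ).left (obj X) (obj Y)
  map_id (X : StackY.{u}) : map (𝟙 X) = .id (obj X)
  map_comp {X Y Z : StackY.{u}} (φ : X ⟶ Y) (ψ : Y ⟶ Z) :
    map (φ ≫ ψ) = .comp (map φ) (map ψ)

namespace StackMap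

/-- The underlying functor. -/
noncomputable def toFunctor (Φ : StackMap.{u}) : StackY.{u} ⥤ StackLRings.{u} where
  obj X := ⟨X.scheme, Φ.obj X⟩
  map {X Y} φ := show StackLRings.Hom ⟨X.scheme, Φ.obj X⟩ ⟨Y.scheme, Φ.obj Y⟩ from
    ⟨StackY.Hom.scheme φ, Φ.map φ⟩
  map_id X := StackLRings.Hom.ext rfl (heq_of_eq (Φ.map_id X))
  map_comp φ ψ := StackLRings.Hom.ext rfl (heq_of_eq (Φ.map_comp φ ψ))

/-- `Φ` restricts to an equivalence of stacks from the full substack `P` of the stack of building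
data to the full substack `Q` of the stack of equivariant algebras: it maps `P` to `Q`, the induced
functor is an equivalence of categories, and every object of `Q` over a scheme `T` is isomorphic,
over the identity of `T`, to the image of an object of `P` over `T`. -/
def InducesEquivalence (Φ : StackMap.{u}) (P : ObjectProperty StackY.{u})
    (Q : ObjectProperty StackLRings.{u}) : Prop :=
  (∃ h : ∀ X : P.FullSubcategory, Q ((P.ι ⋙ Φ.toFunctor).obj X),
    (Q.lift (P.ι ⋙ Φ.toFunctor) h).IsEquivalence) ∧
  ∀ (T : Over base.{u}) (A : EquivariantAlgebra T.left), Q ⟨T, A⟩ →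
    ∃ χ : BuildingData T.left, P ⟨T, χ⟩ ∧
      Nonempty (EquivariantAlgebra.Hom (𝟙 T.left) (Φ.obj ⟨T, χ⟩) A)

end StackMap

/-- An identification of the equivariant algebra `A` with `A_χ = 𝒪_T ⊕ L ⊕ F₁ ⊕ F₂`, where
`F₁ = F₂ = F`, with its coaction of `G` and its multiplication. The summand `𝒪_T` is embedded by
means of the unit of `A`. -/
structure AlgebraPresentation {T : Scheme.{u}} (χ : BuildingData T)
    (A : EquivariantAlgebra T) where
  ιL : χ.L ⟶ A.sheaf
  ι₁ : χ.F ⟶ A.sheaf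
  ι₂ : χ.F ⟶ A.sheaf
  bijective (U : T.Opens) : Function.Bijective
    fun x : Γ(T, U) × Γ(χ.L, U) × Γ(χ.F, U) × Γ(χ.F, U) =>
      x.1 • A.oneOn U + ιL.app U x.2.1 + ι₁.app U x.2.2.1 + ι₂.app U x.2.2.2
  /-- `𝒪_T ⊕ L`, `F₁`, `F₂` are the components of degree `0, 1, 2` for the coaction of `μ₃`. -/
  mu_L (U : T.Opens) (s : Γ(χ.L, U)) :
    A.coaction.mu U (ιL.app U s) = ιL.app U s ⊗ₜ AddMonoidAlgebra.single 0 1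
  mu_F₁ (U : T.Opens) (u : Γ(χ.F, U)) :
    A.coaction.mu U (ι₁.app U u) = ι₁.app U u ⊗ₜ AddMonoidAlgebra.single 1 1
  mu_F₂ (U : T.Opens) (u : Γ(χ.F, U)) :
    A.coaction.mu U (ι₂.app U u) = ι₂.app U u ⊗ₜ AddMonoidAlgebra.single 2 1
  /-- `σ` acts as `-id` on `L` and exchanges `F₁` and `F₂`. -/
  sigma_L (U : T.Opens) (s : Γ(χ.L, U)) : A.coaction.sigma U (ιL.app U s) = -ιL.app U s
  sigma_F₁ (U : T.Opens) (u : Γ(χ.F, U)) : A.coaction.sigma U (ι₁.app U u) = ι₂.app U u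
  sigma_F₂ (U : T.Opens) (u : Γ(χ.F, U)) : A.coaction.sigma U (ι₂.app U u) = ι₁.app U u
  /-- The multiplication. -/
  mul_L_L (U : T.Opens) (s t : Γ(χ.L, U)) :
    A.mul.app U (ιL.app U s) (ιL.app U t) = χ.m U s t • A.oneOn U
  mul_L_F₁ (U : T.Opens) (s : Γ(χ.L, U)) (u : Γ(χ.F, U)) :
    A.mul.app U (ιL.app U s) (ι₁.app U u) = ι₁.app U (χ.α.app U s u)
  mul_L_F₂ (U : T.Opens) (s : Γ(χ.L, U)) (u : Γ(χ.F, U)) :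
    A.mul.app U (ιL.app U s) (ι₂.app U u) = ι₂.app U (-χ.α.app U s u)
  mul_F₁_L (U : T.Opens) (u : Γ(χ.F, U)) (s : Γ(χ.L, U)) :
    A.mul.app U (ι₁.app U u) (ιL.app U s) = ι₁.app U (χ.α.app U s u)
  mul_F₂_L (U : T.Opens) (u : Γ(χ.F, U)) (s : Γ(χ.L, U)) :
    A.mul.app U (ι₂.app U u) (ιL.app U s) = ι₂.app U (-χ.α.app U s u)
  mul_F₁_F₁ (U : T.Opens) (u v : Γ(χ.F, U)) :
    A.mul.app U (ι₁.app U u) (ι₁.app U v) = ι₂.app U (χ.β.app U u v)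
  mul_F₂_F₂ (U : T.Opens) (u v : Γ(χ.F, U)) :
    A.mul.app U (ι₂.app U u) (ι₂.app U v) = ι₁.app U (χ.β.app U u v)
  mul_F₁_F₂ (U : T.Opens) (u v : Γ(χ.F, U)) :
    A.mul.app U (ι₁.app U u) (ι₂.app U v) =
      χ.bracket U u v • A.oneOn U + ιL.app U (χ.pairing.app U u v)
  mul_F₂_F₁ (U : T.Opens) (u v : Γ(χ.F, U)) :
    A.mul.app U (ι₂.app U u) (ι₁.app U v) =
      χ.bracket U u v • A.oneOn U - ιL.app U (χ.pairing.app U u v)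

/-- The morphism of stacks `Φ` is `χ ↦ A_χ`: on objects by means of presentations of the algebras
`Φ(χ)`, and on morphisms `(a, b)` as `id ⊕ a ⊕ b ⊕ b` by means of these presentations. -/
structure StackMap.Presentation (Φ : StackMap.{u}) where
  pres (X : StackY.{u}) : AlgebraPresentation X.data (Φ.obj X)
  map_L {X Y : StackY.{u}} (φ : X ⟶ Y) (U : Y.scheme.left.Opens) (s : Γ(Y.data.L, U)) :
    (Φ.map φ).map.app U ((pres Y).ιL.app U s) =
      (pres X).ιL.app ((StackY.Hom.scheme φ).left ⁻¹ᵁ U) ((StackY.Hom.data φ).mapL.app U s)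
  map_F₁ {X Y : StackY.{u}} (φ : X ⟶ Y) (U : Y.scheme.left.Opens) (u : Γ(Y.data.F, U)) :
    (Φ.map φ).map.app U ((pres Y).ι₁.app U u) =
      (pres X).ι₁.app ((StackY.Hom.scheme φ).left ⁻¹ᵁ U) ((StackY.Hom.data φ).mapF.app U u)
  map_F₂ {X Y : StackY.{u}} (φ : X ⟶ Y) (U : Y.scheme.left.Opens) (u : Γ(Y.data.F, U)) :
    (Φ.map φ).map.app U ((pres Y).ι₂.app U u) =
      (pres X).ι₂.app ((StackY.Hom.scheme φ).left ⁻¹ᵁ U) ((StackY.Hom.data φ).mapF.app U u)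

end SThreeCover

/-!
A coaction of `G = μ₃ ⋊ ℤ/2` on a sheaf is the same as a grading by `ℤ/3`, given by projections
`p k`, together with an involution `σ` which maps the part of degree `k` to the part of degree `-k`
(`GModule`, `Coaction.gmod`). As `2` is invertible, the part of degree `0` is moreover the sum of
the two parts on which `σ` acts as `1` and as `-1`. In this language the multiplication of an
equivariant algebra respects the degrees and commutes with `σ`.

*The map of stacks.* The algebra `A_χ` is the direct sum `𝒪_T ⊕ L ⊕ F ⊕ F` with the prescribed
multiplication (`BuildingData.algebra`), and `BuildingData.presentation` exhibits its four
summands. All further arguments use only such a presentation of an algebra `A`. A morphism of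
algebras commutes with the coactions, so that it maps `L` to `L` and `F₁` to `F₁`, and its
component on `F₂` is determined by that on `F₁` through `σ`; it is compatible with the components
`α`, `β` and `⟨-,-⟩` of the multiplication. Conversely, a pair `(a, b)` compatible with these maps
is also compatible with `m` and `(-,-)`, which are defined from them. This is full faithfulness
(`mapHom`, `dataHom`, `AlgebraPresentation.hom_ext`).

*The relations.* Two facts make `m` and `(-,-)` manageable. The function `(u, v)` acts on the
invertible sheaf `L` as `l ↦ ⟨α(l ⊗ v), u⟩` (`bracket_smul`), which determines it; and if the
composite of `α(s ⊗ -)` and `α(t ⊗ -)` is a homothety, then its factor is `m(s ⊗ t)`, because `F`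
has rank `2` (`m_eq_of_smul`). With them the local relations and the diagrams both become the
equations `BuildingData.Relations`, in which no generator of `L` occurs. These equations hold if
and only if the multiplication of `A` is commutative and associative (`relations_of_comm_assoc`,
`comm_of_relations`, `assoc_of_relations`): each of them is a component of associativity or of
commutativity, and conversely the associativity at triples of summands reduces, by commutativity
and by `σ`, to a few cases in which it is one of the equations.

*`A_χ` is locally regular.* A linear form on a `G`-module defines an equivariant map to the
regular representation. Where `t` generates `L` and `y, z` is a basis of `F`, the form with value
`1` on `1`, on `t`, on `y ∈ F₁` and on `z ∈ F₂`, and `0` on the other basis elements, gives an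
isomorphism, as `2` is invertible (`form_bijective`). Hence `A_χ` is a `G`-cover as soon as it is
commutative and associative (`isGCover`).

*Every `G`-cover is some `A_χ`.* Conversely, the projections of a `G`-cover onto its isotypic
parts are idempotents, so that these parts are direct summands of a locally free sheaf, hence
locally free (`exists_split`). Their ranks can be computed on an fppf cover, where the algebra is
the regular representation; they are `1` for the invariants and for `L`, and `2` for `F`
(`card_eq_of_fixed`, `locallyFreeOfRank_of_split`). The invariants are then generated by the unit
(`EquivariantAlgebra.isLocalBasis_one`), so they are `𝒪_T`, and the components of the
multiplication are the building data (`IsGCover.nonempty_summands`, `exists_presentation`). That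
the component of `F₁ ⊗ F₂` in `𝒪_T` is `(-,-)` and that of `L ⊗ L` is `m` follows from
associativity by the two facts above.
-/

/-! ### Sections of sheaves of modules -/

namespace SThreeCover

section SheafTools

variable {T T' : Scheme.{u}}

/-- A morphism of sheaves of modules, from linear maps on sections compatible with restriction. -/
noncomputable def homMk {M N : T.Modules} (g : ∀ U : T.Opens, Γ(M, U) →ₗ[Γ(T, U)] Γ(N, U))
    (hg : ∀ (U V : T.Opens) (h : V ≤ U) (x : Γ(M, U)), res N h (g U x) = g V (res M h x)) :
    M ⟶ N :=
  SheafOfModules.Hom.mk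
    { app := fun U => ModuleCat.ofHom (X := M.val.obj U) (Y := N.val.obj U) (g U.unop)
      naturality := fun {U V} i => by
        ext x
        exact (hg U.unop V.unop (leOfHom i.unop) x).symm }

/-- The action of a morphism of sheaves of modules on sections, as a linear map. -/
noncomputable def appL {M N : T.Modules} (φ : M ⟶ N) (U : T.Opens) :
    Γ(M, U) →ₗ[Γ(T, U)] Γ(N, U) where
  toFun x := φ.app U x
  map_add' x y := map_add (φ.app U).hom x y
  map_smul' r x := φ.app_smul r x

theorem appL_apply {M N : T.Modules} (φ : M ⟶ N) (U : T.Opens) (x : Γ(M, U)) :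
    appL φ U x = φ.app U x := rfl

theorem res_hom_app {M N : T.Modules} (φ : M ⟶ N) {U V : T.Opens} (h : V ≤ U) (x : Γ(M, U)) :
    res N h (φ.app U x) = φ.app V (res M h x) :=
  (ConcreteCategory.congr_hom (φ.mapPresheaf.naturality (homOfLE h).op) x).symm

/-- The structure sheaf as a sheaf of modules. -/
noncomputable def unitSheaf (T : Scheme.{u}) : T.Modules :=
  SheafOfModules.unit T.ringCatSheaf

theorem unitSheaf_res {U V : T.Opens} (h : V ≤ U) (x : Γ(T, U)) :
    res (unitSheaf T) (U := U) h x = resO h x := rfl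

theorem unitSheaf_smul {U : T.Opens} (r x : Γ(T, U)) :
    (HSMul.hSMul (α := Γ(T, U)) (β := Γ(unitSheaf T, U)) r x) = r * x := rfl

theorem section_ext (M : T.Modules) {U : T.Opens} {x y : Γ(M, U)}
    (H : ∀ t ∈ U, ∃ (V : T.Opens) (h : V ≤ U), t ∈ V ∧ res M h x = res M h y) : x = y := by
  choose V h ht hx using fun t : U => H t.1 t.2
  exact TopCat.Sheaf.eq_of_locally_eq' ⟨M.presheaf, M.isSheaf⟩ V U (fun i => homOfLE (h i))
    (fun t ht' => Opens.mem_iSup.mpr ⟨⟨t, ht'⟩, ht _⟩) x y hx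

theorem sectionO_ext {U : T.Opens} {x y : Γ(T, U)}
    (H : ∀ t ∈ U, ∃ (V : T.Opens) (h : V ≤ U), t ∈ V ∧ resO h x = resO h y) : x = y :=
  section_ext (unitSheaf T) H

theorem section_glue (M : T.Modules) {U : T.Opens} {ι : Type u} (V : ι → T.Opens)
    (hV : ∀ i, V i ≤ U) (hcov : ∀ t ∈ U, ∃ i, t ∈ V i) (s : ∀ i, Γ(M, V i))
    (hs : ∀ i j, res M (inf_le_left : V i ⊓ V j ≤ V i) (s i) = res M inf_le_right (s j)) :
    ∃ x : Γ(M, U), ∀ i, res M (hV i) x = s i :=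
  (TopCat.Sheaf.existsUnique_gluing' ⟨M.presheaf, M.isSheaf⟩ V U (fun i => homOfLE (hV i))
    (fun t ht' => Opens.mem_iSup.mpr (hcov t ht')) s fun i j => hs i j).exists

/-- A morphism `M → f_* M'`, from semilinear maps on sections compatible with restriction. -/
noncomputable def pushMk (f : T' ⟶ T) {M : T.Modules} {M' : T'.Modules}
    (g : ∀ U : T.Opens, Γ(M, U) →+ Γ(M', f ⁻¹ᵁ U))
    (hs : ∀ (U : T.Opens) (r : Γ(T, U)) (x : Γ(M, U)), g U (r • x) = f.app U r • g U x)
    (hg : ∀ (U V : T.Opens) (h : V ≤ U) (x : Γ(M, U)),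
      res M' (f.preimage_mono h) (g U x) = g V (res M h x)) :
    M ⟶ (Scheme.Modules.pushforward f).obj M' :=
  homMk (N := (Scheme.Modules.pushforward f).obj M')
    (fun U => { toFun := g U, map_add' := (g U).map_add, map_smul' := hs U }) hg

/-- The action on sections of a morphism `M → f_* M'`. -/
noncomputable def pushApp {f : T' ⟶ T} {M : T.Modules} {M' : T'.Modules}
    (φ : M ⟶ (Scheme.Modules.pushforward f).obj M') (U : T.Opens) :
    Γ(M, U) →ₗ[ℤ] Γ(M', f ⁻¹ᵁ U) :=
  (φ.app U).hom.toIntLinearMap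

theorem pushApp_smul {f : T' ⟶ T} {M : T.Modules} {M' : T'.Modules}
    (φ : M ⟶ (Scheme.Modules.pushforward f).obj M') (U : T.Opens) (r : Γ(T, U)) (x : Γ(M, U)) :
    pushApp φ U (r • x) = f.app U r • pushApp φ U x :=
  φ.app_smul r x

theorem res_pushApp {f : T' ⟶ T} {M : T.Modules} {M' : T'.Modules}
    (φ : M ⟶ (Scheme.Modules.pushforward f).obj M') {U V : T.Opens} (h : V ≤ U) (x : Γ(M, U)) :
    res M' (f.preimage_mono h) (pushApp φ U x) = pushApp φ V (res M h x) :=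
  res_hom_app φ h x

theorem CartMap.app_smul {f : T' ⟶ T} {M : T.Modules} {M' : T'.Modules} (φ : CartMap f M M')
    (U : T.Opens) (r : Γ(T, U)) (x : Γ(M, U)) : φ.app U (r • x) = f.app U r • φ.app U x :=
  pushApp_smul φ.hom U r x

theorem CartMap.res_app {f : T' ⟶ T} {M : T.Modules} {M' : T'.Modules} (φ : CartMap f M M')
    {U V : T.Opens} (h : V ≤ U) (x : Γ(M, U)) :
    res M' (f.preimage_mono h) (φ.app U x) = φ.app V (res M h x) :=
  res_pushApp φ.hom h x

theorem resO_app (f : T' ⟶ T) {U V : T.Opens} (h : V ≤ U) (r : Γ(T, U)) :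
    resO (f.preimage_mono h) (f.app U r) = f.app V (resO h r) :=
  (ConcreteCategory.congr_hom (f.naturality (homOfLE h).op) r).symm

@[ext]
theorem CartMap.ext_app {f : T' ⟶ T} {M : T.Modules} {M' : T'.Modules} {φ ψ : CartMap f M M'}
    (h : ∀ (U : T.Opens) (x : Γ(M, U)), φ.app U x = ψ.app U x) : φ = ψ :=
  eq_of_heq (CartMap.heq_of_app rfl φ ψ fun U V h₁ _ x => by rw [h])

end SheafTools
end SThreeCover

/-! ### Local bases and traces -/

namespace SThreeCover

section LocalBases

theorem bijective_retract {R N A : Type*} [CommRing R] [AddCommGroup N] [Module R N]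
    [AddCommGroup A] [Module R A] {κ κ' : Type*} [Fintype κ] [Fintype κ'] (i : N →ₗ[R] A)
    (e : A →ₗ[R] N) (hie : ∀ x, e (i x) = x) (b : κ → N) (d : κ' → A) (hd : ∀ k, e (d k) = 0)
    (h : Function.Bijective fun c : κ ⊕ κ' → R => ∑ k, c k • Sum.elim (fun k => i (b k)) d k) :
    Function.Bijective fun c : κ → R => ∑ k, c k • b k := by
  constructor
  · intro c c' hc
    have := @h.1 (Sum.elim c 0) (Sum.elim c' 0) (by
      have := congrArg i hc
      simpa using this)
    funext k
    exact congrFun this (Sum.inl k)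
  · intro x
    obtain ⟨c, hc⟩ := h.2 (i x)
    refine ⟨fun k => c (Sum.inl k), ?_⟩
    have := congrArg e hc
    simpa [hie, hd] using this

/-- If a semilinear map sends one finite basis to a basis, it sends every finite basis to a basis,
also when the two index sets have different cardinalities, as may happen over the zero ring. -/
theorem bijective_of_semilinear {R S M N : Type*} [CommRing R] [CommRing S] [AddCommGroup M]
    [Module R M] [AddCommGroup N] [Module S N] (f : R →+* S) (φ : M →ₛₗ[f] N) {ι κ : Type*}
    [Fintype ι] [Fintype κ] (b : ι → M) (c : κ → M)
    (hb : Function.Bijective fun x : ι → R => ∑ i, x i • b i)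
    (hc : Function.Bijective fun x : κ → R => ∑ i, x i • c i)
    (hφ : Function.Bijective fun x : κ → S => ∑ i, x i • φ (c i)) :
    Function.Bijective fun x : ι → S => ∑ i, x i • φ (b i) := by
  classical
  choose P hP using fun i => hc.2 (b i)
  choose Q hQ using fun k => hb.2 (c k)
  simp only at hP hQ
  have key : ∀ x : ι → S, ∑ i, x i • φ (b i) = ∑ k, (∑ i, x i * f (P i k)) • φ (c k) := by
    intro x
    simp only [Finset.sum_smul]
    rw [Finset.sum_comm]
    refine Finset.sum_congr rfl fun i _ => ?_
    rw [← hP i, map_sum, Finset.smul_sum]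
    refine Finset.sum_congr rfl fun k _ => ?_
    rw [map_smulₛₗ, smul_smul]
  have h1 : ∀ i j, ∑ k, P i k * Q k j = if i = j then 1 else 0 := by
    intro i j
    have : (fun j => ∑ k, P i k * Q k j) = fun j => if i = j then 1 else 0 := by
      apply hb.1
      simp only [Finset.sum_smul, ite_smul, one_smul, zero_smul, Finset.sum_ite_eq,
        Finset.mem_univ, if_true]
      rw [Finset.sum_comm]
      rw [← hP i]
      refine Finset.sum_congr rfl fun k _ => ?_
      rw [← hQ k, Finset.smul_sum]
      refine Finset.sum_congr rfl fun l _ => ?_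
      rw [smul_smul]
    exact congrFun this j
  have h2 : ∀ i j, ∑ k, Q i k * P k j = if i = j then 1 else 0 := by
    intro i j
    have : (fun j => ∑ k, Q i k * P k j) = fun j => if i = j then 1 else 0 := by
      apply hc.1
      simp only [Finset.sum_smul, ite_smul, one_smul, zero_smul, Finset.sum_ite_eq,
        Finset.mem_univ, if_true]
      rw [Finset.sum_comm]
      rw [← hQ i]
      refine Finset.sum_congr rfl fun k _ => ?_
      rw [← hP k, Finset.smul_sum]
      refine Finset.sum_congr rfl fun l _ => ?_
      rw [smul_smul]
    exact congrFun this j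
  have h1' : ∀ i j, ∑ k, f (P i k) * f (Q k j) = if i = j then 1 else 0 := by
    intro i j
    have := congrArg f (h1 i j)
    simpa [apply_ite f] using this
  have h2' : ∀ i j, ∑ k, f (Q i k) * f (P k j) = if i = j then 1 else 0 := by
    intro i j
    have := congrArg f (h2 i j)
    simpa [apply_ite f] using this
  have hbij : Function.Bijective fun (x : ι → S) (k : κ) => ∑ i, x i * f (P i k) := by
    refine Function.bijective_iff_has_inverse.mpr
      ⟨fun y i => ∑ k, y k * f (Q k i), fun x => funext fun j => ?_, fun y => funext fun j => ?_⟩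
    · simp only [Finset.sum_mul]
      rw [Finset.sum_comm]
      simp only [mul_assoc, ← Finset.mul_sum, h1']
      simp
    · simp only [Finset.sum_mul]
      rw [Finset.sum_comm]
      simp only [mul_assoc, ← Finset.mul_sum, h2']
      simp
  have := hφ.comp hbij
  convert this using 1
  funext x
  exact key x

variable {T T' : Scheme.{u}}

theorem IsLocalBasis.reindex {M : T.Modules} {U : T.Opens} {ι κ : Type} [Fintype ι] [Fintype κ]
    {b : ι → Γ(M, U)} (hb : IsLocalBasis M b) (e : κ ≃ ι) : IsLocalBasis M fun k => b (e k) := by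
  intro V h
  have := (hb V h).comp (e.arrowCongr (Equiv.refl Γ(T, V))).bijective
  convert this using 1
  funext c
  simp only [Function.comp, Equiv.arrowCongr_apply, Equiv.coe_refl, id]
  rw [← Equiv.sum_comp e]
  simp

/-- Cartesian maps preserve local bases indexed by arbitrary finite types. -/
theorem CartMap.isLocalBasis' {f : T' ⟶ T} {M : T.Modules} {M' : T'.Modules} (φ : CartMap f M M')
    {U : T.Opens} {ι : Type} [Fintype ι] {b : ι → Γ(M, U)} (hb : IsLocalBasis M b) :
    IsLocalBasis M' (U := f ⁻¹ᵁ U) fun i => φ.app U (b i) := by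
  have := (φ.isLocalBasis U _ _ (hb.reindex (Fintype.equivFin ι).symm)).reindex
    (Fintype.equivFin ι)
  simp only [Equiv.symm_apply_apply] at this
  exact this

theorem IsLocalBasis.congr {M : T.Modules} {U : T.Opens} {ι : Type} [Fintype ι]
    {b b' : ι → Γ(M, U)} (hb : IsLocalBasis M b) (h : ∀ i, b i = b' i) : IsLocalBasis M b' := by
  rwa [← funext h]

/-- Being a local basis is a local property. -/
theorem isLocalBasis_of_cover {M : T.Modules} {U : T.Opens} {ι : Type} [Fintype ι]
    (b : ι → Γ(M, U))
    (H : ∀ t ∈ U, ∃ (V : T.Opens) (h : V ≤ U), t ∈ V ∧ IsLocalBasis M fun i => res M h (b i)) :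
    IsLocalBasis M b := by
  intro W hW
  have H' : ∀ t : W, ∃ V : T.Opens, V ≤ W ∧ t.1 ∈ V ∧ ∀ (V' : T.Opens) (h' : V' ≤ V) (hU : V' ≤ U),
      Function.Bijective fun c : ι → Γ(T, V') => ∑ i, c i • res M hU (b i) := by
    intro t
    obtain ⟨V, h, ht, hV⟩ := H t.1 (hW t.2)
    refine ⟨V ⊓ W, inf_le_right, ⟨ht, t.2⟩, fun V' h' hU => ?_⟩
    have := hV V' (h'.trans inf_le_left)
    simpa only [res_res] using this
  choose V hVW ht hV using H'
  constructor
  · intro c c' hc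
    funext i
    refine sectionO_ext fun t htW => ⟨V ⟨t, htW⟩, hVW _, ht ⟨t, htW⟩, ?_⟩
    have := @(hV ⟨t, htW⟩ _ le_rfl ((hVW _).trans hW)).1 (fun i => resO (hVW _) (c i))
      (fun i => resO (hVW _) (c' i)) (by
        have := congrArg (res M (hVW ⟨t, htW⟩)) hc
        simpa only [map_sum, res_smul, res_res] using this)
    exact congrFun this i
  · intro x
    choose c hc using fun t : W => (hV t _ le_rfl ((hVW t).trans hW)).2 (res M (hVW t) x)
    have hglue : ∀ i, ∃ a : Γ(T, W), ∀ t, resO (hVW t) a = c t i := fun i =>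
      section_glue (unitSheaf T) V hVW (fun t ht' => ⟨⟨t, ht'⟩, ht _⟩) (fun t => c t i)
        fun s t => by
          have := @(hV s (V s ⊓ V t) inf_le_left ((inf_le_left.trans (hVW s)).trans hW)).1
            (fun i => resO inf_le_left (c s i)) (fun i => resO inf_le_right (c t i)) (by
              have h1 := congrArg (res M (inf_le_left : V s ⊓ V t ≤ V s)) (hc s)
              have h2 := congrArg (res M (inf_le_right : V s ⊓ V t ≤ V t)) (hc t)
              simp only [map_sum, res_smul, res_res] at h1 h2
              simp only [h1, h2])
          exact congrFun this i
    choose a ha using hglue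
    refine ⟨a, section_ext M fun t htW => ⟨V ⟨t, htW⟩, hVW _, ht ⟨t, htW⟩, ?_⟩⟩
    simp only [map_sum, res_smul, res_res, ha, ← hc]

/-- A direct summand inherits a local basis from an adapted local basis. -/
theorem IsLocalBasis.retract {M N : T.Modules} (i : N ⟶ M) (e : M ⟶ N)
    (hie : ∀ (U : T.Opens) (x : Γ(N, U)), e.app U (i.app U x) = x) {U : T.Opens} {κ κ' : Type}
    [Fintype κ] [Fintype κ'] {b : κ → Γ(N, U)} {d : κ' → Γ(M, U)} (hd : ∀ k, e.app U (d k) = 0)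
    (h : IsLocalBasis M (Sum.elim (fun k => i.app U (b k)) d)) : IsLocalBasis N b := by
  intro V hV
  refine bijective_retract (appL i V) (appL e V) (hie V) (fun k => res N hV (b k))
    (fun k => res M hV (d k)) (fun k => ?_) ?_
  · rw [appL_apply, ← res_hom_app, hd, map_zero]
  · convert h V hV using 4 with c k
    rcases k with k | k
    · simp [appL_apply, res_hom_app]
    · rfl

/-- A morphism `M → f_* M'` maps all local bases to local bases as soon as, near each point, it does
so for one local basis. -/
theorem isLocalBasis_pushApp {f : T' ⟶ T} {M : T.Modules} {M' : T'.Modules}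
    (φ : M ⟶ (Scheme.Modules.pushforward f).obj M')
    (H : ∀ t : T, ∃ (V : T.Opens), t ∈ V ∧ ∃ (ι : Type) (_ : Fintype ι) (c : ι → Γ(M, V)),
      IsLocalBasis M c ∧ IsLocalBasis M' fun i => pushApp φ V (c i))
    (U : T.Opens) {ι : Type} [Fintype ι] (b : ι → Γ(M, U)) (hb : IsLocalBasis M b) :
    IsLocalBasis M' fun i => pushApp φ U (b i) := by
  refine isLocalBasis_of_cover _ fun t ht => ?_
  obtain ⟨V, htV, κ, _, c, hc, hc'⟩ := H (f t)
  refine ⟨f ⁻¹ᵁ (U ⊓ V), f.preimage_mono inf_le_left, ⟨ht, htV⟩, fun W hW => ?_⟩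
  have h1 := hb (U ⊓ V) inf_le_left
  have h2 := hc (U ⊓ V) inf_le_right
  have h3 := hc' W (hW.trans (f.preimage_mono inf_le_right))
  let g : Γ(M, U ⊓ V) →ₛₗ[(resO hW).comp (f.app (U ⊓ V)).hom] Γ(M', W) :=
    { toFun := fun x => res M' hW (pushApp φ (U ⊓ V) x)
      map_add' := fun x y => by simp only [map_add]
      map_smul' := fun r x => by
        rw [pushApp_smul, res_smul]
        rfl }
  have := bijective_of_semilinear _ g _ _ h1 h2 (by
    convert h3 using 4 with x i
    change res M' hW (pushApp φ (U ⊓ V) (res M inf_le_right (c i))) = _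
    rw [← res_pushApp, res_res])
  convert this using 4 with x i
  change res M' hW (res M' _ (pushApp φ U (b i))) =
    res M' hW (pushApp φ (U ⊓ V) (res M inf_le_left (b i)))
  rw [← res_pushApp]

end LocalBases

section Traces

variable {T T' : Scheme.{u}}

theorem LocalEnd.resO_trace_eq {F : T.Modules} (hF : LocallyFree F) {U V : T.Opens}
    (φ : LocalEnd F U) (h : V ≤ U) {n : ℕ} {b : Fin n → Γ(F, V)} (hb : IsLocalBasis F b) :
    resO h (φ.trace hF) = LinearMap.trace Γ(T, V) Γ(F, V) (φ.app V h) :=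
  (φ.existsUnique_isTrace hF).choose_spec.1 V h ⟨n, b, hb⟩

theorem trace_semilinear {R S M N : Type*} [CommRing R] [CommRing S] [AddCommGroup M]
    [Module R M] [AddCommGroup N] [Module S N] (f : R →+* S) (φ : M →ₛₗ[f] N) {ι : Type*}
    [Fintype ι] (b : Module.Basis ι R M) (c : Module.Basis ι S N) (hbc : ∀ i, φ (b i) = c i)
    (g : M →ₗ[R] M) (g' : N →ₗ[S] N) (hg : ∀ x, φ (g x) = g' (φ x)) :
    f (LinearMap.trace R M g) = LinearMap.trace S N g' := by
  classical
  have key : ∀ (x : M) (i : ι), c.repr (φ x) i = f (b.repr x i) := by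
    intro x i
    conv_lhs => rw [← b.sum_repr x]
    have h : φ (∑ i, b.repr x i • b i) = ∑ i, f (b.repr x i) • c i := by
      simp only [map_sum, map_smulₛₗ, hbc]
    rw [h, Module.Basis.repr_sum_self]
  rw [LinearMap.trace_eq_matrix_trace _ b, LinearMap.trace_eq_matrix_trace _ c]
  simp [Matrix.trace, LinearMap.toMatrix_apply, ← hbc, ← hg, key]

/-- Traces are compatible with cartesian maps. -/
theorem CartMap.app_trace {f : T' ⟶ T} {F : T.Modules} {F' : T'.Modules} (hF : LocallyFree F)
    (hF' : LocallyFree F') (φ : CartMap f F F') {U : T.Opens} (g : LocalEnd F U)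
    (g' : LocalEnd F' (f ⁻¹ᵁ U))
    (hg : ∀ (V : T.Opens) (h : V ≤ U) (x : Γ(F, V)),
      φ.app V (g.app V h x) = g'.app (f ⁻¹ᵁ V) (f.preimage_mono h) (φ.app V x)) :
    f.app U (g.trace hF) = g'.trace hF' := by
  refine sectionO_ext fun t ht => ?_
  obtain ⟨V, htV, n, b, hb⟩ := hF (f t)
  have hb1 := hb.restrict (inf_le_right : U ⊓ V ≤ V)
  have hb2 := φ.isLocalBasis' hb1
  refine ⟨f ⁻¹ᵁ (U ⊓ V), f.preimage_mono inf_le_left, ⟨ht, htV⟩, ?_⟩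
  have hle : U ⊓ V ≤ U := inf_le_left
  rw [resO_app f hle, g.resO_trace_eq hF hle hb1,
    g'.resO_trace_eq hF' (f.preimage_mono hle) hb2]
  exact trace_semilinear (f.app (U ⊓ V)).hom
    { toFun := φ.app (U ⊓ V), map_add' := map_add _, map_smul' := φ.app_smul _ }
    hb1.toBasis hb2.toBasis (fun i => by
      rw [IsLocalBasis.toBasis_apply, IsLocalBasis.toBasis_apply]; rfl) _ _ (hg _ inf_le_left)

end Traces
end SThreeCover

/-! ### Actions of `G` on modules -/

namespace SThreeCover

namespace CoordG

/-- The coefficient of a function on `G` at the basis element `e c k`. -/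
noncomputable def coef (c : ZMod 2) (k : ZMod 3) : CoordG →ₗ[ℤ] ℤ where
  toFun f := (restrict c f).coeff k
  map_add' f g := by simp
  map_smul' n f := by rw [map_zsmul]; rfl

theorem coef_e (c c' : ZMod 2) (k k' : ZMod 3) :
    coef c k (e c' k') = if c = c' ∧ k = k' then 1 else 0 := by
  change (restrict c (e c' k')).coeff k = _
  rw [restrict_e]
  by_cases h : c = c'
  · by_cases h' : k = k'
    · subst h'; simp [h]
    · simp [h, h']
  · simp [h]

theorem sum_coef (f : CoordG) : ∑ c : ZMod 2, ∑ k : ZMod 3, coef c k f • e c k = f := by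
  let g : CoordG →ₗ[ℤ] CoordG :=
    ∑ c : ZMod 2, ∑ k : ZMod 3, (coef c k).smulRight (e c k)
  have : g = LinearMap.id := by
    refine hom_ext fun c k => ?_
    simp only [g, LinearMap.sum_apply, LinearMap.smulRight_apply, coef_e, LinearMap.id_apply]
    rw [Finset.sum_eq_single c, Finset.sum_eq_single k] <;> simp +contextual
  simpa [g] using LinearMap.congr_fun this f

end CoordG

open CoordG

section Parts

-- The module structure of a tensor product over `ℤ` is preferred to those obtained from the
-- structure of an abelian group, so that `simp` finds the same instance everywhere.
attribute [local instance 2000] TensorProduct.instModule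

variable {M N : Type*} [AddCommMonoid M] [Module ℤ M] [AddCommMonoid N] [Module ℤ N]

/-- The coefficient in `M` of an element of `M ⊗ 𝒪(G)` at the basis element `e c k`. -/
noncomputable def part (c : ZMod 2) (k : ZMod 3) : M ⊗[ℤ] CoordG →ₗ[ℤ] M :=
  (TensorProduct.rid ℤ M).toLinearMap ∘ₗ (coef c k).lTensor M

theorem part_tmul (c : ZMod 2) (k : ZMod 3) (x : M) (f : CoordG) :
    part c k (x ⊗ₜ[ℤ] f) = coef c k f • x := by
  simp [part]

theorem sum_part (z : M ⊗[ℤ] CoordG) :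
    ∑ c : ZMod 2, ∑ k : ZMod 3, part c k z ⊗ₜ[ℤ] e c k = z := by
  induction z with
  | zero => simp
  | tmul x f =>
    simp only [part_tmul, TensorProduct.smul_tmul]
    simp only [← TensorProduct.tmul_sum, sum_coef]
  | add x y hx hy =>
    conv_rhs => rw [← hx, ← hy]
    simp only [map_add, TensorProduct.add_tmul, Finset.sum_add_distrib]

theorem tensor_ext {z w : M ⊗[ℤ] CoordG} (h : ∀ c k, part c k z = part c k w) : z = w := by
  rw [← sum_part z, ← sum_part w]
  simp only [h]

theorem part_tmul_e (c c' : ZMod 2) (k k' : ZMod 3) (x : M) :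
    part c k (x ⊗ₜ[ℤ] e c' k') = if c = c' ∧ k = k' then x else 0 := by
  rw [part_tmul, coef_e]
  split_ifs <;> simp

theorem part_sum (c : ZMod 2) (k : ZMod 3) (x : ZMod 2 → ZMod 3 → M) :
    part c k (∑ c : ZMod 2, ∑ k : ZMod 3, x c k ⊗ₜ[ℤ] e c k) = x c k := by
  simp only [map_sum, part_tmul_e]
  rw [Finset.sum_eq_single c (fun b _ hb => by simp [Ne.symm hb]) (by simp),
    Finset.sum_eq_single k (fun b _ hb => by simp [Ne.symm hb]) (by simp)]
  simp

theorem part_rTensor (f : M →ₗ[ℤ] N) (c : ZMod 2) (k : ZMod 3) (z : M ⊗[ℤ] CoordG) :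
    part c k (f.rTensor CoordG z) = f (part c k z) := by
  induction z with
  | zero => simp
  | tmul x f => simp [part_tmul]
  | add x y hx hy => simp [hx, hy]

theorem sum_zmod3 {M : Type*} [AddCommMonoid M] (f : ZMod 3 → M) :
    ∑ a : ZMod 3, f a = f 0 + f 1 + f 2 := Fin.sum_univ_three f

end Parts

section GModule

attribute [local instance 2000] TensorProduct.instModule

variable {R M N : Type*} [CommRing R] [AddCommGroup M] [Module R M] [AddCommGroup N] [Module R N]

theorem part_smul (c : ZMod 2) (k : ZMod 3) (r : R) (z : M ⊗[ℤ] CoordG) :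
    part c k (r • z) = r • part c k z := by
  induction z with
  | zero => simp
  | tmul x f => rw [TensorProduct.smul_tmul', part_tmul, part_tmul, smul_comm]
  | add x y hx hy => rw [smul_add, map_add, hx, hy, map_add, smul_add]

variable (R M) in
/-- An action of `μ₃ ⋊ ℤ/2` on a module: the projections `p k` onto the components of degree `k` of
a grading by `ℤ/3`, and an involution `σ` which maps the component of degree `k` to the one of
degree `-k`. -/
structure GModule where
  p : ZMod 3 → M →ₗ[R] M
  σ : M →ₗ[R] M
  p_p (k l : ZMod 3) (x : M) : p k (p l x) = if k = l then p k x else 0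
  sum_p (x : M) : ∑ k : ZMod 3, p k x = x
  σ_σ (x : M) : σ (σ x) = x
  p_σ (k : ZMod 3) (x : M) : p k (σ x) = σ (p (-k) x)

namespace GModule

variable (P : GModule R M)

/-- The coaction corresponding to an action of `G`. The point `(ζ, a)` acts on the component of
degree `k` as `ζ ^ k` after `σ ^ a`. -/
noncomputable def coact : M →ₗ[R] M ⊗[ℤ] CoordG where
  toFun x := ∑ c : ZMod 2, ∑ k : ZMod 3, (P.p k (if c = 0 then x else P.σ x)) ⊗ₜ[ℤ] e c k
  map_add' x y := by
    simp only [← Finset.sum_add_distrib, ← TensorProduct.add_tmul, ← map_add]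
    refine Finset.sum_congr rfl fun c _ => ?_
    split_ifs <;> simp
  map_smul' r x := by
    simp only [Finset.smul_sum, TensorProduct.smul_tmul', RingHom.id_apply]
    refine Finset.sum_congr rfl fun c _ => ?_
    split_ifs <;> simp

theorem coact_apply (x : M) : P.coact x =
    ∑ c : ZMod 2, ∑ k : ZMod 3, (P.p k (if c = 0 then x else P.σ x)) ⊗ₜ[ℤ] e c k := rfl

theorem part_coact (c : ZMod 2) (k : ZMod 3) (x : M) :
    part c k (P.coact x) = P.p k (if c = 0 then x else P.σ x) := by
  rw [coact_apply, part_sum]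

theorem coact_coassoc (x : M) :
    TensorProduct.assoc ℤ M CoordG CoordG ((P.coact.restrictScalars ℤ).rTensor CoordG (P.coact x)) =
      Coalgebra.comul.lTensor M (P.coact x) := by
  have h1 : (1 : ZMod 2) ≠ 0 := by decide
  have n0 : -(0 : ZMod 3) = 0 := by decide
  have n1 : -(1 : ZMod 3) = 2 := by decide
  have n2 : -(2 : ZMod 3) = 1 := by decide
  have s0 : sgn 0 = 1 := by decide
  have s1 : sgn 1 = 2 := by decide
  have m2 : (2 : ZMod 3) * 2 = 1 := by decide
  have d2 : (1 : ZMod 2) - 1 = 0 := by decide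
  have d3 : (0 : ZMod 2) - 1 = 1 := by decide
  have e1 : (1 : ZMod 3) ≠ 0 := by decide
  have e2 : (2 : ZMod 3) ≠ 0 := by decide
  have e3 : (2 : ZMod 3) ≠ 1 := by decide
  simp only [coact_apply, sum_zmod2, sum_zmod3, if_true, h1, if_false, map_add,
    LinearMap.rTensor_tmul, LinearMap.lTensor_tmul, comul_e, LinearMap.restrictScalars_apply,
    P.p_σ, P.σ_σ, P.p_p, n0, n1, n2, s0, s1, m2, d2, d3, sub_zero, one_mul, mul_one, mul_zero,
    e1, e2, e3, e1.symm, e2.symm, e3.symm, map_zero, TensorProduct.zero_tmul, add_zero, zero_add,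
    TensorProduct.add_tmul, TensorProduct.tmul_add, TensorProduct.assoc_tmul]
  abel

theorem coact_counit (x : M) :
    TensorProduct.rid ℤ M (Coalgebra.counit.lTensor M (P.coact x)) = x := by
  have h1 : (1 : ZMod 2) ≠ 0 := by decide
  conv_rhs => rw [← P.sum_p x]
  simp [coact_apply, sum_zmod2, counit_e, h1]

/-- The coefficients of the two sides of the coassociativity law: in degree `k` on the component
`a`, the character `ζ ↦ ζ ^ l` of the component `b` contributes only if `l = (-1) ^ a k`. -/
theorem part_part_comul (a b : ZMod 2) (k l : ZMod 3) (z : M ⊗[ℤ] CoordG) :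
    part a k (part b l ((TensorProduct.assoc ℤ M CoordG CoordG).symm
      (Coalgebra.comul.lTensor M z))) = if l = sgn a * k then part (a + b) k z else 0 := by
  conv_lhs => rw [← sum_part z]
  simp only [map_sum, LinearMap.lTensor_tmul, comul_e, TensorProduct.tmul_sum,
    TensorProduct.assoc_symm_tmul, part_tmul_e, apply_ite (part a k), map_zero]
  rw [Finset.sum_eq_single (a + b), Finset.sum_eq_single k, Finset.sum_eq_single a]
  · simp
  · intro c _ hc
    simp [Ne.symm hc]
  · simp
  · intro c _ hc
    simp [Ne.symm hc]
  · simp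
  · intro c _ hc
    refine Finset.sum_eq_zero fun k' _ => Finset.sum_eq_zero fun a' _ => ?_
    split_ifs with h1 h2
    · obtain ⟨rfl, rfl⟩ := h2
      refine absurd ?_ hc
      rw [h1.1]; ring
    all_goals rfl
  · simp

/-- The coassociativity of a coaction in terms of coefficients. -/
theorem part_coaction (ρ : M →ₗ[R] M ⊗[ℤ] CoordG)
    (hρ : ∀ x, TensorProduct.assoc ℤ M CoordG CoordG
      ((ρ.restrictScalars ℤ).rTensor CoordG (ρ x)) = Coalgebra.comul.lTensor M (ρ x))
    (a b : ZMod 2) (k l : ZMod 3) (x : M) :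
    part a k (ρ (part b l (ρ x))) = if l = sgn a * k then part (a + b) k (ρ x) else 0 := by
  have h := congrArg (part a k ∘ part b l ∘ (TensorProduct.assoc ℤ M CoordG CoordG).symm) (hρ x)
  simp only [Function.comp, LinearEquiv.symm_apply_apply, part_rTensor,
    LinearMap.restrictScalars_apply, part_part_comul] at h
  exact h

/-- The action of `G` corresponding to a coaction. -/
noncomputable def ofCoaction (ρ : M →ₗ[R] M ⊗[ℤ] CoordG)
    (hρ : ∀ x, TensorProduct.assoc ℤ M CoordG CoordG
      ((ρ.restrictScalars ℤ).rTensor CoordG (ρ x)) = Coalgebra.comul.lTensor M (ρ x))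
    (hε : ∀ x, TensorProduct.rid ℤ M (Coalgebra.counit.lTensor M (ρ x)) = x) : GModule R M :=
  have key := part_coaction ρ hρ
  have hsum (x : M) : ∑ k : ZMod 3, part 0 k (ρ x) = x := by
    have := hε x
    conv_lhs at this => rw [← sum_part (ρ x)]
    have h1 : (1 : ZMod 2) ≠ 0 := by decide
    simpa [sum_zmod2, counit_e, h1] using this
  have d2 : (1 : ZMod 2) + 1 = 0 := by decide
  have h1 : (1 : ZMod 2) ≠ 0 := by decide
  have s1 : sgn 1 = -1 := by decide
  have s0 : sgn 0 = 1 := by decide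
  { p := fun k =>
      { toFun := fun x => part 0 k (ρ x)
        map_add' := fun x y => by simp
        map_smul' := fun r x => by simp [part_smul] }
    σ :=
      { toFun := fun x => ∑ k, part 1 k (ρ x)
        map_add' := fun x y => by simp [Finset.sum_add_distrib]
        map_smul' := fun r x => by simp [part_smul, Finset.smul_sum] }
    p_p := fun k l x => by
      simp [key, s0, eq_comm]
    sum_p := hsum
    σ_σ := fun x => by
      simp only [LinearMap.coe_mk, AddHom.coe_mk, map_sum, key, d2, s1]
      rw [Finset.sum_comm]
      conv_rhs => rw [← hsum x]
      refine Finset.sum_congr rfl fun l _ => ?_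
      rw [Finset.sum_eq_single (-l)] <;> simp +contextual
    p_σ := fun k x => by
      simp only [LinearMap.coe_mk, AddHom.coe_mk, map_sum, key, s0, s1]
      rw [Finset.sum_eq_single k, Finset.sum_eq_single k] <;> simp +contextual
      intro l hl h; exact absurd h.symm hl }

theorem coact_ofCoaction (ρ : M →ₗ[R] M ⊗[ℤ] CoordG) (hρ hε) (x : M) :
    (ofCoaction ρ hρ hε).coact x = ρ x := by
  have key := part_coaction ρ hρ
  have s0 : sgn 0 = 1 := by decide
  refine tensor_ext fun c k => ?_
  rw [part_coact]
  have hc : c = 0 ∨ c = 1 := by decide +revert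
  rcases hc with rfl | rfl
  · rfl
  · change part 0 k (ρ (∑ l, part 1 l (ρ x))) = _
    simp only [map_sum, key, s0, one_mul, zero_add, Finset.sum_ite_eq', Finset.mem_univ, if_true]

theorem ext_of_coact {P Q : GModule R M} (h : ∀ x, P.coact x = Q.coact x) : P = Q := by
  have hp : P.p = Q.p := by
    funext k
    ext x
    have := congrArg (part 0 k) (h x)
    simpa [part_coact] using this
  have hσ : P.σ = Q.σ := by
    ext x
    rw [← P.sum_p (P.σ x), ← Q.sum_p (Q.σ x)]
    refine Finset.sum_congr rfl fun k _ => ?_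
    have := congrArg (part 1 k) (h x)
    simpa [part_coact] using this
  cases P; cases Q; cases hp; cases hσ; rfl

end GModule
end GModule
end SThreeCover

/-! ### Coactions on sheaves of modules -/

namespace SThreeCover

open CoordG

section GModule

attribute [local instance 2000] TensorProduct.instModule

variable {R M N : Type*} [CommRing R] [AddCommGroup M] [Module R M]

theorem part_map₂ (μ : M →ₗ[R] M →ₗ[R] M) (c : ZMod 2) (k : ZMod 3) (z w : M ⊗[ℤ] CoordG) :
    part c k (TensorProduct.map₂ (μ.restrictScalars₁₂ ℤ ℤ) (LinearMap.mul ℤ CoordG) z w) =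
      ∑ i, μ (part c i z) (part c (k - i) w) := by
  have h : ∀ (i j : ZMod 3), (k = i + j) = (j = k - i) := fun i j => by decide +revert
  have htmul : ∀ (x y : M) (f g : CoordG),
      TensorProduct.map₂ (μ.restrictScalars₁₂ ℤ ℤ) (LinearMap.mul ℤ CoordG) (x ⊗ₜ f) (y ⊗ₜ g) =
        μ x y ⊗ₜ (f * g) := fun _ _ _ _ => rfl
  conv_lhs => rw [← sum_part z, ← sum_part w]
  simp only [map_sum, LinearMap.sum_apply, htmul, e_mul_e]
  rw [Finset.sum_eq_single c]
  · rw [Finset.sum_congr rfl fun j _ => Finset.sum_eq_single c _ _, Finset.sum_comm]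
    · refine Finset.sum_congr rfl fun i _ => ?_
      simp only [if_true, part_tmul_e, true_and, h]
      simp
    · intro j _ c' _ hc'
      simp [hc']
    · simp
  · intro c' _ hc'
    refine Finset.sum_eq_zero fun i _ => Finset.sum_eq_zero fun d _ =>
      Finset.sum_eq_zero fun j _ => ?_
    split_ifs with h
    · subst h
      simp [part_tmul_e, Ne.symm hc']
    · simp
  · simp

namespace GModule

variable (P : GModule R M)

/-- Equivariance of a multiplication in terms of degrees and of `σ`. -/
theorem coact_mul_iff (μ : M →ₗ[R] M →ₗ[R] M) :
    (∀ x y, P.coact (μ x y) =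
      TensorProduct.map₂ (μ.restrictScalars₁₂ ℤ ℤ) (LinearMap.mul ℤ CoordG)
        (P.coact x) (P.coact y)) ↔
    (∀ k x y, P.p k (μ x y) = ∑ i, μ (P.p i x) (P.p (k - i) y)) ∧
      ∀ x y, P.σ (μ x y) = μ (P.σ x) (P.σ y) := by
  have h1 : (1 : ZMod 2) ≠ 0 := by decide
  constructor
  · intro h
    have hp : ∀ k x y, P.p k (μ x y) = ∑ i, μ (P.p i x) (P.p (k - i) y) := fun k x y => by
      have := congrArg (part 0 k) (h x y)
      simpa only [part_map₂, part_coact, if_true] using this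
    refine ⟨hp, fun x y => ?_⟩
    rw [← P.sum_p (P.σ (μ x y)), ← P.sum_p (μ (P.σ x) (P.σ y))]
    refine Finset.sum_congr rfl fun k _ => ?_
    rw [hp]
    have := congrArg (part 1 k) (h x y)
    simpa only [part_map₂, part_coact, h1, if_false] using this
  · rintro ⟨hp, hσ⟩ x y
    refine tensor_ext fun c k => ?_
    rw [part_map₂]
    simp only [part_coact]
    split_ifs
    · rw [hp]
    · rw [hσ, hp]

/-- An element is invariant if and only if it has degree `0` and is fixed by `σ`. -/
theorem coact_one_iff (x : M) : P.coact x = x ⊗ₜ 1 ↔ P.p 0 x = x ∧ P.σ x = x := by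
  have h1 : (1 : ZMod 2) ≠ 0 := by decide
  have hx : ∀ c k, part c k (x ⊗ₜ[ℤ] (1 : CoordG)) = if k = 0 then x else 0 := by
    intro c k
    simp only [one_eq, TensorProduct.tmul_sum, map_sum, part_tmul_e]
    simp [ite_and]
  constructor
  · intro h
    have hp : P.p 0 x = x := by
      have := congrArg (part 0 0) h
      simpa [part_coact, hx] using this
    have hp' : P.p 0 (P.σ x) = x := by
      have := congrArg (part 1 0) h
      simpa [part_coact, hx] using this
    refine ⟨hp, ?_⟩
    rw [P.p_σ, neg_zero, hp] at hp'
    exact hp'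
  · rintro ⟨hp, hσ⟩
    refine tensor_ext fun c k => ?_
    rw [part_coact, hx, hσ, ite_self, ← hp, P.p_p]
    split_ifs with h
    · rw [h]
    · rfl

/-- A map is equivariant if and only if it commutes with the projections `p k` and with `σ`. -/
theorem rTensor_coact_iff {S : Type*} [CommRing S] [AddCommGroup N] [Module S N]
    (Q : GModule S N) (f : M →ₗ[ℤ] N) :
    (∀ x, f.rTensor CoordG (P.coact x) = Q.coact (f x)) ↔
      (∀ k x, f (P.p k x) = Q.p k (f x)) ∧ ∀ x, f (P.σ x) = Q.σ (f x) := by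
  have h1 : (1 : ZMod 2) ≠ 0 := by decide
  constructor
  · intro h
    have hp : ∀ k x, f (P.p k x) = Q.p k (f x) := fun k x => by
      have := congrArg (part 0 k) (h x)
      simpa [part_coact, part_rTensor] using this
    refine ⟨hp, fun x => ?_⟩
    rw [← P.sum_p (P.σ x), ← Q.sum_p (Q.σ (f x)), map_sum]
    refine Finset.sum_congr rfl fun k _ => ?_
    have := congrArg (part 1 k) (h x)
    simpa [part_coact, part_rTensor] using this
  · rintro ⟨hp, hσ⟩ x
    refine tensor_ext fun c k => ?_
    rw [part_rTensor, part_coact, part_coact, hp, apply_ite f, hσ]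

theorem lTensor_restrict_coact (x : M) :
    (CoordG.restrict 0).lTensor M (P.coact x) =
      ∑ k, P.p k x ⊗ₜ[ℤ] AddMonoidAlgebra.single k (1 : ℤ) := by
  simp [coact_apply, sum_zmod2, restrict_e]

theorem lTensor_counit_coact (x : M) :
    TensorProduct.rid ℤ M ((Coalgebra.counit ∘ₗ CoordG.restrict 1).lTensor M (P.coact x)) =
      P.σ x := by
  conv_rhs => rw [← P.sum_p (P.σ x)]
  simp [coact_apply, sum_zmod2, restrict_e]

theorem σ_injective : Function.Injective P.σ := fun x y h => by
  rw [← P.σ_σ x, h, P.σ_σ]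

end GModule
end GModule

namespace Coaction

variable {T T' : Scheme.{u}} {M : T.Modules} {M' : T'.Modules}

/-- The action of `G` on the module of sections defined by a coaction. -/
noncomputable def gmod (ρ : Coaction M) (U : T.Opens) : GModule Γ(T, U) Γ(M, U) :=
  .ofCoaction (ρ.app U) (ρ.coassoc U) (ρ.counit U)

theorem app_eq (ρ : Coaction M) (U : T.Opens) (x : Γ(M, U)) :
    ρ.app U x = (ρ.gmod U).coact x :=
  (GModule.coact_ofCoaction _ _ _ x).symm

theorem res_gmod (ρ : Coaction M) {U V : T.Opens} (h : V ≤ U) :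
    (∀ k x, res M h ((ρ.gmod U).p k x) = (ρ.gmod V).p k (res M h x)) ∧
      ∀ x, res M h ((ρ.gmod U).σ x) = (ρ.gmod V).σ (res M h x) :=
  ((ρ.gmod U).rTensor_coact_iff (ρ.gmod V) (res M h)).1 fun x => by
    rw [← app_eq, ← app_eq]
    exact ρ.res_app U V h x

/-- The coaction corresponding to actions on the modules of sections. -/
noncomputable def ofGMod (P : ∀ U : T.Opens, GModule Γ(T, U) Γ(M, U))
    (hp : ∀ (U V : T.Opens) (h : V ≤ U) k x, res M h ((P U).p k x) = (P V).p k (res M h x))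
    (hσ : ∀ (U V : T.Opens) (h : V ≤ U) x, res M h ((P U).σ x) = (P V).σ (res M h x)) :
    Coaction M where
  app U := (P U).coact
  res_app U V h := ((P U).rTensor_coact_iff (P V) (res M h)).2 ⟨hp U V h, hσ U V h⟩
  coassoc U := (P U).coact_coassoc
  counit U := (P U).coact_counit

theorem gmod_ofGMod (P : ∀ U : T.Opens, GModule Γ(T, U) Γ(M, U)) (hp hσ) (U : T.Opens) :
    (ofGMod P hp hσ).gmod U = P U :=
  GModule.ext_of_coact fun x => (app_eq _ U x).symm

theorem mu_eq (ρ : Coaction M) (U : T.Opens) (x : Γ(M, U)) :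
    ρ.mu U x = ∑ k, (ρ.gmod U).p k x ⊗ₜ[ℤ] AddMonoidAlgebra.single k (1 : ℤ) := by
  rw [mu, app_eq]
  exact (ρ.gmod U).lTensor_restrict_coact x

theorem sigma_eq (ρ : Coaction M) (U : T.Opens) (x : Γ(M, U)) :
    ρ.sigma U x = (ρ.gmod U).σ x := by
  rw [sigma, app_eq]
  exact (ρ.gmod U).lTensor_counit_coact x

theorem mu_eq_of_degree (ρ : Coaction M) (U : T.Opens) (x : Γ(M, U)) (k : ZMod 3)
    (h : (ρ.gmod U).p k x = x) : ρ.mu U x = x ⊗ₜ AddMonoidAlgebra.single k 1 := by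
  rw [mu_eq, Finset.sum_eq_single k, h]
  · intro l _ hl
    rw [← h, GModule.p_p, if_neg hl, TensorProduct.zero_tmul]
  · simp

theorem degree_of_mu_eq (ρ : Coaction M) (U : T.Opens) (x : Γ(M, U)) (k : ZMod 3)
    (h : ρ.mu U x = x ⊗ₜ AddMonoidAlgebra.single k 1) : (ρ.gmod U).p k x = x := by
  rw [mu_eq] at h
  have := congrArg (fun z => part 0 k ((extend 0).lTensor Γ(M, U) z)) h
  simp only [map_sum, LinearMap.lTensor_tmul, extend_single, part_tmul_e] at this
  simpa using this

end Coaction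

namespace EquivariantAlgebra

variable {T T' : Scheme.{u}} (A : EquivariantAlgebra T)

theorem p_mul (U : T.Opens) (k : ZMod 3) (x y : Γ(A.sheaf, U)) :
    (A.coaction.gmod U).p k (A.mul.app U x y) =
      ∑ i, A.mul.app U ((A.coaction.gmod U).p i x) ((A.coaction.gmod U).p (k - i) y) :=
  (((A.coaction.gmod U).coact_mul_iff (A.mul.app U)).1 fun x y => by
    simp only [← Coaction.app_eq]
    exact A.coaction_mul U x y).1 k x y

theorem σ_mul (U : T.Opens) (x y : Γ(A.sheaf, U)) :
    (A.coaction.gmod U).σ (A.mul.app U x y) =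
      A.mul.app U ((A.coaction.gmod U).σ x) ((A.coaction.gmod U).σ y) :=
  (((A.coaction.gmod U).coact_mul_iff (A.mul.app U)).1 fun x y => by
    simp only [← Coaction.app_eq]
    exact A.coaction_mul U x y).2 x y

theorem p_σ_one (U : T.Opens) : (A.coaction.gmod U).p 0 (A.oneOn U) = A.oneOn U ∧
    (A.coaction.gmod U).σ (A.oneOn U) = A.oneOn U := by
  have h := ((A.coaction.gmod ⊤).coact_one_iff A.one).1 (by
    rw [← Coaction.app_eq]; exact A.coaction_one)
  rw [oneOn, ← (A.coaction.res_gmod _).1, ← (A.coaction.res_gmod _).2, h.1, h.2]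
  exact ⟨rfl, rfl⟩

end EquivariantAlgebra

end SThreeCover

/-! ### The maps `m` and `(-,-)`, and the relations -/

namespace SThreeCover

section TraceAlgebra

/-- The trace of the endomorphism `w ↦ α (⟨w, u⟩ ⊗ v)` of a module of rank two, evaluated by means
of an element of a module of rank one. -/
theorem trace_pairing_smul {R L F : Type*} [CommRing R] [AddCommGroup L] [Module R L]
    [AddCommGroup F] [Module R F] (t : Module.Basis (Fin 1) R L) (b : Module.Basis (Fin 2) R F)
    (α : L →ₗ[R] F →ₗ[R] F) (p : F →ₗ[R] F →ₗ[R] L) (hp : ∀ u, p u u = 0) (u v : F) (l : L) :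
    LinearMap.trace R F (α.flip v ∘ₗ p.flip u) • l = p (α l v) u := by
  have hp' : ∀ u v, p v u = -p u v := fun u v => by
    have := hp (u + v)
    simp only [map_add, LinearMap.add_apply, hp, add_zero, zero_add] at this
    exact eq_neg_of_add_eq_zero_left this
  have hL : ∀ l, l = t.repr l 0 • t 0 := fun l => by
    conv_lhs => rw [← t.sum_repr l]
    simp
  have hF : ∀ w, w = b.repr w 0 • b 0 + b.repr w 1 • b 1 := fun w => by
    conv_lhs => rw [← b.sum_repr w, Fin.sum_univ_two]
  have hpu : ∀ w, p w u = (b.repr w 0 * b.repr u 1 - b.repr w 1 * b.repr u 0) •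
      (t.repr (p (b 0) (b 1)) 0 • t 0) := fun w => by
    rw [← hL]
    conv_lhs => rw [hF u, hF w]
    simp only [map_add, LinearMap.add_apply, map_smul, LinearMap.smul_apply, hp, hp' (b 0) (b 1)]
    module
  rw [LinearMap.trace_eq_matrix_trace R b, Matrix.trace_fin_two, LinearMap.toMatrix_apply,
    LinearMap.toMatrix_apply]
  simp only [LinearMap.comp_apply, LinearMap.flip_apply, hpu (α l v)]
  rw [hpu (b 0), hpu (b 1)]
  rw [hL l]
  simp only [map_smul, LinearMap.smul_apply, Module.Basis.repr_self, Finsupp.smul_apply,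
    smul_eq_mul, smul_smul]
  simp
  ring_nf

end TraceAlgebra

section Two

theorem two_isUnit {T : Scheme.{u}} [hT : Fact (IsUnit (2 : Γ(T, ⊤)))] (U : T.Opens) :
    IsUnit (2 : Γ(T, U)) := by
  have := hT.1.map (resO (le_top : U ≤ ⊤))
  rwa [map_ofNat] at this

theorem two_isUnit_of_over (T : Over base.{u}) : IsUnit (2 : Γ(T.left, ⊤)) := by
  have h : IsUnit (2 : ULift.{u} (Localization.Away (2 : ℤ))) := by
    have := IsLocalization.Away.algebraMap_isUnit (S := Localization.Away (2 : ℤ)) (2 : ℤ)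
    rw [map_ofNat] at this
    have h2 := this.map (ULift.ringEquiv.{0, u} (R := Localization.Away (2 : ℤ))).symm
    rwa [map_ofNat] at h2
  have h' := h.map ((Scheme.ΓSpecIso (CommRingCat.of
    (ULift.{u} (Localization.Away (2 : ℤ))))).inv ≫ T.hom.appTop).hom
  rwa [map_ofNat] at h'

/-- The hypothesis `Fact (IsUnit (2 : Γ(T, ⊤)))`, under which most results are stated, expresses
that `T` is a scheme over `ℤ[1/2]`. -/
instance (T : Over base.{u}) : Fact (IsUnit (2 : Γ(T.left, ⊤))) := ⟨two_isUnit_of_over T⟩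

theorem map_inverse_two {R S : Type*} [CommRing R] [CommRing S] (f : R →+* S)
    (h : IsUnit (2 : R)) : f (Ring.inverse 2) = Ring.inverse 2 := by
  have h' : IsUnit (2 : S) := by
    have := h.map f
    rwa [map_ofNat] at this
  apply h'.mul_left_cancel
  rw [Ring.mul_inverse_cancel _ h', ← map_ofNat f 2, ← map_mul, Ring.mul_inverse_cancel _ h,
    map_one]

end Two

theorem IsLocalBasis.exists_smul {T : Scheme.{u}} {L : T.Modules} {U : T.Opens} {t : Γ(L, U)}
    (ht : IsLocalBasis L fun _ : Fin 1 => t) (s : Γ(L, U)) : ∃ c : Γ(T, U), s = c • t := by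
  obtain ⟨c, hc⟩ := (ht U le_rfl).2 s
  refine ⟨c 0, ?_⟩
  simpa [res_refl] using hc.symm

theorem IsLocalBasis.smul_injective {T : Scheme.{u}} {L : T.Modules} {U : T.Opens} {t : Γ(L, U)}
    (ht : IsLocalBasis L fun _ : Fin 1 => t) {c d : Γ(T, U)} (h : c • t = d • t) : c = d := by
  have := @(ht U le_rfl).1 (fun _ => c) (fun _ => d) (by simpa [res_refl] using h)
  exact congrFun this 0

theorem IsLocalBasis.repr_smul {T : Scheme.{u}} {L : T.Modules} {U : T.Opens} {t : Γ(L, U)}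
    (ht : IsLocalBasis L fun _ : Fin 1 => t) (s : Γ(L, U)) : ht.toBasis.repr s 0 • t = s := by
  conv_rhs => rw [← ht.toBasis.sum_repr s]
  simp [ht.toBasis_apply]

theorem LocalEnd.trace_eq {T : Scheme.{u}} {F : T.Modules} (hF : LocallyFree F) {U : T.Opens}
    (φ : LocalEnd F U) (a : Γ(T, U)) (h : φ.IsTrace a) : φ.trace hF = a :=
  (φ.existsUnique_isTrace hF).unique (φ.existsUnique_isTrace hF).choose_spec.1 h

namespace BuildingData

variable {T T' : Scheme.{u}} (χ : BuildingData T)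

theorem exists_bases (x : T) : ∃ V : T.Opens, x ∈ V ∧ ∃ (t : Γ(χ.L, V)) (y z : Γ(χ.F, V)),
    IsLocalBasis χ.L (fun _ : Fin 1 => t) ∧ IsLocalBasis χ.F ![y, z] := by
  obtain ⟨V, hV, b, hb⟩ := χ.rank_L x
  obtain ⟨W, hW, c, hc⟩ := χ.rank_F x
  refine ⟨V ⊓ W, ⟨hV, hW⟩, res χ.L inf_le_left (b 0), res χ.F inf_le_right (c 0),
    res χ.F inf_le_right (c 1), ?_, ?_⟩
  · refine (hb.restrict inf_le_left).congr fun i => ?_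
    rw [Subsingleton.elim i 0]
  · refine (hc.restrict inf_le_right).congr fun i => ?_
    fin_cases i <;> rfl

/-- Each open is covered by opens over which both sheaves are trivial. -/
theorem exists_bases_le {U : T.Opens} (x : T) (hx : x ∈ U) :
    ∃ (V : T.Opens) (_ : V ≤ U), x ∈ V ∧ ∃ (t : Γ(χ.L, V)) (y z : Γ(χ.F, V)),
      IsLocalBasis χ.L (fun _ : Fin 1 => t) ∧ IsLocalBasis χ.F ![y, z] := by
  obtain ⟨V, hV, t, y, z, ht, hyz⟩ := χ.exists_bases x
  refine ⟨U ⊓ V, inf_le_left, ⟨hx, hV⟩, res χ.L inf_le_right t, res χ.F inf_le_right y,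
    res χ.F inf_le_right z, ht.restrict inf_le_right, (hyz.restrict inf_le_right).congr fun i => ?_⟩
  fin_cases i <;> rfl

theorem section_ext_bases (M : T.Modules) {U : T.Opens} {x y : Γ(M, U)}
    (H : ∀ (V : T.Opens) (h : V ≤ U) (t : Γ(χ.L, V)) (y' z' : Γ(χ.F, V)),
      IsLocalBasis χ.L (fun _ : Fin 1 => t) → IsLocalBasis χ.F ![y', z'] →
      res M h x = res M h y) : x = y :=
  section_ext M fun p hp =>
    let ⟨V, h, hpV, t, y', z', ht, hyz⟩ := χ.exists_bases_le p hp
    ⟨V, h, hpV, H V h t y' z' ht hyz⟩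

theorem resO_m [Fact (IsUnit (2 : Γ(T, ⊤)))] {U V : T.Opens} (h : V ≤ U) (s t : Γ(χ.L, U)) :
    resO h (χ.m U s t) = χ.m V (res χ.L h s) (res χ.L h t) := by
  rw [m, m, map_mul]
  congr 1
  · exact map_inverse_two _ (two_isUnit U)
  · refine (LocalEnd.trace_eq _ _ _ fun W hW ⟨n, b, hb⟩ => ?_).symm
    rw [resO_resO, LocalEnd.resO_trace_eq _ _ _ hb]
    simp [squareEnd, res_res]

theorem resO_bracket {U V : T.Opens} (h : V ≤ U) (u v : Γ(χ.F, U)) :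
    resO h (χ.bracket U u v) = χ.bracket V (res χ.F h u) (res χ.F h v) := by
  refine (LocalEnd.trace_eq _ _ _ fun W hW ⟨n, b, hb⟩ => ?_).symm
  rw [bracket, resO_resO, LocalEnd.resO_trace_eq _ _ _ hb]
  simp [bracketEnd, res_res]

/-- The defining property of `(-,-)`: on the invertible sheaf `L` the function `(u, v)` acts as
`l ↦ ⟨α (l ⊗ v), u⟩`. -/
theorem bracket_smul (U : T.Opens) (u v : Γ(χ.F, U)) (l : Γ(χ.L, U)) :
    χ.bracket U u v • l = χ.pairing.app U (χ.α.app U l v) u := by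
  refine χ.section_ext_bases _ fun V h t y z ht hyz => ?_
  rw [res_smul, bracket, LocalEnd.resO_trace_eq _ _ _ hyz, χ.pairing.res_app U V h,
    χ.α.res_app U V h]
  exact trace_pairing_smul ht.toBasis hyz.toBasis (χ.α.app V) (χ.pairing.app V)
    (χ.pairing_self V) _ _ _

/-- As `L` is invertible, functions are determined by their action on local sections of `L`. -/
theorem functions_ext {U : T.Opens} {r r' : Γ(T, U)}
    (H : ∀ (V : T.Opens) (h : V ≤ U) (l : Γ(χ.L, V)), resO h r • l = resO h r' • l) : r = r' :=
  χ.section_ext_bases (unitSheaf T) fun V h t _ _ ht _ => ht.smul_injective (H V h t)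

/-- The bilinear map `m`. -/
noncomputable def mLin (U : T.Opens) : Γ(χ.L, U) →ₗ[Γ(T, U)] Γ(χ.L, U) →ₗ[Γ(T, U)] Γ(T, U) :=
  LinearMap.mk₂ Γ(T, U) (χ.m U)
    (fun s s' t => by
      rw [m, m, m, ← mul_add]
      congr 1
      refine LocalEnd.trace_eq _ _ _ fun W hW ⟨n, b, hb⟩ => ?_
      rw [map_add, LocalEnd.resO_trace_eq _ _ _ hb, LocalEnd.resO_trace_eq _ _ _ hb, ← map_add]
      congr 1
      ext x
      simp [squareEnd])
    (fun r s t => by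
      rw [m, m, smul_eq_mul, mul_left_comm]
      congr 1
      refine LocalEnd.trace_eq _ _ _ fun W hW ⟨n, b, hb⟩ => ?_
      rw [map_mul, LocalEnd.resO_trace_eq _ _ _ hb, ← smul_eq_mul, ← map_smul]
      congr 1
      ext x
      simp [squareEnd, res_smul])
    (fun s t t' => by
      rw [m, m, m, ← mul_add]
      congr 1
      refine LocalEnd.trace_eq _ _ _ fun W hW ⟨n, b, hb⟩ => ?_
      rw [map_add, LocalEnd.resO_trace_eq _ _ _ hb, LocalEnd.resO_trace_eq _ _ _ hb, ← map_add]
      congr 1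
      ext x
      simp [squareEnd])
    (fun r s t => by
      rw [m, m, smul_eq_mul, mul_left_comm]
      congr 1
      refine LocalEnd.trace_eq _ _ _ fun W hW ⟨n, b, hb⟩ => ?_
      rw [map_mul, LocalEnd.resO_trace_eq _ _ _ hb, ← smul_eq_mul, ← map_smul]
      congr 1
      ext x
      simp [squareEnd, res_smul])

theorem mLin_apply (U : T.Opens) (s t : Γ(χ.L, U)) : χ.mLin U s t = χ.m U s t := rfl

/-- The bilinear map `(-,-)`. -/
noncomputable def bracketLin (U : T.Opens) :
    Γ(χ.F, U) →ₗ[Γ(T, U)] Γ(χ.F, U) →ₗ[Γ(T, U)] Γ(T, U) :=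
  LinearMap.mk₂ Γ(T, U) (χ.bracket U)
    (fun u u' v => χ.functions_ext fun V h l => by
      simp only [map_add, add_smul, resO_bracket, bracket_smul])
    (fun r u v => χ.functions_ext fun V h l => by
      simp only [smul_eq_mul, map_mul, mul_smul, resO_bracket, bracket_smul, res_smul, map_smul])
    (fun u v v' => χ.functions_ext fun V h l => by
      simp only [map_add, add_smul, resO_bracket, bracket_smul, LinearMap.add_apply])
    (fun r u v => χ.functions_ext fun V h l => by
      simp only [smul_eq_mul, map_mul, mul_smul, resO_bracket, bracket_smul, res_smul, map_smul,
        LinearMap.smul_apply])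

theorem bracketLin_apply (U : T.Opens) (u v : Γ(χ.F, U)) :
    χ.bracketLin U u v = χ.bracket U u v := rfl

theorem m_comm (U : T.Opens) (s t : Γ(χ.L, U)) : χ.m U s t = χ.m U t s := by
  rw [m, m]
  congr 1
  refine LocalEnd.trace_eq _ _ _ fun W hW ⟨n, b, hb⟩ => ?_
  rw [LocalEnd.resO_trace_eq _ _ _ hb]
  exact LinearMap.trace_mul_comm _ _ _

/-- The trilinear map `m(s ⊗ t) r` is symmetric, because `L` is invertible. -/
theorem m_smul_comm [Fact (IsUnit (2 : Γ(T, ⊤)))] (U : T.Opens) (s t r : Γ(χ.L, U)) :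
    χ.m U s t • r = χ.m U t r • s := by
  refine χ.section_ext_bases _ fun V h l _ _ hl _ => ?_
  rw [res_smul, res_smul, resO_m, resO_m]
  obtain ⟨a, ha⟩ := hl.exists_smul (res χ.L h s)
  obtain ⟨b, hb⟩ := hl.exists_smul (res χ.L h t)
  obtain ⟨c, hc⟩ := hl.exists_smul (res χ.L h r)
  rw [ha, hb, hc, ← mLin_apply, ← mLin_apply]
  simp only [map_smul, LinearMap.smul_apply, smul_eq_mul, smul_smul]
  ring_nf

theorem pairing_swap (U : T.Opens) (u v : Γ(χ.F, U)) :
    χ.pairing.app U u v = -χ.pairing.app U v u := by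
  have := χ.pairing_self U (u + v)
  simp only [map_add, LinearMap.add_apply, χ.pairing_self, add_zero, zero_add] at this
  exact eq_neg_of_add_eq_zero_right this

/-- Morphisms of building data are compatible with `m`. -/
theorem Hom.map_m [Fact (IsUnit (2 : Γ(T, ⊤)))] {f : T' ⟶ T} {χ' : BuildingData T'}
    {χ : BuildingData T} (φ : Hom f χ' χ) (U : T.Opens) (s t : Γ(χ.L, U)) :
    f.app U (χ.m U s t) = χ'.m (f ⁻¹ᵁ U) (φ.mapL.app U s) (φ.mapL.app U t) := by
  rw [m, m, map_mul]
  congr 1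
  · exact map_inverse_two (f.app U).hom (two_isUnit U)
  · refine φ.mapF.app_trace _ _ _ _ fun V h x => ?_
    simp only [squareEnd, LinearMap.comp_apply, φ.map_α]
    rw [← φ.mapL.res_app h, ← φ.mapL.res_app h]

/-- Morphisms of building data are compatible with `(-,-)`. -/
theorem Hom.map_bracket {f : T' ⟶ T} {χ' : BuildingData T'}
    {χ : BuildingData T} (φ : Hom f χ' χ) (U : T.Opens) (u v : Γ(χ.F, U)) :
    f.app U (χ.bracket U u v) = χ'.bracket (f ⁻¹ᵁ U) (φ.mapF.app U u) (φ.mapF.app U v) := by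
  refine φ.mapF.app_trace _ _ _ _ fun V h x => ?_
  simp only [bracketEnd, LinearMap.comp_apply, LinearMap.flip_apply, φ.map_α, φ.map_pairing]
  rw [← φ.mapF.res_app h, ← φ.mapF.res_app h]

/-- If `α_s ∘ α_t` is a homothety, its factor is `m (s ⊗ t)`. -/
theorem m_eq_of_smul [Fact (IsUnit (2 : Γ(T, ⊤)))] (U : T.Opens) (s t : Γ(χ.L, U)) (a : Γ(T, U))
    (h : ∀ (V : T.Opens) (hV : V ≤ U) (u : Γ(χ.F, V)),
      χ.α.app V (res χ.L hV s) (χ.α.app V (res χ.L hV t) u) = resO hV a • u) :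
    χ.m U s t = a := by
  refine χ.functions_ext fun V hV l => ?_
  refine χ.section_ext_bases _ fun W hW l' y z hl hyz => ?_
  rw [res_smul, res_smul, resO_resO, resO_resO]
  congr 1
  rw [m, map_mul, LocalEnd.resO_trace_eq _ _ _ hyz, map_inverse_two _ (two_isUnit U)]
  have : (χ.squareEnd U s t).app W (hW.trans hV) =
      resO (hW.trans hV) a • (LinearMap.id : Γ(χ.F, W) →ₗ[Γ(T, W)] Γ(χ.F, W)) := by
    ext u
    exact h W _ u
  rw [this, map_smul, LinearMap.trace_eq_matrix_trace _ hyz.toBasis, LinearMap.toMatrix_id]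
  have h2 : ((Fintype.card (Fin 2) : ℕ) : Γ(T, W)) = 2 := by simp
  rw [Matrix.trace_one, h2, smul_eq_mul, mul_comm, mul_assoc,
    Ring.mul_inverse_cancel _ (two_isUnit W), mul_one]

/-- The five relations, in a form which does not refer to local generators of `L` and in which
the fifth one lives in `L` only. -/
structure Relations (χ : BuildingData T) : Prop where
  α_α (U : T.Opens) (s t : Γ(χ.L, U)) (u : Γ(χ.F, U)) :
    χ.α.app U s (χ.α.app U t u) = χ.m U s t • u
  pairing_α (U : T.Opens) (l : Γ(χ.L, U)) (u v : Γ(χ.F, U)) :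
    χ.pairing.app U (χ.α.app U l u) v = χ.pairing.app U (χ.α.app U l v) u
  α_β (U : T.Opens) (l : Γ(χ.L, U)) (u v : Γ(χ.F, U)) :
    χ.α.app U l (χ.β.app U u v) = -χ.β.app U u (χ.α.app U l v)
  β_β (U : T.Opens) (u v w : Γ(χ.F, U)) :
    χ.β.app U (χ.β.app U u v) w =
      χ.bracket U v w • u + χ.α.app U (χ.pairing.app U v w) u
  pairing_β (U : T.Opens) (u v w : Γ(χ.F, U)) :
    χ.pairing.app U u (χ.β.app U v w) = χ.pairing.app U w (χ.β.app U u v)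

/-- After the choice of a generator `t` of `L`, the function `(u, v)` is `⟨α(v), u⟩`. -/
theorem bracket_eq_repr (U : T.Opens) (t : Γ(χ.L, U)) (ht : IsLocalBasis χ.L fun _ : Fin 1 => t)
    (u v : Γ(χ.F, U)) :
    χ.bracket U u v = ht.toBasis.repr (χ.pairing.app U (χ.α.app U t v) u) 0 := by
  apply ht.smul_injective
  rw [ht.repr_smul, bracket_smul]

/-- By multilinearity and locality it suffices to test the relations on a local generator of `L`. -/
theorem satisfiesRelations_iff [Fact (IsUnit (2 : Γ(T, ⊤)))] :
    χ.SatisfiesRelations ↔ χ.Relations := by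
  constructor
  · intro H
    refine ⟨fun U s t u => ?_, fun U l u v => ?_, fun U l u v => ?_, fun U u v w => ?_,
      fun U u v w => ?_⟩ <;> refine χ.section_ext_bases _ fun V h t₀ y z ht hyz => ?_ <;>
      have H' := H V t₀ y z ht hyz <;> dsimp only at H' <;> obtain ⟨h1, h2, h3, h4, h5⟩ := H'
    · obtain ⟨a, ha⟩ := ht.exists_smul (res χ.L h s)
      obtain ⟨b, hb⟩ := ht.exists_smul (res χ.L h t)
      rw [χ.α.res_app U V h, χ.α.res_app U V h, res_smul, resO_m, ha, hb, ← mLin_apply]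
      simp only [map_smul, LinearMap.smul_apply, h1, smul_smul, smul_eq_mul, mLin_apply]
    · obtain ⟨a, ha⟩ := ht.exists_smul (res χ.L h l)
      rw [χ.pairing.res_app U V h, χ.pairing.res_app U V h, χ.α.res_app U V h,
        χ.α.res_app U V h, ha]
      simp only [map_smul, LinearMap.smul_apply]
      rw [← ht.repr_smul (χ.pairing.app V (χ.α.app V t₀ (res χ.F h u)) (res χ.F h v)), h2,
        ht.repr_smul]
    · obtain ⟨a, ha⟩ := ht.exists_smul (res χ.L h l)
      rw [χ.α.res_app U V h, map_neg, χ.β.res_app U V h, χ.β.res_app U V h, χ.α.res_app U V h, ha]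
      simp only [map_smul, LinearMap.smul_apply, h3, smul_neg]
    · rw [χ.β.res_app U V h, χ.β.res_app U V h, h4, map_add, res_smul, resO_bracket,
        χ.α.res_app U V h, χ.pairing.res_app U V h, χ.bracket_eq_repr V t₀ ht]
      congr 1
      refine (?_ : _ = χ.α.app V (_ • t₀) _).trans (by rw [ht.repr_smul])
      rw [map_smul, LinearMap.smul_apply]
    · rw [χ.pairing.res_app U V h, χ.pairing.res_app U V h, χ.β.res_app U V h, χ.β.res_app U V h,
        ← ht.repr_smul (χ.pairing.app V (res χ.F h u) _), h5, ht.repr_smul]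
  · intro H U t y z ht hyz
    refine ⟨fun u => H.α_α U t t u, fun u v => ?_, fun u v => H.α_β U t u v, fun u v w => ?_,
      fun u v w => ?_⟩
    · dsimp only
      rw [H.pairing_α]
    · dsimp only
      rw [H.β_β, χ.bracket_eq_repr U t ht]
      conv_lhs => rw [← ht.repr_smul (χ.pairing.app U v w)]
      rw [map_smul, LinearMap.smul_apply]
    · dsimp only
      rw [H.pairing_β]

/-- Only the component in `𝒪_T` of the fifth diagram needs an argument: multiplied by a section of
`L`, it becomes an identity between values of `⟨-,-⟩`, which follows from the other relations. -/
theorem satisfiesDiagrams_iff : χ.SatisfiesDiagrams ↔ χ.Relations := by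
  constructor
  · intro H
    have hE := fun U u v w => congrArg Prod.snd (H.diagram_E U u v w)
    simp only [γ, γ'] at hE
    refine ⟨H.diagram_A, fun U l u v => ?_, fun U l u v => ?_, fun U u v w => ?_,
      fun U u v w => ?_⟩
    · rw [χ.pairing_swap U _ u, H.diagram_symm, map_neg, LinearMap.neg_apply, neg_neg]
    · rw [H.diagram_C, neg_neg]
    · rw [H.diagram_D]
      simp [γ']
    · rw [hE, χ.pairing_swap U w]
  · intro H
    refine ⟨H.α_α, fun U u l v => ?_, fun U u v l => ?_, fun U u v w => ?_, fun U u v w => ?_⟩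
    · rw [map_neg, LinearMap.neg_apply, χ.pairing_swap U u, H.pairing_α]
    · rw [H.α_β, neg_neg]
    · rw [H.β_β]
      simp [γ']
    · refine Prod.ext (χ.functions_ext fun V h l => ?_) ?_
      · simp only [γ, γ', resO_bracket, bracket_smul, χ.β.res_app U V h]
        rw [χ.pairing_swap V _ (res χ.F h u), H.α_β, map_neg, neg_neg, H.pairing_β]
      · simp only [γ, γ']
        rw [H.pairing_β, χ.pairing_swap U w]

end BuildingData
end SThreeCover

/-! ### Coordinates of a presented algebra -/

namespace SThreeCover

/-- A direct summand inherits a local basis if a part of a local basis of the whole sheaf lies in it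
and the rest is annihilated by the projection. -/
theorem IsLocalBasis.retract_of_injective {T : Scheme.{u}} {M N : T.Modules} (i : N ⟶ M)
    (e : M ⟶ N) (hie : ∀ (U : T.Opens) (x : Γ(N, U)), e.app U (i.app U x) = x) {U : T.Opens}
    {κ κ' : Type} [Fintype κ] [Fintype κ'] {b : κ' → Γ(N, U)} {c : κ → Γ(M, U)}
    (hc : IsLocalBasis M c) (S : κ' → κ) (hS : Function.Injective S)
    (hb : ∀ k, c (S k) = i.app U (b k)) (h0 : ∀ k ∉ Set.range S, e.app U (c k) = 0) :
    IsLocalBasis N b := by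
  classical
  have := hc.reindex (((Equiv.ofInjective S hS).sumCongr (Equiv.refl _)).trans
    (Equiv.sumCompl (· ∈ Set.range S)))
  refine IsLocalBasis.retract i e hie (d := fun k : {k // k ∉ Set.range S} => c k)
    (fun k => h0 k.1 k.2) (this.congr fun k => ?_)
  rcases k with k | k
  · simp [hb]
  · simp

namespace AlgebraPresentation

variable {T T' : Scheme.{u}} {χ : BuildingData T} {A : EquivariantAlgebra T}
  (P : AlgebraPresentation χ A)

/-- The decomposition `𝒪_T ⊕ L ⊕ F₁ ⊕ F₂ ≅ A` on sections. -/
noncomputable def equiv (U : T.Opens) :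
    (Γ(T, U) × Γ(χ.L, U) × Γ(χ.F, U) × Γ(χ.F, U)) ≃ₗ[Γ(T, U)] Γ(A.sheaf, U) :=
  LinearEquiv.ofBijective
    { toFun := fun x =>
        x.1 • A.oneOn U + P.ιL.app U x.2.1 + P.ι₁.app U x.2.2.1 + P.ι₂.app U x.2.2.2
      map_add' := fun x y => by simp only [Prod.fst_add, Prod.snd_add, map_add, add_smul]; abel
      map_smul' := fun r x => by
        simp only [Prod.smul_fst, Prod.smul_snd, Scheme.Modules.Hom.app_smul, smul_add, smul_eq_mul,
          mul_smul, RingHom.id_apply] }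
    (P.bijective U)

theorem equiv_apply (U : T.Opens) (x : Γ(T, U) × Γ(χ.L, U) × Γ(χ.F, U) × Γ(χ.F, U)) :
    P.equiv U x =
      x.1 • A.oneOn U + P.ιL.app U x.2.1 + P.ι₁.app U x.2.2.1 + P.ι₂.app U x.2.2.2 := rfl

theorem oneOn_res {U V : T.Opens} (h : V ≤ U) : res A.sheaf h (A.oneOn U) = A.oneOn V :=
  res_res _ _ _ _

/-- The four coordinates of a section. -/
noncomputable def coord (U : T.Opens) :
    Γ(A.sheaf, U) →ₗ[Γ(T, U)] Γ(T, U) × Γ(χ.L, U) × Γ(χ.F, U) × Γ(χ.F, U) :=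
  (P.equiv U).symm.toLinearMap

theorem coord_eq (U : T.Opens) (r : Γ(T, U)) (s : Γ(χ.L, U)) (u v : Γ(χ.F, U)) :
    P.coord U (r • A.oneOn U + P.ιL.app U s + P.ι₁.app U u + P.ι₂.app U v) = (r, s, u, v) :=
  (P.equiv U).symm_apply_apply (r, s, u, v)

theorem coord_one (U : T.Opens) : P.coord U (A.oneOn U) = (1, 0, 0, 0) := by
  simpa using P.coord_eq U 1 0 0 0

theorem coord_ιL (U : T.Opens) (s : Γ(χ.L, U)) : P.coord U (P.ιL.app U s) = (0, s, 0, 0) := by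
  simpa using P.coord_eq U 0 s 0 0

theorem coord_ι₁ (U : T.Opens) (u : Γ(χ.F, U)) : P.coord U (P.ι₁.app U u) = (0, 0, u, 0) := by
  simpa using P.coord_eq U 0 0 u 0

theorem coord_ι₂ (U : T.Opens) (u : Γ(χ.F, U)) : P.coord U (P.ι₂.app U u) = (0, 0, 0, u) := by
  simpa using P.coord_eq U 0 0 0 u

theorem decomp (U : T.Opens) (x : Γ(A.sheaf, U)) :
    x = (P.coord U x).1 • A.oneOn U + P.ιL.app U (P.coord U x).2.1 +
      P.ι₁.app U (P.coord U x).2.2.1 + P.ι₂.app U (P.coord U x).2.2.2 :=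
  ((P.equiv U).apply_symm_apply x).symm

theorem coord_res {U V : T.Opens} (h : V ≤ U) (x : Γ(A.sheaf, U)) :
    P.coord V (res A.sheaf h x) = (resO h (P.coord U x).1, res χ.L h (P.coord U x).2.1,
      res χ.F h (P.coord U x).2.2.1, res χ.F h (P.coord U x).2.2.2) := by
  rw [← P.coord_eq]
  conv_lhs => rw [P.decomp U x]
  simp only [map_add, res_smul, res_hom_app, oneOn_res]

theorem ιL_injective (U : T.Opens) {s s' : Γ(χ.L, U)} (h : P.ιL.app U s = P.ιL.app U s') :
    s = s' := by
  simpa [coord_ιL] using congrArg (P.coord U) h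

theorem ι₁_injective (U : T.Opens) {s s' : Γ(χ.F, U)} (h : P.ι₁.app U s = P.ι₁.app U s') :
    s = s' := by
  simpa [coord_ι₁] using congrArg (P.coord U) h

theorem ι₂_injective (U : T.Opens) {s s' : Γ(χ.F, U)} (h : P.ι₂.app U s = P.ι₂.app U s') :
    s = s' := by
  simpa [coord_ι₂] using congrArg (P.coord U) h

/-- The projection onto `L`. -/
noncomputable def πL : A.sheaf ⟶ χ.L :=
  homMk (fun U => LinearMap.fst _ _ _ ∘ₗ LinearMap.snd _ _ _ ∘ₗ P.coord U) fun U V h x => by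
    simp [P.coord_res h]

/-- The projection onto `F₁`. -/
noncomputable def π₁ : A.sheaf ⟶ χ.F :=
  homMk (fun U => LinearMap.fst _ _ _ ∘ₗ LinearMap.snd _ _ _ ∘ₗ LinearMap.snd _ _ _ ∘ₗ P.coord U)
    fun U V h x => by simp [P.coord_res h]

theorem πL_app (U : T.Opens) (x : Γ(A.sheaf, U)) : P.πL.app U x = (P.coord U x).2.1 := rfl

theorem π₁_app (U : T.Opens) (x : Γ(A.sheaf, U)) : P.π₁.app U x = (P.coord U x).2.2.1 := rfl

/-- To prove an additive property of all sections it suffices to treat the four summands. -/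
theorem induction (U : T.Opens) {C : Γ(A.sheaf, U) → Prop} (hadd : ∀ x y, C x → C y → C (x + y))
    (h0 : ∀ r : Γ(T, U), C (r • A.oneOn U)) (hL : ∀ s, C (P.ιL.app U s))
    (h₁ : ∀ u, C (P.ι₁.app U u)) (h₂ : ∀ u, C (P.ι₂.app U u)) (x : Γ(A.sheaf, U)) : C x := by
  rw [P.decomp U x]
  exact hadd _ _ (hadd _ _ (hadd _ _ (h0 _) (hL _)) (h₁ _)) (h₂ _)

theorem p_ιL (U : T.Opens) (k : ZMod 3) (s : Γ(χ.L, U)) :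
    (A.coaction.gmod U).p k (P.ιL.app U s) = if k = 0 then P.ιL.app U s else 0 := by
  have h := A.coaction.degree_of_mu_eq U _ _ (P.mu_L U s)
  rw [← h, GModule.p_p]
  split_ifs with hk <;> simp [*]

theorem p_ι₁ (U : T.Opens) (k : ZMod 3) (s : Γ(χ.F, U)) :
    (A.coaction.gmod U).p k (P.ι₁.app U s) = if k = 1 then P.ι₁.app U s else 0 := by
  have h := A.coaction.degree_of_mu_eq U _ _ (P.mu_F₁ U s)
  rw [← h, GModule.p_p]
  split_ifs with hk <;> simp [*]

theorem p_ι₂ (U : T.Opens) (k : ZMod 3) (s : Γ(χ.F, U)) :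
    (A.coaction.gmod U).p k (P.ι₂.app U s) = if k = 2 then P.ι₂.app U s else 0 := by
  have h := A.coaction.degree_of_mu_eq U _ _ (P.mu_F₂ U s)
  rw [← h, GModule.p_p]
  split_ifs with hk <;> simp [*]

theorem p_one (U : T.Opens) (k : ZMod 3) :
    (A.coaction.gmod U).p k (A.oneOn U) = if k = 0 then A.oneOn U else 0 := by
  have h := (A.p_σ_one U).1
  rw [← h, GModule.p_p]
  split_ifs with hk <;> simp [*]

theorem σ_ιL (U : T.Opens) (s : Γ(χ.L, U)) :
    (A.coaction.gmod U).σ (P.ιL.app U s) = -P.ιL.app U s := by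
  rw [← Coaction.sigma_eq, P.sigma_L]

theorem σ_ι₁ (U : T.Opens) (s : Γ(χ.F, U)) :
    (A.coaction.gmod U).σ (P.ι₁.app U s) = P.ι₂.app U s := by
  rw [← Coaction.sigma_eq, P.sigma_F₁]

theorem σ_ι₂ (U : T.Opens) (s : Γ(χ.F, U)) :
    (A.coaction.gmod U).σ (P.ι₂.app U s) = P.ι₁.app U s := by
  rw [← Coaction.sigma_eq, P.sigma_F₂]

/-- The summand `F₁` is the part of degree `1`. -/
theorem eq_ι₁_of_degree (U : T.Opens) (x : Γ(A.sheaf, U)) (h : (A.coaction.gmod U).p 1 x = x) :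
    x = P.ι₁.app U (P.coord U x).2.2.1 := by
  have h10 : (1 : ZMod 3) ≠ 0 := by decide
  have h12 : (1 : ZMod 3) ≠ 2 := by decide
  conv_lhs => rw [← h, P.decomp U x]
  simp [p_ιL, p_ι₁, p_ι₂, p_one, h10, h12]

/-- The summand `L` is the part of degree `0` on which `σ` acts as `-1`: the component in `𝒪_T` of
an element of this part is equal to its opposite, hence vanishes because `2` is invertible. -/
theorem eq_ιL_of_degree [Fact (IsUnit (2 : Γ(T, ⊤)))] (U : T.Opens) (x : Γ(A.sheaf, U))
    (h : (A.coaction.gmod U).p 0 x = x) (hσ : (A.coaction.gmod U).σ x = -x) :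
    x = P.ιL.app U (P.coord U x).2.1 := by
  have h10 : (0 : ZMod 3) ≠ 1 := by decide
  have h12 : (0 : ZMod 3) ≠ 2 := by decide
  have hx : x = (P.coord U x).1 • A.oneOn U + P.ιL.app U (P.coord U x).2.1 := by
    conv_lhs => rw [← h, P.decomp U x]
    simp [p_ιL, p_ι₁, p_ι₂, p_one, h10, h12]
  have h0 : (P.coord U x).1 = 0 := by
    have h1 : (A.coaction.gmod U).σ x =
        (P.coord U x).1 • A.oneOn U + P.ιL.app U (-(P.coord U x).2.1) + P.ι₁.app U 0 +
          P.ι₂.app U 0 := by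
      conv_lhs => rw [hx]
      simp [σ_ιL, (A.p_σ_one U).2]
    have h2 := congrArg (fun y => (P.coord U y).1) h1
    dsimp only at h2
    rw [hσ, coord_eq, map_neg (P.coord U), Prod.fst_neg] at h2
    have h3 : (2 : Γ(T, U)) * (P.coord U x).1 = 2 * 0 := by
      linear_combination -h2
    exact (two_isUnit U).mul_left_cancel h3
  conv_lhs => rw [hx, h0, zero_smul, zero_add]

/-- The local basis of `A` defined by local bases of `L` and `F`. -/
theorem isLocalBasis {U : T.Opens} {κ ι : Type} [Fintype κ] [Fintype ι] {t : κ → Γ(χ.L, U)}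
    {b : ι → Γ(χ.F, U)} (ht : IsLocalBasis χ.L t) (hb : IsLocalBasis χ.F b) :
    IsLocalBasis A.sheaf (Sum.elim (fun _ : Fin 1 => A.oneOn U)
      (Sum.elim (fun k => P.ιL.app U (t k))
        (Sum.elim (fun k => P.ι₁.app U (b k)) fun k => P.ι₂.app U (b k)))) := by
  intro V h
  have hO : Function.Bijective fun c : Fin 1 → Γ(T, V) => c 0 :=
    (Equiv.funUnique (Fin 1) Γ(T, V)).bijective
  have h1 := (P.bijective V).comp
    (hO.prodMap ((ht V h).prodMap ((hb V h).prodMap (hb V h))))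
  let e : (Fin 1 ⊕ κ ⊕ ι ⊕ ι → Γ(T, V)) ≃
      (Fin 1 → Γ(T, V)) × (κ → Γ(T, V)) × (ι → Γ(T, V)) × (ι → Γ(T, V)) :=
    (Equiv.sumArrowEquivProdArrow _ _ _).trans (Equiv.prodCongr (Equiv.refl _)
      ((Equiv.sumArrowEquivProdArrow _ _ _).trans (Equiv.prodCongr (Equiv.refl _)
        (Equiv.sumArrowEquivProdArrow _ _ _))))
  convert h1.comp e.bijective using 1
  funext c
  simp [e, Fintype.sum_sum_type, res_hom_app, oneOn_res, add_assoc,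
    Scheme.Modules.Hom.app_smul]

end AlgebraPresentation
end SThreeCover

/-! ### Morphisms of presented algebras -/

namespace SThreeCover

variable {T T' T'' : Scheme.{u}}

namespace EquivariantAlgebra.Hom

variable {f : T' ⟶ T} {A' : EquivariantAlgebra T'} {A : EquivariantAlgebra T}

theorem map_p (ψ : Hom f A' A) (U : T.Opens) (k : ZMod 3) (x : Γ(A.sheaf, U)) :
    ψ.map.app U ((A.coaction.gmod U).p k x) =
      (A'.coaction.gmod (f ⁻¹ᵁ U)).p k (ψ.map.app U x) :=
  (((A.coaction.gmod U).rTensor_coact_iff (A'.coaction.gmod _) (ψ.map.app U)).1 fun x => by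
    rw [← Coaction.app_eq, ← Coaction.app_eq, ψ.map_coaction]).1 k x

theorem map_σ (ψ : Hom f A' A) (U : T.Opens) (x : Γ(A.sheaf, U)) :
    ψ.map.app U ((A.coaction.gmod U).σ x) =
      (A'.coaction.gmod (f ⁻¹ᵁ U)).σ (ψ.map.app U x) :=
  (((A.coaction.gmod U).rTensor_coact_iff (A'.coaction.gmod _) (ψ.map.app U)).1 fun x => by
    rw [← Coaction.app_eq, ← Coaction.app_eq, ψ.map_coaction]).2 x

theorem ext_map {φ ψ : Hom f A' A} (h : φ.map = ψ.map) : φ = ψ := by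
  cases φ; cases ψ; cases h; rfl

end EquivariantAlgebra.Hom

namespace AlgebraPresentation

variable {χ : BuildingData T} {A : EquivariantAlgebra T} (P : AlgebraPresentation χ A)
  {χ' : BuildingData T'} {A' : EquivariantAlgebra T'} (P' : AlgebraPresentation χ' A')
  {f : T' ⟶ T}

section OfData

variable (φ : BuildingData.Hom f χ' χ)

/-- The map `id ⊕ a ⊕ b ⊕ b` on sections. -/
noncomputable def mapFun (U : T.Opens) : Γ(A.sheaf, U) →+ Γ(A'.sheaf, f ⁻¹ᵁ U) where
  toFun x := f.app U (P.coord U x).1 • A'.oneOn (f ⁻¹ᵁ U) +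
    P'.ιL.app (f ⁻¹ᵁ U) (φ.mapL.app U (P.coord U x).2.1) +
    P'.ι₁.app (f ⁻¹ᵁ U) (φ.mapF.app U (P.coord U x).2.2.1) +
    P'.ι₂.app (f ⁻¹ᵁ U) (φ.mapF.app U (P.coord U x).2.2.2)
  map_zero' := by simp
  map_add' x y := by
    simp only [map_add, Prod.fst_add, Prod.snd_add, add_smul]
    abel

theorem mapFun_apply (U : T.Opens) (x : Γ(A.sheaf, U)) : mapFun P P' φ U x =
    f.app U (P.coord U x).1 • A'.oneOn (f ⁻¹ᵁ U) +
    P'.ιL.app (f ⁻¹ᵁ U) (φ.mapL.app U (P.coord U x).2.1) +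
    P'.ι₁.app (f ⁻¹ᵁ U) (φ.mapF.app U (P.coord U x).2.2.1) +
    P'.ι₂.app (f ⁻¹ᵁ U) (φ.mapF.app U (P.coord U x).2.2.2) := rfl

theorem mapFun_one (U : T.Opens) : mapFun P P' φ U (A.oneOn U) = A'.oneOn (f ⁻¹ᵁ U) := by
  simp [mapFun_apply, coord_one]

theorem mapFun_ιL (U : T.Opens) (s : Γ(χ.L, U)) :
    mapFun P P' φ U (P.ιL.app U s) = P'.ιL.app (f ⁻¹ᵁ U) (φ.mapL.app U s) := by
  simp [mapFun_apply, coord_ιL]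

theorem mapFun_ι₁ (U : T.Opens) (s : Γ(χ.F, U)) :
    mapFun P P' φ U (P.ι₁.app U s) = P'.ι₁.app (f ⁻¹ᵁ U) (φ.mapF.app U s) := by
  simp [mapFun_apply, coord_ι₁]

theorem mapFun_ι₂ (U : T.Opens) (s : Γ(χ.F, U)) :
    mapFun P P' φ U (P.ι₂.app U s) = P'.ι₂.app (f ⁻¹ᵁ U) (φ.mapF.app U s) := by
  simp [mapFun_apply, coord_ι₂]

theorem mapFun_smul (U : T.Opens) (r : Γ(T, U)) (x : Γ(A.sheaf, U)) :
    mapFun P P' φ U (r • x) = f.app U r • mapFun P P' φ U x := by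
  simp only [mapFun_apply, map_smul, Prod.smul_fst, Prod.smul_snd, CartMap.app_smul, smul_eq_mul,
    map_mul, mul_smul, Scheme.Modules.Hom.app_smul, smul_add]

theorem res_mapFun {U V : T.Opens} (h : V ≤ U) (x : Γ(A.sheaf, U)) :
    res A'.sheaf (f.preimage_mono h) (mapFun P P' φ U x) =
      mapFun P P' φ V (res A.sheaf h x) := by
  simp only [mapFun_apply, map_add, res_smul, res_hom_app, oneOn_res, P.coord_res h]
  rw [resO_app f h, φ.mapL.res_app h, φ.mapF.res_app h, φ.mapF.res_app h]

/-- The morphism of sheaves `id ⊕ a ⊕ b ⊕ b`. -/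
noncomputable def mapPush : A.sheaf ⟶ (Scheme.Modules.pushforward f).obj A'.sheaf :=
  pushMk f (mapFun P P' φ) (mapFun_smul P P' φ) fun _ _ h x => res_mapFun P P' φ h x

/-- The cartesian map `id ⊕ a ⊕ b ⊕ b`. -/
noncomputable def mapCart : CartMap f A.sheaf A'.sheaf where
  hom := mapPush P P' φ
  isLocalBasis U n b hb := by
    refine isLocalBasis_pushApp (mapPush P P' φ) (fun t => ?_) U b hb
    obtain ⟨V, htV, s, y, z, hs, hyz⟩ := χ.exists_bases t
    refine ⟨V, htV, _, inferInstance, _, P.isLocalBasis hs hyz, ?_⟩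
    refine (P'.isLocalBasis (φ.mapL.isLocalBasis' hs) (φ.mapF.isLocalBasis' hyz)).congr ?_
    rintro (k | k | k | k)
    · exact (mapFun_one P P' φ V).symm
    · exact (mapFun_ιL P P' φ V _).symm
    · exact (mapFun_ι₁ P P' φ V _).symm
    · exact (mapFun_ι₂ P P' φ V _).symm

theorem mapCart_app (U : T.Opens) (x : Γ(A.sheaf, U)) :
    (mapCart P P' φ).app U x = mapFun P P' φ U x := rfl

theorem mapFun_mul [Fact (IsUnit (2 : Γ(T, ⊤)))] (U : T.Opens) (x y : Γ(A.sheaf, U)) :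
    mapFun P P' φ U (A.mul.app U x y) =
      A'.mul.app (f ⁻¹ᵁ U) (mapFun P P' φ U x) (mapFun P P' φ U y) := by
  have h1 : ∀ (A : EquivariantAlgebra T) (U : T.Opens) x, A.mul.app U (A.oneOn U) x = x :=
    fun A U x => A.one_mul U x
  have h1' : ∀ (A : EquivariantAlgebra T) (U : T.Opens) x, A.mul.app U x (A.oneOn U) = x :=
    fun A U x => A.mul_one U x
  have h2 : ∀ (A : EquivariantAlgebra T') (U : T'.Opens) x, A.mul.app U (A.oneOn U) x = x :=
    fun A U x => A.one_mul U x
  have h2' : ∀ (A : EquivariantAlgebra T') (U : T'.Opens) x, A.mul.app U x (A.oneOn U) = x :=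
    fun A U x => A.mul_one U x
  induction x using P.induction with
  | hadd x x' hx hx' => simp only [map_add, LinearMap.add_apply, hx, hx']
  | h0 r => simp only [map_smul, LinearMap.smul_apply, h1, h2, mapFun_smul, mapFun_one]
  | hL s =>
    induction y using P.induction with
    | hadd x x' hx hx' => simp only [map_add, hx, hx']
    | h0 r => simp only [map_smul, h1', h2', mapFun_smul, mapFun_one]
    | hL s' =>
      rw [P.mul_L_L, mapFun_smul, mapFun_one, mapFun_ιL, mapFun_ιL, P'.mul_L_L, φ.map_m]
    | h₁ u => rw [P.mul_L_F₁, mapFun_ιL, mapFun_ι₁, mapFun_ι₁, P'.mul_L_F₁, φ.map_α]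
    | h₂ u => rw [P.mul_L_F₂, mapFun_ιL, mapFun_ι₂, mapFun_ι₂, P'.mul_L_F₂, map_neg, φ.map_α]
  | h₁ u =>
    induction y using P.induction with
    | hadd x x' hx hx' => simp only [map_add, hx, hx']
    | h0 r => simp only [map_smul, h1', h2', mapFun_smul, mapFun_one]
    | hL s => rw [P.mul_F₁_L, mapFun_ιL, mapFun_ι₁, mapFun_ι₁, P'.mul_F₁_L, φ.map_α]
    | h₁ v => rw [P.mul_F₁_F₁, mapFun_ι₂, mapFun_ι₁, mapFun_ι₁, P'.mul_F₁_F₁, φ.map_β]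
    | h₂ v =>
      rw [P.mul_F₁_F₂, map_add, mapFun_smul, mapFun_one, mapFun_ιL, mapFun_ι₁, mapFun_ι₂,
        P'.mul_F₁_F₂, φ.map_bracket, φ.map_pairing]
  | h₂ u =>
    induction y using P.induction with
    | hadd x x' hx hx' => simp only [map_add, hx, hx']
    | h0 r => simp only [map_smul, h1', h2', mapFun_smul, mapFun_one]
    | hL s => rw [P.mul_F₂_L, mapFun_ιL, mapFun_ι₂, mapFun_ι₂, P'.mul_F₂_L, map_neg, φ.map_α]
    | h₁ v =>
      rw [P.mul_F₂_F₁, map_sub, mapFun_smul, mapFun_one, mapFun_ιL, mapFun_ι₁, mapFun_ι₂,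
        P'.mul_F₂_F₁, φ.map_bracket, φ.map_pairing]
    | h₂ v => rw [P.mul_F₂_F₂, mapFun_ι₁, mapFun_ι₂, mapFun_ι₂, P'.mul_F₂_F₂, φ.map_β]

/-- The morphism `id ⊕ a ⊕ b ⊕ b` of equivariant algebras defined by a morphism `(a, b)` of building
data. -/
noncomputable def mapHom [Fact (IsUnit (2 : Γ(T, ⊤)))] : EquivariantAlgebra.Hom f A' A where
  map := mapCart P P' φ
  map_coaction U x := by
    rw [Coaction.app_eq, Coaction.app_eq]
    revert x
    rw [GModule.rTensor_coact_iff]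
    simp only [mapCart_app]
    constructor
    · intro k x
      induction x using P.induction with
      | hadd x x' hx hx' => simp only [map_add, hx, hx']
      | h0 r =>
        rw [map_smul, mapFun_smul, mapFun_smul, map_smul, mapFun_one, p_one, p_one]
        split_ifs <;> simp [mapFun_one]
      | hL s =>
        rw [p_ιL P, mapFun_ιL, p_ιL P']
        split_ifs <;> simp [mapFun_ιL]
      | h₁ s =>
        rw [p_ι₁ P, mapFun_ι₁, p_ι₁ P']
        split_ifs <;> simp [mapFun_ι₁]
      | h₂ s =>
        rw [p_ι₂ P, mapFun_ι₂, p_ι₂ P']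
        split_ifs <;> simp [mapFun_ι₂]
    · intro x
      induction x using P.induction with
      | hadd x x' hx hx' => simp only [map_add, hx, hx']
      | h0 r =>
        rw [map_smul, mapFun_smul, mapFun_smul, map_smul, (A.p_σ_one U).2, mapFun_one,
          (A'.p_σ_one _).2]
      | hL s => rw [σ_ιL P, map_neg, mapFun_ιL, σ_ιL P']
      | h₁ s => rw [σ_ι₁ P, mapFun_ι₁, mapFun_ι₂, σ_ι₁ P']
      | h₂ s => rw [σ_ι₂ P, mapFun_ι₁, mapFun_ι₂, σ_ι₂ P']
  map_mul := mapFun_mul P P' φ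
  map_one := mapFun_one P P' φ

end OfData

/-- A morphism of algebras is determined by its restrictions to `L`, `F₁` and `F₂`. -/
theorem hom_ext {φ ψ : EquivariantAlgebra.Hom f A' A}
    (hL : ∀ U s, φ.map.app U (P.ιL.app U s) = ψ.map.app U (P.ιL.app U s))
    (h₁ : ∀ U s, φ.map.app U (P.ι₁.app U s) = ψ.map.app U (P.ι₁.app U s))
    (h₂ : ∀ U s, φ.map.app U (P.ι₂.app U s) = ψ.map.app U (P.ι₂.app U s)) : φ = ψ := by
  refine EquivariantAlgebra.Hom.ext_map (CartMap.ext_app fun U x => ?_)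
  induction x using P.induction with
  | hadd x x' hx hx' => simp only [map_add, hx, hx']
  | h0 r => rw [CartMap.app_smul, CartMap.app_smul, φ.map_one, ψ.map_one]
  | hL s => exact hL U s
  | h₁ s => exact h₁ U s
  | h₂ s => exact h₂ U s

section OfAlgebra

variable (ψ : EquivariantAlgebra.Hom f A' A)

/-- Morphisms of algebras respect the isotypic parts, hence map `L` to `L`. -/
theorem map_ιL [Fact (IsUnit (2 : Γ(T', ⊤)))] (U : T.Opens) (s : Γ(χ.L, U)) :
    P'.ιL.app (f ⁻¹ᵁ U) (P'.coord _ (ψ.map.app U (P.ιL.app U s))).2.1 =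
      ψ.map.app U (P.ιL.app U s) := by
  refine (P'.eq_ιL_of_degree _ _ ?_ ?_).symm
  · rw [← ψ.map_p, p_ιL, if_pos rfl]
  · rw [← ψ.map_σ, σ_ιL, map_neg]

theorem map_ι₁ (U : T.Opens) (s : Γ(χ.F, U)) :
    P'.ι₁.app (f ⁻¹ᵁ U) (P'.coord _ (ψ.map.app U (P.ι₁.app U s))).2.2.1 =
      ψ.map.app U (P.ι₁.app U s) := by
  refine (P'.eq_ι₁_of_degree _ _ ?_).symm
  rw [← ψ.map_p, p_ι₁, if_pos rfl]

/-- The component of a morphism of algebras on `F₂` is the same as on `F₁`, because it commutes with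
`σ`. -/
theorem map_ι₂ (U : T.Opens) (s : Γ(χ.F, U)) :
    P'.ι₂.app (f ⁻¹ᵁ U) (P'.coord _ (ψ.map.app U (P.ι₁.app U s))).2.2.1 =
      ψ.map.app U (P.ι₂.app U s) := by
  rw [← P'.σ_ι₁, map_ι₁, ← ψ.map_σ, σ_ι₁]

/-- The component on `L` of a morphism of algebras. -/
noncomputable def pushL : χ.L ⟶ (Scheme.Modules.pushforward f).obj χ'.L :=
  P.ιL ≫ ψ.map.hom ≫ (Scheme.Modules.pushforward f).map P'.πL

/-- The component on `F` of a morphism of algebras. -/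
noncomputable def pushF : χ.F ⟶ (Scheme.Modules.pushforward f).obj χ'.F :=
  P.ι₁ ≫ ψ.map.hom ≫ (Scheme.Modules.pushforward f).map P'.π₁

/-- The morphism of invertible sheaves defined by a morphism of algebras. -/
noncomputable def cartL [Fact (IsUnit (2 : Γ(T', ⊤)))] : CartMap f χ.L χ'.L where
  hom := pushL P P' ψ
  isLocalBasis U n b hb := by
    refine isLocalBasis_pushApp (pushL P P' ψ) (fun x => ?_) U b hb
    obtain ⟨V, hxV, t, y, z, ht, hyz⟩ := χ.exists_bases x
    refine ⟨V, hxV, _, inferInstance, _, ht, ?_⟩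
    refine (ψ.map.isLocalBasis' (P.isLocalBasis ht hyz)).retract_of_injective P'.ιL P'.πL
      (fun W s => by rw [πL_app, coord_ιL]) (fun i => Sum.inr (Sum.inl i))
      (fun i j h => by simpa using h) (fun i => (map_ιL P P' ψ V t).symm) ?_
    rintro (k | k | k | k) hk
    · change P'.πL.app _ (ψ.map.app V (A.oneOn V)) = 0
      rw [ψ.map_one, πL_app, coord_one]
    · exact absurd ⟨k, rfl⟩ hk
    · change P'.πL.app _ (ψ.map.app V (P.ι₁.app V _)) = 0
      rw [← map_ι₁ P P' ψ V, πL_app, coord_ι₁]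
    · change P'.πL.app _ (ψ.map.app V (P.ι₂.app V _)) = 0
      rw [← map_ι₂ P P' ψ V, πL_app, coord_ι₂]

/-- The morphism of sheaves of rank two defined by a morphism of algebras. -/
noncomputable def cartF [Fact (IsUnit (2 : Γ(T', ⊤)))] : CartMap f χ.F χ'.F where
  hom := pushF P P' ψ
  isLocalBasis U n b hb := by
    refine isLocalBasis_pushApp (pushF P P' ψ) (fun x => ?_) U b hb
    obtain ⟨V, hxV, t, y, z, ht, hyz⟩ := χ.exists_bases x
    refine ⟨V, hxV, _, inferInstance, _, hyz, ?_⟩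
    refine (ψ.map.isLocalBasis' (P.isLocalBasis ht hyz)).retract_of_injective P'.ι₁ P'.π₁
      (fun W s => by rw [π₁_app, coord_ι₁]) (fun i => Sum.inr (Sum.inr (Sum.inl i)))
      (fun i j h => by simpa using h) (fun i => (map_ι₁ P P' ψ V _).symm) ?_
    rintro (k | k | k | k) hk
    · change P'.π₁.app _ (ψ.map.app V (A.oneOn V)) = 0
      rw [ψ.map_one, π₁_app, coord_one]
    · change P'.π₁.app _ (ψ.map.app V (P.ιL.app V _)) = 0
      rw [← map_ιL P P' ψ V, π₁_app, coord_ιL]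
    · exact absurd ⟨k, rfl⟩ hk
    · change P'.π₁.app _ (ψ.map.app V (P.ι₂.app V _)) = 0
      rw [← map_ι₂ P P' ψ V, π₁_app, coord_ι₂]

theorem ιL_cartL [Fact (IsUnit (2 : Γ(T', ⊤)))] (U : T.Opens) (s : Γ(χ.L, U)) :
    P'.ιL.app (f ⁻¹ᵁ U) ((cartL P P' ψ).app U s) = ψ.map.app U (P.ιL.app U s) :=
  map_ιL P P' ψ U s

theorem ι₁_cartF [Fact (IsUnit (2 : Γ(T', ⊤)))] (U : T.Opens) (s : Γ(χ.F, U)) :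
    P'.ι₁.app (f ⁻¹ᵁ U) ((cartF P P' ψ).app U s) = ψ.map.app U (P.ι₁.app U s) :=
  map_ι₁ P P' ψ U s

theorem ι₂_cartF [Fact (IsUnit (2 : Γ(T', ⊤)))] (U : T.Opens) (s : Γ(χ.F, U)) :
    P'.ι₂.app (f ⁻¹ᵁ U) ((cartF P P' ψ).app U s) = ψ.map.app U (P.ι₂.app U s) :=
  map_ι₂ P P' ψ U s

/-- The morphism of building data defined by a morphism of algebras. -/
noncomputable def dataHom [Fact (IsUnit (2 : Γ(T', ⊤)))] : BuildingData.Hom f χ' χ where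
  mapL := cartL P P' ψ
  mapF := cartF P P' ψ
  map_α U s u := by
    apply P'.ι₁_injective
    rw [ι₁_cartF, ← P.mul_L_F₁, ψ.map_mul, ← P'.mul_L_F₁, ιL_cartL, ι₁_cartF]
  map_β U u v := by
    apply P'.ι₂_injective
    rw [ι₂_cartF, ← P.mul_F₁_F₁, ψ.map_mul, ← P'.mul_F₁_F₁, ι₁_cartF, ι₁_cartF]
  map_pairing U u v := by
    have h : ψ.map.app U (P.ι₁.app U u) = _ := (ι₁_cartF P P' ψ U u).symm
    have h' : ψ.map.app U (P.ι₂.app U v) = _ := (ι₂_cartF P P' ψ U v).symm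
    have := ψ.map_mul U (P.ι₁.app U u) (P.ι₂.app U v)
    rw [P.mul_F₁_F₂, h, h', P'.mul_F₁_F₂, map_add, CartMap.app_smul, ψ.map_one,
      ← ιL_cartL P P'] at this
    have := congrArg (fun x => (P'.coord _ x).2.1) this
    simpa [map_add, coord_one, coord_ιL] using this

end OfAlgebra

end AlgebraPresentation
end SThreeCover

/-! ### Commutativity and associativity -/

namespace SThreeCover

section Associators

variable {R A : Type*} [CommRing R] [AddCommGroup A] [Module R A] (μ : A →ₗ[R] A →ₗ[R] A)

/-- The associativity of a multiplication at three elements. -/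
def Assoc (x y z : A) : Prop := μ (μ x y) z = μ x (μ y z)

variable {μ}

/-- For a commutative multiplication, associativity at a triple and at the reversed triple are
equivalent. -/
theorem Assoc.reverse (hμ : ∀ x y, μ x y = μ y x) {x y z : A} (h : Assoc μ x y z) :
    Assoc μ z y x := by
  have h : μ (μ x y) z = μ x (μ y z) := h
  change μ (μ z y) x = μ z (μ y x)
  rw [hμ z y, hμ _ x, ← h, hμ z, hμ y x]

/-- For a commutative multiplication the sum of the associators of the cyclic permutations of three
elements vanishes. -/
theorem Assoc.cyclic (hμ : ∀ x y, μ x y = μ y x) {x y z : A} (h : Assoc μ x y z)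
    (h' : Assoc μ y z x) : Assoc μ z x y := by
  have h : μ (μ x y) z = μ x (μ y z) := h
  have h' : μ (μ y z) x = μ y (μ z x) := h'
  change μ (μ z x) y = μ z (μ x y)
  rw [hμ _ y, ← h', hμ _ x, ← h, hμ z]

theorem Assoc.add_right {x y z z' : A} (h : Assoc μ x y z) (h' : Assoc μ x y z') :
    Assoc μ x y (z + z') := by
  simp only [Assoc, map_add] at h h' ⊢
  rw [h, h']

end Associators

namespace AlgebraPresentation

variable {T : Scheme.{u}} {χ : BuildingData T} {A : EquivariantAlgebra T}

/-- If `A` is commutative and associative, the relations can be read off from the associativity at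
`L ⊗ L ⊗ F₁`, `F₁ ⊗ F₁ ⊗ L`, `F₁ ⊗ F₁ ⊗ F₂` and `F₁ ⊗ F₁ ⊗ F₁`, and from the symmetry of `(-,-)`,
which is the commutativity at `F₁ ⊗ F₂`. -/
theorem relations_of_comm_assoc (P : AlgebraPresentation χ A)
    (hcomm : ∀ (U : T.Opens) (x y : Γ(A.sheaf, U)), A.mul.app U x y = A.mul.app U y x)
    (hassoc : ∀ (U : T.Opens) (x y z : Γ(A.sheaf, U)),
      A.mul.app U (A.mul.app U x y) z = A.mul.app U x (A.mul.app U y z)) : χ.Relations where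
  α_α U s t u := by
    apply P.ι₁_injective
    have := hassoc U (P.ιL.app U s) (P.ιL.app U t) (P.ι₁.app U u)
    rw [P.mul_L_L, P.mul_L_F₁, P.mul_L_F₁, map_smul, LinearMap.smul_apply] at this
    rw [← this, Scheme.Modules.Hom.app_smul]
    congr 1
    exact A.one_mul U _
  pairing_α U l u v := by
    have := hcomm U (P.ι₁.app U u) (P.ι₂.app U v)
    have hb : ∀ u v, χ.bracket U u v = χ.bracket U v u := fun u v => by
      have := congrArg (fun x => (P.coord U x).1) (hcomm U (P.ι₁.app U u) (P.ι₂.app U v))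
      simpa [P.mul_F₁_F₂, P.mul_F₂_F₁, coord_one, coord_ιL] using this
    rw [← χ.bracket_smul, ← χ.bracket_smul, hb]
  α_β U l u v := by
    apply P.ι₂_injective
    have := hassoc U (P.ι₁.app U u) (P.ι₁.app U v) (P.ιL.app U l)
    rw [P.mul_F₁_F₁, P.mul_F₂_L, P.mul_F₁_L, P.mul_F₁_F₁] at this
    rw [← neg_neg (χ.α.app U l _), map_neg, this, map_neg]
  β_β U u v w := by
    apply P.ι₁_injective
    have := hassoc U (P.ι₁.app U u) (P.ι₁.app U v) (P.ι₂.app U w)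
    rw [P.mul_F₁_F₁, P.mul_F₂_F₂, P.mul_F₁_F₂] at this
    rw [this, map_add, map_smul, P.mul_F₁_L, map_add, Scheme.Modules.Hom.app_smul]
    congr 2
    exact A.mul_one U _
  pairing_β U u v w := by
    have := congrArg (fun x => (P.coord U x).2.1)
      (hassoc U (P.ι₁.app U u) (P.ι₁.app U v) (P.ι₁.app U w))
    have h : -χ.pairing.app U (χ.β.app U u v) w = χ.pairing.app U u (χ.β.app U v w) := by
      simpa [P.mul_F₁_F₁, P.mul_F₁_F₂, P.mul_F₂_F₁, coord_one, coord_ιL] using this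
    rw [← h, ← χ.pairing_swap]

/-- The relation `⟨α(u), v⟩ = ⟨α(v), u⟩` makes `(-,-)` symmetric, which is the only condition for
the commutativity that is not part of the shape of the building data. -/
theorem comm_of_relations (P : AlgebraPresentation χ A) (h : χ.Relations) (U : T.Opens)
    (x y : Γ(A.sheaf, U)) : A.mul.app U x y = A.mul.app U y x := by
  have h1 : ∀ x, A.mul.app U (A.oneOn U) x = x := fun x => A.one_mul U x
  have h1' : ∀ x, A.mul.app U x (A.oneOn U) = x := fun x => A.mul_one U x
  have hb : ∀ u v, χ.bracket U u v = χ.bracket U v u := fun u v =>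
    χ.functions_ext fun V hV l => by
      rw [χ.resO_bracket, χ.resO_bracket, χ.bracket_smul, χ.bracket_smul, h.pairing_α]
  induction x using P.induction with
  | hadd x x' hx hx' => simp only [map_add, LinearMap.add_apply, hx, hx']
  | h0 r => simp only [map_smul, LinearMap.smul_apply, h1, h1']
  | hL s =>
    induction y using P.induction with
    | hadd x x' hx hx' => simp only [map_add, LinearMap.add_apply, hx, hx']
    | h0 r => simp only [map_smul, LinearMap.smul_apply, h1, h1']
    | hL s' => rw [P.mul_L_L, P.mul_L_L, χ.m_comm]
    | h₁ u => rw [P.mul_L_F₁, P.mul_F₁_L]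
    | h₂ u => rw [P.mul_L_F₂, P.mul_F₂_L]
  | h₁ u =>
    induction y using P.induction with
    | hadd x x' hx hx' => simp only [map_add, LinearMap.add_apply, hx, hx']
    | h0 r => simp only [map_smul, LinearMap.smul_apply, h1, h1']
    | hL s => rw [P.mul_F₁_L, P.mul_L_F₁]
    | h₁ v => rw [P.mul_F₁_F₁, P.mul_F₁_F₁, χ.β_symm]
    | h₂ v => rw [P.mul_F₁_F₂, P.mul_F₂_F₁, hb, χ.pairing_swap, map_neg, sub_eq_add_neg]
  | h₂ u =>
    induction y using P.induction with
    | hadd x x' hx hx' => simp only [map_add, LinearMap.add_apply, hx, hx']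
    | h0 r => simp only [map_smul, LinearMap.smul_apply, h1, h1']
    | hL s => rw [P.mul_F₂_L, P.mul_L_F₂]
    | h₁ v => rw [P.mul_F₁_F₂, P.mul_F₂_F₁, hb, χ.pairing_swap, map_neg, sub_neg_eq_add]
    | h₂ v => rw [P.mul_F₂_F₂, P.mul_F₂_F₂, χ.β_symm]

theorem assoc_σ (U : T.Opens) {x y z : Γ(A.sheaf, U)} (h : Assoc (A.mul.app U) x y z) :
    Assoc (A.mul.app U) ((A.coaction.gmod U).σ x) ((A.coaction.gmod U).σ y)
      ((A.coaction.gmod U).σ z) := by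
  have h : A.mul.app U (A.mul.app U x y) z = A.mul.app U x (A.mul.app U y z) := h
  rw [Assoc, ← A.σ_mul, ← A.σ_mul, ← A.σ_mul, ← A.σ_mul, h]

theorem assoc_L_L_F₁ (P : AlgebraPresentation χ A) (h : χ.Relations) (U : T.Opens)
    (s t : Γ(χ.L, U)) (u : Γ(χ.F, U)) :
    Assoc (A.mul.app U) (P.ιL.app U s) (P.ιL.app U t) (P.ι₁.app U u) := by
  rw [Assoc, P.mul_L_L, P.mul_L_F₁, P.mul_L_F₁, h.α_α, map_smul, LinearMap.smul_apply,
    Scheme.Modules.Hom.app_smul]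
  congr 1
  exact A.one_mul U _

theorem assoc_L_L_L [Fact (IsUnit (2 : Γ(T, ⊤)))] (P : AlgebraPresentation χ A)
    (U : T.Opens) (s t r : Γ(χ.L, U)) :
    Assoc (A.mul.app U) (P.ιL.app U s) (P.ιL.app U t) (P.ιL.app U r) := by
  have h1 : A.mul.app U (A.oneOn U) (P.ιL.app U r) = P.ιL.app U r := A.one_mul U _
  have h1' : A.mul.app U (P.ιL.app U s) (A.oneOn U) = P.ιL.app U s := A.mul_one U _
  rw [Assoc, P.mul_L_L, P.mul_L_L, map_smul, map_smul, LinearMap.smul_apply, h1, h1',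
    ← Scheme.Modules.Hom.app_smul, ← Scheme.Modules.Hom.app_smul, χ.m_smul_comm]

theorem assoc_L_F₁_F₁ (P : AlgebraPresentation χ A) (h : χ.Relations) (U : T.Opens)
    (s : Γ(χ.L, U)) (u v : Γ(χ.F, U)) :
    Assoc (A.mul.app U) (P.ιL.app U s) (P.ι₁.app U u) (P.ι₁.app U v) := by
  rw [Assoc, P.mul_L_F₁, P.mul_F₁_F₁, P.mul_F₁_F₁, P.mul_L_F₂, χ.β_symm U u v, h.α_β, neg_neg,
    χ.β_symm U v]

theorem assoc_L_F₁_F₂ [Fact (IsUnit (2 : Γ(T, ⊤)))] (P : AlgebraPresentation χ A)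
    (h : χ.Relations) (U : T.Opens) (s : Γ(χ.L, U)) (u v : Γ(χ.F, U)) :
    Assoc (A.mul.app U) (P.ιL.app U s) (P.ι₁.app U u) (P.ι₂.app U v) := by
  have h1 : A.mul.app U (P.ιL.app U s) (A.oneOn U) = P.ιL.app U s := A.mul_one U _
  have hb : χ.bracket U (χ.α.app U s u) v = χ.m U s (χ.pairing.app U u v) :=
    χ.functions_ext fun V hV l => by
      rw [χ.resO_bracket, χ.bracket_smul, χ.α.res_app U V hV, h.pairing_α, h.α_α, map_smul,
        LinearMap.smul_apply, χ.resO_m, χ.pairing.res_app U V hV, χ.m_smul_comm]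
  rw [Assoc, P.mul_L_F₁, P.mul_F₁_F₂, P.mul_F₁_F₂, map_add, map_smul, h1, P.mul_L_L, hb,
    h.pairing_α, ← χ.bracket_smul, Scheme.Modules.Hom.app_smul, add_comm]

theorem assoc_F₁_F₁_F₁ (P : AlgebraPresentation χ A) (h : χ.Relations) (U : T.Opens)
    (u v w : Γ(χ.F, U)) :
    Assoc (A.mul.app U) (P.ι₁.app U u) (P.ι₁.app U v) (P.ι₁.app U w) := by
  have hD := (χ.satisfiesDiagrams_iff.2 h).diagram_E U u v w
  rw [Assoc, P.mul_F₁_F₁, P.mul_F₁_F₁, P.mul_F₁_F₂, P.mul_F₂_F₁]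
  have hD1 := congrArg Prod.fst hD
  have hD2 := congrArg Prod.snd hD
  simp only [BuildingData.γ, BuildingData.γ'] at hD1 hD2
  rw [hD1, hD2, map_neg, sub_eq_add_neg]

theorem assoc_F₁_F₁_F₂ (P : AlgebraPresentation χ A) (h : χ.Relations) (U : T.Opens)
    (u v w : Γ(χ.F, U)) :
    Assoc (A.mul.app U) (P.ι₁.app U u) (P.ι₁.app U v) (P.ι₂.app U w) := by
  have h1 : A.mul.app U (P.ι₁.app U u) (A.oneOn U) = P.ι₁.app U u := A.mul_one U _
  rw [Assoc, P.mul_F₁_F₁, P.mul_F₂_F₂, P.mul_F₁_F₂, h.β_β, map_add, map_add,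
    map_smul (A.mul.app U _), h1, P.mul_F₁_L, Scheme.Modules.Hom.app_smul]

/-- By trilinearity it suffices to consider triples from the four summands. The involution `σ`
exchanges `F₁` and `F₂`, and for a commutative multiplication the associativity at a triple follows
from the one at the reversed triple, or from those at the two other cyclic permutations. This
reduces all cases to the six triples treated above. -/
theorem assoc_of_relations [Fact (IsUnit (2 : Γ(T, ⊤)))] (P : AlgebraPresentation χ A)
    (h : χ.Relations) (U : T.Opens) (x y z : Γ(A.sheaf, U)) :
    A.mul.app U (A.mul.app U x y) z = A.mul.app U x (A.mul.app U y z) := by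
  have hμ := P.comm_of_relations h U
  have h1 : ∀ x, A.mul.app U (A.oneOn U) x = x := fun x => A.one_mul U x
  have h1' : ∀ x, A.mul.app U x (A.oneOn U) = x := fun x => A.mul_one U x
  -- In the names of the hypotheses, `F` and `G` stand for `F₁` and `F₂`. As `σ` acts as `-1` on
  -- `L`, it is applied to triples in which the sections of `L` are replaced by their opposites.
  have hLLF := P.assoc_L_L_F₁ h U
  have hLLG : ∀ s t u, Assoc (A.mul.app U) (P.ιL.app U s) (P.ιL.app U t) (P.ι₂.app U u) :=
    fun s t u => by
      have := assoc_σ U (hLLF (-s) (-t) u)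
      simpa [P.σ_ιL, P.σ_ι₁] using this
  have hLFF := P.assoc_L_F₁_F₁ h U
  have hLGG : ∀ s u v, Assoc (A.mul.app U) (P.ιL.app U s) (P.ι₂.app U u) (P.ι₂.app U v) :=
    fun s u v => by
      have := assoc_σ U (hLFF (-s) u v)
      simpa [P.σ_ιL, P.σ_ι₁] using this
  have hLFG := P.assoc_L_F₁_F₂ h U
  have hLGF : ∀ s u v, Assoc (A.mul.app U) (P.ιL.app U s) (P.ι₂.app U u) (P.ι₁.app U v) :=
    fun s u v => by
      have := assoc_σ U (hLFG (-s) u v)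
      simpa [P.σ_ιL, P.σ_ι₁, P.σ_ι₂] using this
  have hFFF := P.assoc_F₁_F₁_F₁ h U
  have hGGG : ∀ u v w, Assoc (A.mul.app U) (P.ι₂.app U u) (P.ι₂.app U v) (P.ι₂.app U w) :=
    fun s u v => by
      have := assoc_σ U (hFFF s u v)
      simpa [P.σ_ι₁] using this
  have hFFG := P.assoc_F₁_F₁_F₂ h U
  have hGGF : ∀ u v w, Assoc (A.mul.app U) (P.ι₂.app U u) (P.ι₂.app U v) (P.ι₁.app U w) :=
    fun s u v => by
      have := assoc_σ U (hFFG s u v)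
      simpa [P.σ_ι₁, P.σ_ι₂] using this
  change Assoc _ _ _ _
  have hLLL := P.assoc_L_L_L U
  have hr : ∀ x y (r : Γ(T, U)), Assoc (A.mul.app U) x y (r • A.oneOn U) := fun x y r => by
    simp only [Assoc, map_smul, h1']
  refine P.induction U (C := fun x => ∀ y z, Assoc (A.mul.app U) x y z) ?_ ?_ ?_ ?_ ?_ x y z
  · intro x x' hx hx' y z
    have hx := hx y z
    have hx' := hx' y z
    simp only [Assoc, map_add, LinearMap.add_apply] at hx hx' ⊢
    rw [hx, hx']
  · intro r y z
    simp only [Assoc, map_smul, LinearMap.smul_apply, h1]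
  · intro a y z
    refine P.induction U (C := fun y => ∀ z, Assoc (A.mul.app U) _ y z) ?_ ?_ ?_ ?_ ?_ y z
    · intro x x' hx hx' z
      have hx := hx z
      have hx' := hx' z
      simp only [Assoc, map_add, LinearMap.add_apply] at hx hx' ⊢
      rw [hx, hx']
    · intro r z
      simp only [Assoc, map_smul, LinearMap.smul_apply, h1, h1']
    · intro b z
      exact P.induction U (C := fun z => Assoc (A.mul.app U) _ _ z) (fun _ _ => .add_right) (hr _ _)
        (fun c => hLLL a b c) (fun c => hLLF a b c)
        (fun c => hLLG a b c) z
    · intro b z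
      exact P.induction U (C := fun z => Assoc (A.mul.app U) _ _ z) (fun _ _ => .add_right) (hr _ _)
        (fun c => .cyclic hμ (.reverse hμ (hLLF a c b)) (hLLF c a b)) (fun c => hLFF a b c)
        (fun c => hLFG a b c) z
    · intro b z
      exact P.induction U (C := fun z => Assoc (A.mul.app U) _ _ z) (fun _ _ => .add_right) (hr _ _)
        (fun c => .cyclic hμ (.reverse hμ (hLLG a c b)) (hLLG c a b)) (fun c => hLGF a b c)
        (fun c => hLGG a b c) z
  · intro a y z
    refine P.induction U (C := fun y => ∀ z, Assoc (A.mul.app U) _ y z) ?_ ?_ ?_ ?_ ?_ y z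
    · intro x x' hx hx' z
      have hx := hx z
      have hx' := hx' z
      simp only [Assoc, map_add, LinearMap.add_apply] at hx hx' ⊢
      rw [hx, hx']
    · intro r z
      simp only [Assoc, map_smul, LinearMap.smul_apply, h1, h1']
    · intro b z
      exact P.induction U (C := fun z => Assoc (A.mul.app U) _ _ z) (fun _ _ => .add_right) (hr _ _)
        (fun c => .reverse hμ (hLLF c b a))
        (fun c => .cyclic hμ (hLFF b c a) (.reverse hμ (hLFF b a c)))
        (fun c => .cyclic hμ (hLGF b c a) (.reverse hμ (hLFG b a c))) z
    · intro b z
      exact P.induction U (C := fun z => Assoc (A.mul.app U) _ _ z) (fun _ _ => .add_right) (hr _ _)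
        (fun c => .reverse hμ (hLFF c b a)) (fun c => hFFF a b c)
        (fun c => hFFG a b c) z
    · intro b z
      exact P.induction U (C := fun z => Assoc (A.mul.app U) _ _ z) (fun _ _ => .add_right) (hr _ _)
        (fun c => .reverse hμ (hLGF c b a))
        (fun c => .cyclic hμ (.reverse hμ (hFFG a c b)) (hFFG c a b))
        (fun c => .reverse hμ (hGGF c b a)) z
  · intro a y z
    refine P.induction U (C := fun y => ∀ z, Assoc (A.mul.app U) _ y z) ?_ ?_ ?_ ?_ ?_ y z
    · intro x x' hx hx' z
      have hx := hx z
      have hx' := hx' z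
      simp only [Assoc, map_add, LinearMap.add_apply] at hx hx' ⊢
      rw [hx, hx']
    · intro r z
      simp only [Assoc, map_smul, LinearMap.smul_apply, h1, h1']
    · intro b z
      exact P.induction U (C := fun z => Assoc (A.mul.app U) _ _ z) (fun _ _ => .add_right) (hr _ _)
        (fun c => .reverse hμ (hLLG c b a))
        (fun c => .cyclic hμ (hLFG b c a) (.reverse hμ (hLGF b a c)))
        (fun c => .cyclic hμ (hLGG b c a) (.reverse hμ (hLGG b a c))) z
    · intro b z
      exact P.induction U (C := fun z => Assoc (A.mul.app U) _ _ z) (fun _ _ => .add_right) (hr _ _)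
        (fun c => .reverse hμ (hLFG c b a)) (fun c => .reverse hμ (hFFG c b a))
        (fun c => .cyclic hμ (.reverse hμ (hGGF a c b)) (hGGF c a b)) z
    · intro b z
      exact P.induction U (C := fun z => Assoc (A.mul.app U) _ _ z) (fun _ _ => .add_right) (hr _ _)
        (fun c => .reverse hμ (hLGG c b a)) (fun c => hGGF a b c)
        (fun c => hGGG a b c) z

end AlgebraPresentation
end SThreeCover

/-! ### The algebra `A_χ` -/

namespace SThreeCover

open CategoryTheory.Limits

section Sum

variable {R L F : Type*} [CommRing R] [AddCommGroup L] [AddCommGroup F] [Module R L] [Module R F]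

variable (R L F) in
/-- The action of `G` on `R ⊕ L ⊕ F₁ ⊕ F₂`, where `F₁ = F₂ = F`. -/
def sumGModule : GModule R (R × L × F × F) where
  p k :=
    { toFun := fun x => (if k = 0 then x.1 else 0, if k = 0 then x.2.1 else 0,
        if k = 1 then x.2.2.1 else 0, if k = 2 then x.2.2.2 else 0)
      map_add' := fun x y => by ext <;> simp <;> split_ifs <;> simp
      map_smul' := fun r x => by ext <;> simp }
  σ :=
    { toFun := fun x => (x.1, -x.2.1, x.2.2.2, x.2.2.1)
      map_add' := fun x y => by ext <;> simp [add_comm]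
      map_smul' := fun r x => by ext <;> simp }
  p_p k l x := by
    by_cases h : k = l
    · subst h; ext <;> simp +contextual
    · simp only [LinearMap.coe_mk, AddHom.coe_mk, if_neg h]
      ext <;> simp <;> rintro rfl rfl <;> exact absurd rfl h
  sum_p x := by
    have e1 : (1 : ZMod 3) ≠ 0 := by decide
    have e2 : (2 : ZMod 3) ≠ 0 := by decide
    have e3 : (2 : ZMod 3) ≠ 1 := by decide
    ext <;> simp [sum_zmod3, e1.symm, e2, e2.symm, e3, e3.symm]
  σ_σ x := by ext <;> simp
  p_σ k x := by
    have h : ∀ k : ZMod 3, (k = 1 ↔ -k = 2) ∧ (k = 2 ↔ -k = 1) ∧ (k = 0 ↔ -k = 0) := by decide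
    simp only [LinearMap.coe_mk, AddHom.coe_mk, (h k).1, (h k).2.1, (h k).2.2]
    ext <;> (simp; try split_ifs <;> simp)

/-- The multiplication on `R ⊕ L ⊕ F₁ ⊕ F₂`. -/
def sumMul (m : L →ₗ[R] L →ₗ[R] R) (c : F →ₗ[R] F →ₗ[R] R) (α : L →ₗ[R] F →ₗ[R] F)
    (β : F →ₗ[R] F →ₗ[R] F) (d : F →ₗ[R] F →ₗ[R] L) :
    (R × L × F × F) →ₗ[R] (R × L × F × F) →ₗ[R] (R × L × F × F) :=
  LinearMap.mk₂ R (fun x y =>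
    (x.1 * y.1 + m x.2.1 y.2.1 + c x.2.2.1 y.2.2.2 + c x.2.2.2 y.2.2.1,
      x.1 • y.2.1 + y.1 • x.2.1 + d x.2.2.1 y.2.2.2 - d x.2.2.2 y.2.2.1,
      x.1 • y.2.2.1 + y.1 • x.2.2.1 + α x.2.1 y.2.2.1 + α y.2.1 x.2.2.1 + β x.2.2.2 y.2.2.2,
      x.1 • y.2.2.2 + y.1 • x.2.2.2 - α x.2.1 y.2.2.2 - α y.2.1 x.2.2.2 + β x.2.2.1 y.2.2.1))
    (fun x x' y => by
      ext <;> simp only [Prod.fst_add, Prod.snd_add, map_add, LinearMap.add_apply] <;>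
        first | ring1 | module)
    (fun r x y => by
      ext <;> simp only [Prod.smul_fst, Prod.smul_snd, map_smul, LinearMap.smul_apply,
        smul_eq_mul] <;> first | ring1 | module)
    (fun x y y' => by
      ext <;> simp only [Prod.fst_add, Prod.snd_add, map_add, LinearMap.add_apply] <;>
        first | ring1 | module)
    (fun r x y => by
      ext <;> simp only [Prod.smul_fst, Prod.smul_snd, map_smul, LinearMap.smul_apply,
        smul_eq_mul] <;> first | ring1 | module)

theorem sumMul_equivariant (m : L →ₗ[R] L →ₗ[R] R) (c : F →ₗ[R] F →ₗ[R] R)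
    (α : L →ₗ[R] F →ₗ[R] F) (β : F →ₗ[R] F →ₗ[R] F) (d : F →ₗ[R] F →ₗ[R] L) :
    (∀ k x y, (sumGModule R L F).p k (sumMul m c α β d x y) =
      ∑ i, sumMul m c α β d ((sumGModule R L F).p i x) ((sumGModule R L F).p (k - i) y)) ∧
      ∀ x y, (sumGModule R L F).σ (sumMul m c α β d x y) =
        sumMul m c α β d ((sumGModule R L F).σ x) ((sumGModule R L F).σ y) := by
  constructor
  · intro k x y
    have e1 : (1 : ZMod 3) ≠ 0 := by decide
    have e2 : (2 : ZMod 3) ≠ 0 := by decide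
    have e3 : (2 : ZMod 3) ≠ 1 := by decide
    have d1 : (0 : ZMod 3) - 1 = 2 := by decide
    have d2 : (0 : ZMod 3) - 2 = 1 := by decide
    have d3 : (1 : ZMod 3) - 2 = 2 := by decide
    have d4 : (2 : ZMod 3) - 1 = 1 := by decide
    rw [sum_zmod3]
    have hk : k = 0 ∨ k = 1 ∨ k = 2 := by decide +revert
    rcases hk with rfl | rfl | rfl <;>
    ext <;>
    simp only [sumGModule, sumMul, LinearMap.coe_mk, AddHom.coe_mk, LinearMap.mk₂_apply, sub_zero,
      sub_self, d1, d2, d3, d4, e1, e2, e3, e1.symm, e2.symm, e3.symm, if_true, if_false, map_zero,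
      LinearMap.zero_apply, zero_smul, smul_zero, add_zero, zero_add, Prod.fst_add, Prod.snd_add,
      mul_zero, zero_mul] <;>
    first | ring1 | module
  · intro x y
    ext <;>
    simp only [sumGModule, sumMul, LinearMap.coe_mk, AddHom.coe_mk, LinearMap.mk₂_apply, map_neg,
      LinearMap.neg_apply] <;>
    first | ring1 | module

theorem sumMul_L_L (m : L →ₗ[R] L →ₗ[R] R) (c : F →ₗ[R] F →ₗ[R] R) (α : L →ₗ[R] F →ₗ[R] F)
    (β : F →ₗ[R] F →ₗ[R] F) (d : F →ₗ[R] F →ₗ[R] L) (s t : L) :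
    sumMul m c α β d (0, s, 0, 0) (0, t, 0, 0) = m s t • (1, 0, 0, 0) := by
  simp [sumMul]

theorem sumMul_L_F₁ (m : L →ₗ[R] L →ₗ[R] R) (c : F →ₗ[R] F →ₗ[R] R) (α : L →ₗ[R] F →ₗ[R] F)
    (β : F →ₗ[R] F →ₗ[R] F) (d : F →ₗ[R] F →ₗ[R] L) (s : L) (v : F) :
    sumMul m c α β d (0, s, 0, 0) (0, 0, v, 0) = (0, 0, α s v, 0) := by
  simp [sumMul]

theorem sumMul_L_F₂ (m : L →ₗ[R] L →ₗ[R] R) (c : F →ₗ[R] F →ₗ[R] R) (α : L →ₗ[R] F →ₗ[R] F)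
    (β : F →ₗ[R] F →ₗ[R] F) (d : F →ₗ[R] F →ₗ[R] L) (s : L) (v : F) :
    sumMul m c α β d (0, s, 0, 0) (0, 0, 0, v) = (0, 0, 0, -α s v) := by
  simp [sumMul]

theorem sumMul_F₁_L (m : L →ₗ[R] L →ₗ[R] R) (c : F →ₗ[R] F →ₗ[R] R) (α : L →ₗ[R] F →ₗ[R] F)
    (β : F →ₗ[R] F →ₗ[R] F) (d : F →ₗ[R] F →ₗ[R] L) (u : F) (s : L) :
    sumMul m c α β d (0, 0, u, 0) (0, s, 0, 0) = (0, 0, α s u, 0) := by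
  simp [sumMul]

theorem sumMul_F₂_L (m : L →ₗ[R] L →ₗ[R] R) (c : F →ₗ[R] F →ₗ[R] R) (α : L →ₗ[R] F →ₗ[R] F)
    (β : F →ₗ[R] F →ₗ[R] F) (d : F →ₗ[R] F →ₗ[R] L) (u : F) (s : L) :
    sumMul m c α β d (0, 0, 0, u) (0, s, 0, 0) = (0, 0, 0, -α s u) := by
  simp [sumMul]

theorem sumMul_F₁_F₁ (m : L →ₗ[R] L →ₗ[R] R) (c : F →ₗ[R] F →ₗ[R] R) (α : L →ₗ[R] F →ₗ[R] F)
    (β : F →ₗ[R] F →ₗ[R] F) (d : F →ₗ[R] F →ₗ[R] L) (u v : F) :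
    sumMul m c α β d (0, 0, u, 0) (0, 0, v, 0) = (0, 0, 0, β u v) := by
  simp [sumMul]

theorem sumMul_F₂_F₂ (m : L →ₗ[R] L →ₗ[R] R) (c : F →ₗ[R] F →ₗ[R] R) (α : L →ₗ[R] F →ₗ[R] F)
    (β : F →ₗ[R] F →ₗ[R] F) (d : F →ₗ[R] F →ₗ[R] L) (u v : F) :
    sumMul m c α β d (0, 0, 0, u) (0, 0, 0, v) = (0, 0, β u v, 0) := by
  simp [sumMul]

theorem sumMul_F₁_F₂ (m : L →ₗ[R] L →ₗ[R] R) (c : F →ₗ[R] F →ₗ[R] R) (α : L →ₗ[R] F →ₗ[R] F)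
    (β : F →ₗ[R] F →ₗ[R] F) (d : F →ₗ[R] F →ₗ[R] L) (u v : F) :
    sumMul m c α β d (0, 0, u, 0) (0, 0, 0, v) = c u v • (1, 0, 0, 0) + (0, d u v, 0, 0) := by
  simp [sumMul]

theorem sumMul_F₂_F₁ (m : L →ₗ[R] L →ₗ[R] R) (c : F →ₗ[R] F →ₗ[R] R) (α : L →ₗ[R] F →ₗ[R] F)
    (β : F →ₗ[R] F →ₗ[R] F) (d : F →ₗ[R] F →ₗ[R] L) (u v : F) :
    sumMul m c α β d (0, 0, 0, u) (0, 0, v, 0) = c u v • (1, 0, 0, 0) - (0, d u v, 0, 0) := by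
  simp [sumMul]

end Sum

/-- Transport of structure. -/
def GModule.transport {R M N : Type*} [CommRing R] [AddCommGroup M] [Module R M] [AddCommGroup N]
    [Module R N] (Q : GModule R N) (e : M ≃ₗ[R] N) : GModule R M where
  p k := e.symm.toLinearMap ∘ₗ Q.p k ∘ₗ e.toLinearMap
  σ := e.symm.toLinearMap ∘ₗ Q.σ ∘ₗ e.toLinearMap
  p_p k l x := by
    simp only [LinearMap.comp_apply, LinearEquiv.coe_coe, LinearEquiv.apply_symm_apply, Q.p_p]
    split_ifs <;> simp
  sum_p x := by
    simp only [LinearMap.comp_apply, LinearEquiv.coe_coe, ← map_sum, Q.sum_p]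
    simp
  σ_σ x := by simp [Q.σ_σ]
  p_σ k x := by simp [Q.p_σ]

section Biproduct

variable {T : Scheme.{u}}

/-- Sections of a direct sum of two sheaves. -/
noncomputable def biprodEquiv (M N : T.Modules) (U : T.Opens) :
    Γ((M ⊞ N : T.Modules), U) ≃ₗ[Γ(T, U)] Γ(M, U) × Γ(N, U) :=
  { (appL (biprod.fst : M ⊞ N ⟶ M) U).prod (appL (biprod.snd : M ⊞ N ⟶ N) U) with
    invFun := fun x => appL (biprod.inl : M ⟶ M ⊞ N) U x.1 + appL (biprod.inr : N ⟶ M ⊞ N) U x.2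
    left_inv := fun x =>
      congrArg (fun φ : M ⊞ N ⟶ M ⊞ N => φ.app U x) (biprod.total (X := M) (Y := N))
    right_inv := fun x => by
      have h1 : ∀ x, appL (biprod.fst : M ⊞ N ⟶ M) U (appL (biprod.inl : M ⟶ M ⊞ N) U x) = x :=
        fun x => congrArg (fun φ : M ⟶ M => φ.app U x) (biprod.inl_fst (X := M) (Y := N))
      have h2 : ∀ x, appL (biprod.snd : M ⊞ N ⟶ N) U (appL (biprod.inl : M ⟶ M ⊞ N) U x) = 0 :=
        fun x => congrArg (fun φ : M ⟶ N => φ.app U x) (biprod.inl_snd (X := M) (Y := N))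
      have h3 : ∀ x, appL (biprod.fst : M ⊞ N ⟶ M) U (appL (biprod.inr : N ⟶ M ⊞ N) U x) = 0 :=
        fun x => congrArg (fun φ : N ⟶ M => φ.app U x) (biprod.inr_fst (X := M) (Y := N))
      have h4 : ∀ x, appL (biprod.snd : M ⊞ N ⟶ N) U (appL (biprod.inr : N ⟶ M ⊞ N) U x) = x :=
        fun x => congrArg (fun φ : N ⟶ N => φ.app U x) (biprod.inr_snd (X := M) (Y := N))
      change (appL biprod.fst U (_ + _), appL biprod.snd U (_ + _)) = x
      rw [map_add, map_add, h1, h2, h3, h4, add_zero, zero_add] }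

theorem biprodEquiv_res (M N : T.Modules) {U V : T.Opens} (h : V ≤ U)
    (x : Γ((M ⊞ N : T.Modules), U)) :
    biprodEquiv M N V (res _ h x) =
      (res M h (biprodEquiv M N U x).1, res N h (biprodEquiv M N U x).2) :=
  Prod.ext (res_hom_app _ h x).symm (res_hom_app _ h x).symm

theorem IsLocalBasis.biprod {M N : T.Modules} {U : T.Opens} {ι κ : Type} [Fintype ι] [Fintype κ]
    {b : ι → Γ(M, U)} {c : κ → Γ(N, U)} (hb : IsLocalBasis M b) (hc : IsLocalBasis N c) :
    IsLocalBasis (M ⊞ N : T.Modules) (Sum.elim (fun i => (biprodEquiv M N U).symm (b i, 0))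
      (fun j => (biprodEquiv M N U).symm (0, c j))) := by
  intro V h
  have hs : ∀ x, res (M ⊞ N : T.Modules) h ((biprodEquiv M N U).symm x) =
      (biprodEquiv M N V).symm (res M h x.1, res N h x.2) := fun x => by
    rw [LinearEquiv.eq_symm_apply, biprodEquiv_res, LinearEquiv.apply_symm_apply]
  convert (biprodEquiv M N V).symm.bijective.comp (((hb V h).prodMap (hc V h)).comp
    (Equiv.sumArrowEquivProdArrow ι κ Γ(T, V)).bijective) using 1
  ext x
  simp only [Fintype.sum_sum_type, Sum.elim_inl, Sum.elim_inr, hs, map_zero, Function.comp]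
  rw [LinearEquiv.eq_symm_apply]
  simp only [map_add, map_sum, map_smul, LinearEquiv.apply_symm_apply]
  ext <;> simp [Prod.fst_sum, Prod.snd_sum, Equiv.sumArrowEquivProdArrow]

theorem LocallyFree.biprod {M N : T.Modules} (hM : LocallyFree M) (hN : LocallyFree N) :
    LocallyFree (M ⊞ N : T.Modules) := fun x => by
  obtain ⟨U, hU, n, b, hb⟩ := hM x
  obtain ⟨V, hV, m, c, hc⟩ := hN x
  exact ⟨U ⊓ V, ⟨hU, hV⟩, _, _, ((hb.restrict inf_le_left).biprod
    (hc.restrict inf_le_right)).reindex finSumFinEquiv.symm⟩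

theorem isLocalBasis_one (U : T.Opens) :
    IsLocalBasis (unitSheaf T) (U := U) fun _ : Fin 1 => (1 : Γ(T, U)) := by
  intro V h
  have : (fun c : Fin 1 → Γ(T, V) => ∑ i, c i • res (unitSheaf T) (U := U) h (1 : Γ(T, U))) =
      Equiv.funUnique (Fin 1) Γ(T, V) := by
    ext c
    simp only [Finset.univ_unique, Finset.sum_singleton]
    erw [unitSheaf_res, unitSheaf_smul]
    simp
    rfl
  rw [this]
  exact (Equiv.funUnique (Fin 1) Γ(T, V)).bijective

end Biproduct

namespace BuildingData

variable {T : Scheme.{u}} (χ : BuildingData T)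

/-- The sheaf `𝒪_T ⊕ L ⊕ F₁ ⊕ F₂`. -/
noncomputable def sumSheaf : T.Modules := unitSheaf T ⊞ χ.L ⊞ χ.F ⊞ χ.F

theorem sumSheaf_locallyFree : LocallyFree χ.sumSheaf :=
  LocallyFree.biprod (fun _ => ⟨⊤, trivial, 1, _, isLocalBasis_one _⟩) <|
    χ.rank_L.locallyFree.biprod <| χ.rank_F.locallyFree.biprod χ.rank_F.locallyFree

/-- The sections of `𝒪_T ⊕ L ⊕ F₁ ⊕ F₂`. -/
noncomputable def sumEquiv (U : T.Opens) :
    Γ(χ.sumSheaf, U) ≃ₗ[Γ(T, U)] Γ(T, U) × Γ(χ.L, U) × Γ(χ.F, U) × Γ(χ.F, U) :=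
  biprodEquiv (unitSheaf T) _ U ≪≫ₗ (LinearEquiv.refl Γ(T, U) Γ(unitSheaf T, U)).prodCongr
    (biprodEquiv χ.L _ U ≪≫ₗ (LinearEquiv.refl Γ(T, U) Γ(χ.L, U)).prodCongr
      (biprodEquiv χ.F χ.F U))

theorem sumEquiv_res {U V : T.Opens} (h : V ≤ U) (x : Γ(χ.sumSheaf, U)) :
    χ.sumEquiv V (res _ h x) = (resO h (χ.sumEquiv U x).1, res χ.L h (χ.sumEquiv U x).2.1,
      res χ.F h (χ.sumEquiv U x).2.2.1, res χ.F h (χ.sumEquiv U x).2.2.2) := by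
  have h1 := biprodEquiv_res (unitSheaf T) _ h x
  have h2 := biprodEquiv_res χ.L _ h (biprodEquiv (unitSheaf T) _ U x).2
  have h3 := biprodEquiv_res χ.F χ.F h
    (biprodEquiv χ.L _ U (biprodEquiv (unitSheaf T) _ U x).2).2
  have h2' := (congrArg (biprodEquiv χ.L _ V) (congrArg Prod.snd h1)).trans h2
  have h3' := (congrArg (biprodEquiv χ.F _ V) (congrArg Prod.snd h2')).trans h3
  have e1 := congrArg Prod.fst h1
  have e2 := congrArg Prod.fst h2'
  have e3 := congrArg Prod.fst h3'
  have e4 := congrArg Prod.snd h3'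
  exact Prod.ext e1 (Prod.ext e2 (Prod.ext e3 e4))

theorem res_sumEquiv_symm {U V : T.Opens} (h : V ≤ U)
    (x : Γ(T, U) × Γ(χ.L, U) × Γ(χ.F, U) × Γ(χ.F, U)) :
    res _ h ((χ.sumEquiv U).symm x) = (χ.sumEquiv V).symm
      (resO h x.1, res χ.L h x.2.1, res χ.F h x.2.2.1, res χ.F h x.2.2.2) := by
  rw [LinearEquiv.eq_symm_apply, sumEquiv_res, LinearEquiv.apply_symm_apply]

/-- The coaction on `𝒪_T ⊕ L ⊕ F₁ ⊕ F₂`. -/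
noncomputable def sumCoaction : Coaction χ.sumSheaf :=
  .ofGMod (fun U => (sumGModule _ _ _).transport (χ.sumEquiv U))
    (fun U V h k x => by
      change res _ h ((χ.sumEquiv U).symm _) = (χ.sumEquiv V).symm _
      rw [res_sumEquiv_symm]
      congr 1
      simp only [sumGModule, LinearMap.coe_mk, AddHom.coe_mk, LinearEquiv.coe_coe, sumEquiv_res,
        apply_ite (resO h), apply_ite (res χ.L h), apply_ite (res χ.F h), map_zero,
        LinearMap.comp_apply])
    (fun U V h x => by
      change res _ h ((χ.sumEquiv U).symm _) = (χ.sumEquiv V).symm _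
      rw [res_sumEquiv_symm]
      congr 1
      simp only [sumGModule, LinearMap.coe_mk, AddHom.coe_mk, LinearEquiv.coe_coe, sumEquiv_res,
        map_neg, LinearMap.comp_apply])

theorem sumCoaction_p (U : T.Opens) (k : ZMod 3) (x) :
    (χ.sumCoaction.gmod U).p k x =
      (χ.sumEquiv U).symm ((sumGModule _ _ _).p k (χ.sumEquiv U x)) := by
  rw [sumCoaction, Coaction.gmod_ofGMod]
  rfl

theorem sumCoaction_σ (U : T.Opens) (x) :
    (χ.sumCoaction.gmod U).σ x =
      (χ.sumEquiv U).symm ((sumGModule _ _ _).σ (χ.sumEquiv U x)) := by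
  rw [sumCoaction, Coaction.gmod_ofGMod]
  rfl

/-- The multiplication on `𝒪_T ⊕ L ⊕ F₁ ⊕ F₂`. -/
noncomputable def sumMultiplication [Fact (IsUnit (2 : Γ(T, ⊤)))] :
    BilinMap χ.sumSheaf χ.sumSheaf χ.sumSheaf where
  app U := ((sumMul (χ.mLin U) (χ.bracketLin U) (χ.α.app U) (χ.β.app U) (χ.pairing.app U)).compl₁₂
    (χ.sumEquiv U).toLinearMap (χ.sumEquiv U).toLinearMap).compr₂ (χ.sumEquiv U).symm.toLinearMap
  res_app U V h x y := by
    change res _ h ((χ.sumEquiv U).symm _) = (χ.sumEquiv V).symm _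
    rw [res_sumEquiv_symm]
    congr 1
    simp only [sumMul, LinearMap.mk₂_apply, LinearMap.compl₁₂_apply, LinearEquiv.coe_coe,
      sumEquiv_res, map_add, map_sub, res_smul, χ.α.res_app U V h, χ.β.res_app U V h,
      χ.pairing.res_app U V h, mLin_apply, bracketLin_apply, resO_m, resO_bracket, map_mul]

theorem sumMultiplication_app [Fact (IsUnit (2 : Γ(T, ⊤)))] (U : T.Opens) (x y) :
    χ.sumMultiplication.app U x y = (χ.sumEquiv U).symm (sumMul (χ.mLin U) (χ.bracketLin U)
      (χ.α.app U) (χ.β.app U) (χ.pairing.app U) (χ.sumEquiv U x) (χ.sumEquiv U y)) := rfl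

/-- The algebra `A_χ`. -/
noncomputable def algebra [Fact (IsUnit (2 : Γ(T, ⊤)))] : EquivariantAlgebra T where
  sheaf := χ.sumSheaf
  locallyFree := χ.sumSheaf_locallyFree
  coaction := χ.sumCoaction
  mul := χ.sumMultiplication
  one := (χ.sumEquiv ⊤).symm (1, 0, 0, 0)
  one_mul U x := by
    rw [res_sumEquiv_symm, sumMultiplication_app, LinearEquiv.apply_symm_apply,
      LinearEquiv.symm_apply_eq]
    ext <;> simp [sumMul]
  mul_one U x := by
    rw [res_sumEquiv_symm, sumMultiplication_app, LinearEquiv.apply_symm_apply,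
      LinearEquiv.symm_apply_eq]
    ext <;> simp [sumMul]
  coaction_mul U x y := by
    simp only [Coaction.app_eq]
    refine ((χ.sumCoaction.gmod U).coact_mul_iff (χ.sumMultiplication.app U)).2 ⟨?_, ?_⟩ x y
    · intro k x y
      simp only [sumMultiplication_app, sumCoaction_p, LinearEquiv.apply_symm_apply, ← map_sum,
        (sumMul_equivariant _ _ _ _ _).1]
    · intro x y
      simp only [sumMultiplication_app, sumCoaction_σ, LinearEquiv.apply_symm_apply,
        (sumMul_equivariant _ _ _ _ _).2]
  coaction_one := by
    rw [Coaction.app_eq, GModule.coact_one_iff]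
    simp [sumCoaction_p, sumCoaction_σ, sumGModule]

/-- The sections of `A_χ`. -/
noncomputable def algebraEquiv [Fact (IsUnit (2 : Γ(T, ⊤)))] (U : T.Opens) :
    Γ(χ.algebra.sheaf, U) ≃ₗ[Γ(T, U)] Γ(T, U) × Γ(χ.L, U) × Γ(χ.F, U) × Γ(χ.F, U) :=
  χ.sumEquiv U

theorem res_algebraEquiv_symm [Fact (IsUnit (2 : Γ(T, ⊤)))] {U V : T.Opens} (h : V ≤ U)
    (x : Γ(T, U) × Γ(χ.L, U) × Γ(χ.F, U) × Γ(χ.F, U)) :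
    res _ h ((χ.algebraEquiv U).symm x) = (χ.algebraEquiv V).symm
      (resO h x.1, res χ.L h x.2.1, res χ.F h x.2.2.1, res χ.F h x.2.2.2) :=
  χ.res_sumEquiv_symm h x

theorem algebra_oneOn [Fact (IsUnit (2 : Γ(T, ⊤)))] (U : T.Opens) :
    χ.algebra.oneOn U = (χ.algebraEquiv U).symm (1, 0, 0, 0) := by
  refine (χ.res_algebraEquiv_symm le_top (1, 0, 0, 0)).trans ?_
  simp only [map_one, map_zero]

/-- The inclusion of a summand, from linear maps on sections. -/
noncomputable def algebraIncl [Fact (IsUnit (2 : Γ(T, ⊤)))] {M : T.Modules}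
    (g : ∀ U : T.Opens, Γ(M, U) →ₗ[Γ(T, U)] Γ(T, U) × Γ(χ.L, U) × Γ(χ.F, U) × Γ(χ.F, U))
    (hg : ∀ (U V : T.Opens) (h : V ≤ U) (x : Γ(M, U)),
      (resO h (g U x).1, res χ.L h (g U x).2.1, res χ.F h (g U x).2.2.1,
        res χ.F h (g U x).2.2.2) = g V (res M h x)) : M ⟶ χ.algebra.sheaf :=
  homMk (fun U => (χ.algebraEquiv U).symm.toLinearMap ∘ₗ g U) fun U V h x => by
    simp only [LinearMap.comp_apply, LinearEquiv.coe_coe, res_algebraEquiv_symm, hg U V h]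

theorem algebra_p [Fact (IsUnit (2 : Γ(T, ⊤)))] (U : T.Opens) (k : ZMod 3) (x) :
    (χ.algebra.coaction.gmod U).p k ((χ.algebraEquiv U).symm x) =
      (χ.algebraEquiv U).symm ((sumGModule _ _ _).p k x) := by
  refine (χ.sumCoaction_p U k _).trans (congrArg (χ.sumEquiv U).symm (congrArg _ ?_))
  exact (χ.sumEquiv U).apply_symm_apply x

theorem algebra_σ [Fact (IsUnit (2 : Γ(T, ⊤)))] (U : T.Opens) (x) :
    (χ.algebra.coaction.gmod U).σ ((χ.algebraEquiv U).symm x) =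
      (χ.algebraEquiv U).symm ((sumGModule _ _ _).σ x) := by
  refine (χ.sumCoaction_σ U _).trans (congrArg (χ.sumEquiv U).symm (congrArg _ ?_))
  exact (χ.sumEquiv U).apply_symm_apply x

theorem algebra_mul [Fact (IsUnit (2 : Γ(T, ⊤)))] (U : T.Opens) (x y) :
    χ.algebra.mul.app U ((χ.algebraEquiv U).symm x) ((χ.algebraEquiv U).symm y) =
      (χ.algebraEquiv U).symm (sumMul (χ.mLin U) (χ.bracketLin U)
        (χ.α.app U) (χ.β.app U) (χ.pairing.app U) x y) := by
  refine (χ.sumMultiplication_app U _ _).trans (congrArg (χ.sumEquiv U).symm ?_)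
  exact congrArg₂ (fun x y => sumMul _ _ _ _ _ x y)
    ((χ.sumEquiv U).apply_symm_apply x) ((χ.sumEquiv U).apply_symm_apply y)

/-- The algebra `A_χ` is `𝒪_T ⊕ L ⊕ F₁ ⊕ F₂`. -/
noncomputable def presentation [Fact (IsUnit (2 : Γ(T, ⊤)))] : AlgebraPresentation χ χ.algebra where
  ιL := χ.algebraIncl (fun U => LinearMap.inr _ _ _ ∘ₗ LinearMap.inl _ _ _) (by simp)
  ι₁ := χ.algebraIncl (fun U => LinearMap.inr _ _ _ ∘ₗ LinearMap.inr _ _ _ ∘ₗ LinearMap.inl _ _ _)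
    (by simp)
  ι₂ := χ.algebraIncl (fun U => LinearMap.inr _ _ _ ∘ₗ LinearMap.inr _ _ _ ∘ₗ LinearMap.inr _ _ _)
    (by simp)
  bijective U := by
    have : (fun x : Γ(T, U) × Γ(χ.L, U) × Γ(χ.F, U) × Γ(χ.F, U) =>
        x.1 • χ.algebra.oneOn U + (χ.algebraEquiv U).symm (0, x.2.1, 0, 0) +
          (χ.algebraEquiv U).symm (0, 0, x.2.2.1, 0) + (χ.algebraEquiv U).symm (0, 0, 0, x.2.2.2)) =
        (χ.algebraEquiv U).symm := by
      funext x
      rw [algebra_oneOn]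
      refine ((congrArg (· + _ + _ + _) (map_smul (χ.algebraEquiv U).symm _ _).symm).trans ?_)
      simp only [← map_add]
      congr 1
      ext <;> simp
    exact this ▸ (χ.algebraEquiv U).symm.bijective
  mu_L U s := Coaction.mu_eq_of_degree _ _ _ _ <| (χ.algebra_p U _ _).trans <|
    congrArg _ (by simp [sumGModule])
  mu_F₁ U s := Coaction.mu_eq_of_degree _ _ _ _ <| (χ.algebra_p U _ _).trans <|
    congrArg _ (by simp [sumGModule])
  mu_F₂ U s := Coaction.mu_eq_of_degree _ _ _ _ <| (χ.algebra_p U _ _).trans <|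
    congrArg _ (by simp [sumGModule])
  sigma_L U s := (Coaction.sigma_eq _ _ _).trans <| (χ.algebra_σ U _).trans <| by
    refine Eq.trans (congrArg (χ.algebraEquiv U).symm ?_) (map_neg (χ.algebraEquiv U).symm _)
    simp [sumGModule]
  sigma_F₁ U s := (Coaction.sigma_eq _ _ _).trans <| (χ.algebra_σ U _).trans <| by
    exact congrArg (χ.algebraEquiv U).symm (by simp [sumGModule])
  sigma_F₂ U s := (Coaction.sigma_eq _ _ _).trans <| (χ.algebra_σ U _).trans <| by
    exact congrArg (χ.algebraEquiv U).symm (by simp [sumGModule])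
  mul_L_L U s t := (χ.algebra_mul U _ _).trans <|
    (congrArg _ (sumMul_L_L _ _ _ _ _ s t)).trans <|
      (map_smul (χ.algebraEquiv U).symm _ _).trans (congrArg _ (χ.algebra_oneOn U).symm)
  mul_L_F₁ U u v := (χ.algebra_mul U _ _).trans <| congrArg _ (sumMul_L_F₁ _ _ _ _ _ u v)
  mul_L_F₂ U u v := (χ.algebra_mul U _ _).trans <| congrArg _ (sumMul_L_F₂ _ _ _ _ _ u v)
  mul_F₁_L U u v := (χ.algebra_mul U _ _).trans <| congrArg _ (sumMul_F₁_L _ _ _ _ _ u v)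
  mul_F₂_L U u v := (χ.algebra_mul U _ _).trans <| congrArg _ (sumMul_F₂_L _ _ _ _ _ u v)
  mul_F₁_F₁ U u v := (χ.algebra_mul U _ _).trans <| congrArg _ (sumMul_F₁_F₁ _ _ _ _ _ u v)
  mul_F₂_F₂ U u v := (χ.algebra_mul U _ _).trans <| congrArg _ (sumMul_F₂_F₂ _ _ _ _ _ u v)
  mul_F₁_F₂ U u v := (χ.algebra_mul U _ _).trans <|
    (congrArg _ (sumMul_F₁_F₂ _ _ _ _ _ u v)).trans <|
      (map_add (χ.algebraEquiv U).symm _ _).trans <| congrArg₂ _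
        ((map_smul (χ.algebraEquiv U).symm _ _).trans (congrArg _ (χ.algebra_oneOn U).symm)) rfl
  mul_F₂_F₁ U u v := (χ.algebra_mul U _ _).trans <|
    (congrArg _ (sumMul_F₂_F₁ _ _ _ _ _ u v)).trans <|
      (map_sub (χ.algebraEquiv U).symm _ _).trans <| congrArg₂ _
        ((map_smul (χ.algebraEquiv U).symm _ _).trans (congrArg _ (χ.algebra_oneOn U).symm)) rfl

end BuildingData
end SThreeCover

/-! ### Local isomorphisms with the regular representation -/

namespace SThreeCover

open CoordG

section Regular

attribute [local instance 2000] TensorProduct.instModule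

variable {R M : Type*} [CommRing R] [AddCommGroup M] [Module R M]

namespace GModule

/-- The equivariant map to the regular representation defined by a linear form. -/
noncomputable def regMap (Q : GModule R M) (l : M →ₗ[R] R) : M →ₗ[R] R ⊗[ℤ] CoordG where
  toFun x := (l.restrictScalars ℤ).rTensor CoordG (Q.coact x)
  map_add' x y := by rw [map_add, map_add]
  map_smul' r x := by
    refine tensor_ext fun c k => ?_
    simp [part_rTensor, part_smul]

theorem part_regMap (Q : GModule R M) (l : M →ₗ[R] R) (c : ZMod 2) (k : ZMod 3) (x : M) :
    part c k (Q.regMap l x) = l (Q.p k (if c = 0 then x else Q.σ x)) := by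
  change part c k ((l.restrictScalars ℤ).rTensor CoordG (Q.coact x)) = _
  rw [part_rTensor, part_coact]
  rfl

/-- The map to the regular representation is bijective if its coefficients, which are the values of
the linear form on the translates `p k (σ ^ a x)`, take all values exactly once. -/
theorem regMap_bijective (Q : GModule R M) (l : M →ₗ[R] R)
    (h : Function.Bijective fun (x : M) (a : ZMod 2 × ZMod 3) =>
      l (Q.p a.2 (if a.1 = 0 then x else Q.σ x))) : Function.Bijective (Q.regMap l) := by
  constructor
  · intro x y hxy
    refine h.1 (funext fun a => ?_)
    have := congrArg (part a.1 a.2) hxy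
    rwa [part_regMap, part_regMap] at this
  · intro z
    obtain ⟨x, hx⟩ := h.2 fun a => part a.1 a.2 z
    refine ⟨x, tensor_ext fun c k => ?_⟩
    rw [part_regMap]
    exact congrFun hx (c, k)

theorem regMap_equivariant (Q : GModule R M) (l : M →ₗ[R] R) (x : M) :
    TensorProduct.assoc ℤ R CoordG CoordG
        (((Q.regMap l).restrictScalars ℤ).rTensor CoordG (Q.coact x)) =
      Coalgebra.comul.lTensor R (Q.regMap l x) := by
  have h := Q.coact_coassoc x
  have h' := congrArg ((l.restrictScalars ℤ).rTensor (CoordG ⊗[ℤ] CoordG)) h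
  have e1 : (Q.regMap l).restrictScalars ℤ =
      (l.restrictScalars ℤ).rTensor CoordG ∘ₗ Q.coact.restrictScalars ℤ := rfl
  have e2 : ∀ z : (M ⊗[ℤ] CoordG) ⊗[ℤ] CoordG, TensorProduct.assoc ℤ R CoordG CoordG
      (((l.restrictScalars ℤ).rTensor CoordG).rTensor CoordG z) =
      (l.restrictScalars ℤ).rTensor (CoordG ⊗[ℤ] CoordG)
        (TensorProduct.assoc ℤ M CoordG CoordG z) := fun z => by
    rw [LinearMap.rTensor_tensor]
    simp
  rw [e1, LinearMap.rTensor_comp, LinearMap.comp_apply, e2, h']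
  change _ = (Coalgebra.comul.lTensor R ∘ₗ (l.restrictScalars ℤ).rTensor CoordG) (Q.coact x)
  rw [LinearMap.lTensor_comp_rTensor, ← LinearMap.rTensor_comp_lTensor]
  rfl

end GModule
end Regular

theorem IsLocalBasis.repr_res {T : Scheme.{u}} {M : T.Modules} {U V : T.Opens} (h : V ≤ U)
    {ι : Type} [Fintype ι] {b : ι → Γ(M, U)} (hb : IsLocalBasis M b) (x : Γ(M, U)) (i : ι) :
    (hb.restrict h).toBasis.repr (res M h x) i = resO h (hb.toBasis.repr x i) := by
  have hB : ∀ j, res M h (b j) = (hb.restrict h).toBasis j := fun j =>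
    ((hb.restrict h).toBasis_apply j).symm
  generalize (hb.restrict h).toBasis = B at hB ⊢
  conv_lhs => rw [← hb.toBasis.sum_repr x]
  rw [map_sum]
  simp only [res_smul, hb.toBasis_apply, hB]
  rw [Module.Basis.repr_sum_self]

namespace AlgebraPresentation

variable {T : Scheme.{u}} {χ : BuildingData T} {A : EquivariantAlgebra T}
  (P : AlgebraPresentation χ A)

/-- The linear form which maps `1` and `t` to `1`, the element `y` of `F₁` to `1`, the element `z`
of `F₂` to `1`, and the other elements of the basis to `0`. -/
noncomputable def form {U : T.Opens} {t : Γ(χ.L, U)} {y z : Γ(χ.F, U)}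
    (ht : IsLocalBasis χ.L fun _ : Fin 1 => t) (hb : IsLocalBasis χ.F ![y, z]) :
    Γ(A.sheaf, U) →ₗ[Γ(T, U)] Γ(T, U) :=
  (LinearMap.id.coprod ((ht.toBasis.coord 0).coprod
    ((hb.toBasis.coord 0).coprod (hb.toBasis.coord 1)))) ∘ₗ P.coord U

theorem form_apply {U : T.Opens} {t : Γ(χ.L, U)} {y z : Γ(χ.F, U)}
    (ht : IsLocalBasis χ.L fun _ : Fin 1 => t) (hb : IsLocalBasis χ.F ![y, z]) (x : Γ(A.sheaf, U)) :
    P.form ht hb x = (P.coord U x).1 + (ht.toBasis.repr (P.coord U x).2.1 0 +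
      (hb.toBasis.repr (P.coord U x).2.2.1 0 + hb.toBasis.repr (P.coord U x).2.2.2 1)) := rfl

/-- The six coefficients of `r + s t + u + v`, with `r, s` functions, `u ∈ F₁` and `v ∈ F₂`, are `r
+ s` and `r - s`, which determine `r` and `s` because `2` is invertible, and the coordinates of `u`
and `v`. -/
theorem form_bijective [Fact (IsUnit (2 : Γ(T, ⊤)))] {U : T.Opens} {t : Γ(χ.L, U)}
    {y z : Γ(χ.F, U)} (ht : IsLocalBasis χ.L fun _ : Fin 1 => t)
    (hb : IsLocalBasis χ.F ![y, z]) :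
    Function.Bijective fun (x : Γ(A.sheaf, U)) (a : ZMod 2 × ZMod 3) => P.form ht hb
      ((A.coaction.gmod U).p a.2 (if a.1 = 0 then x else (A.coaction.gmod U).σ x)) := by
  have e1 : (1 : ZMod 3) ≠ 0 := by decide
  have e2 : (2 : ZMod 3) ≠ 0 := by decide
  have e3 : (2 : ZMod 3) ≠ 1 := by decide
  have e4 : (1 : ZMod 2) ≠ 0 := by decide
  have key : ∀ (r : Γ(T, U)) (s : Γ(χ.L, U)) (u v : Γ(χ.F, U)) (c : ZMod 2) (k : ZMod 3),
      P.form ht hb ((A.coaction.gmod U).p k (if c = 0 then P.equiv U (r, s, u, v) else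
        (A.coaction.gmod U).σ (P.equiv U (r, s, u, v)))) =
      if c = 0 then (if k = 0 then r + ht.toBasis.repr s 0 else
        if k = 1 then hb.toBasis.repr u 0 else hb.toBasis.repr v 1)
      else (if k = 0 then r - ht.toBasis.repr s 0 else
        if k = 1 then hb.toBasis.repr v 0 else hb.toBasis.repr u 1) := by
    intro r s u v c k
    have hc : c = 0 ∨ c = 1 := by decide +revert
    have hk : k = 0 ∨ k = 1 ∨ k = 2 := by decide +revert
    rcases hc with rfl | rfl <;> rcases hk with rfl | rfl | rfl <;>
    simp [equiv_apply, form_apply, σ_ιL, σ_ι₁, σ_ι₂, (A.p_σ_one U).2, p_one, p_ιL, p_ι₁, p_ι₂, e1,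
      e2, e3, e4, e1.symm, e2.symm, e3.symm, coord_one, coord_ιL, coord_ι₁, coord_ι₂,
      sub_eq_add_neg]
  obtain ⟨h, hh⟩ := (two_isUnit U).exists_left_inv
  constructor
  · intro x x' hxx
    obtain ⟨⟨r, s, u, v⟩, rfl⟩ := (P.equiv U).surjective x
    obtain ⟨⟨r', s', u', v'⟩, rfl⟩ := (P.equiv U).surjective x'
    have H : ∀ c k, _ := fun c k => congrFun hxx (c, k)
    simp only [key] at H
    have h00 := H 0 0
    have h01 := H 0 1
    have h02 := H 0 2
    have h10 := H 1 0
    have h11 := H 1 1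
    have h12 := H 1 2
    simp only [e1, e2, e3, e4, if_true, if_false] at h00 h01 h02 h10 h11 h12
    have hr : r = r' := by linear_combination (-r + r') * hh + h * h00 + h * h10
    have hs : s = s' := ht.toBasis.ext_elem fun i => by
      rw [Subsingleton.elim i 0]
      linear_combination h00 - hr
    have hu : u = u' := hb.toBasis.ext_elem fun i => by
      fin_cases i
      exacts [h01, h12]
    have hv : v = v' := hb.toBasis.ext_elem fun i => by
      fin_cases i
      exacts [h11, h02]
    rw [hr, hs, hu, hv]
  · intro w
    refine ⟨P.equiv U (h * (w (0, 0) + w (1, 0)),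
      ht.toBasis.repr.symm (Finsupp.single 0 (h * (w (0, 0) - w (1, 0)))),
      hb.toBasis.equivFun.symm ![w (0, 1), w (1, 2)],
      hb.toBasis.equivFun.symm ![w (1, 1), w (0, 2)]), funext fun ⟨c, k⟩ => ?_⟩
    refine (key _ _ _ _ c k).trans ?_
    simp only [← Module.Basis.equivFun_apply, LinearEquiv.apply_symm_apply]
    have hc : c = 0 ∨ c = 1 := by decide +revert
    have hk : k = 0 ∨ k = 1 ∨ k = 2 := by decide +revert
    rcases hc with rfl | rfl <;> rcases hk with rfl | rfl | rfl <;>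
    simp [e1, e2, e3, e4]
    · linear_combination w (0, 0) * hh
    · linear_combination w (1, 0) * hh

theorem resO_form {U V : T.Opens} (h : V ≤ U) {t : Γ(χ.L, U)} {y z : Γ(χ.F, U)}
    (ht : IsLocalBasis χ.L fun _ : Fin 1 => t) (hb : IsLocalBasis χ.F ![y, z])
    {t' : Γ(χ.L, V)} {y' z' : Γ(χ.F, V)}
    (ht' : IsLocalBasis χ.L fun _ : Fin 1 => t') (hb' : IsLocalBasis χ.F ![y', z'])
    (et : res χ.L h t = t') (ey : res χ.F h y = y') (ez : res χ.F h z = z') (x : Γ(A.sheaf, U)) :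
    resO h (P.form ht hb x) = P.form ht' hb' (res A.sheaf h x) := by
  subst et ey ez
  have hbb : (hb.restrict h).toBasis = hb'.toBasis := Module.Basis.eq_of_apply_eq fun i => by
    rw [IsLocalBasis.toBasis_apply, IsLocalBasis.toBasis_apply]
    fin_cases i <;> rfl
  rw [form_apply, form_apply, coord_res, ← hbb, map_add, map_add, map_add]
  exact congrArg₂ (· + ·) rfl (congrArg₂ (· + ·) (ht.repr_res h _ 0).symm
    (congrArg₂ (· + ·) (hb.repr_res h _ 0).symm (hb.repr_res h _ 1).symm))

end AlgebraPresentation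

/-- A linear form on a sheaf with a coaction defines an equivariant map to the regular
representation. -/
theorem Coaction.isRegular_of_form {T : Scheme.{u}} {M : T.Modules} (ρ : Coaction M)
    (l : ∀ U : T.Opens, Γ(M, U) →ₗ[Γ(T, U)] Γ(T, U))
    (hl : ∀ (U V : T.Opens) (h : V ≤ U) (x : Γ(M, U)), resO h (l U x) = l V (res M h x))
    (hb : ∀ U : T.Opens, Function.Bijective fun (x : Γ(M, U)) (a : ZMod 2 × ZMod 3) =>
      l U ((ρ.gmod U).p a.2 (if a.1 = 0 then x else (ρ.gmod U).σ x))) : ρ.IsRegular := by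
  refine ⟨fun U => LinearEquiv.ofBijective _ ((ρ.gmod U).regMap_bijective _ (hb U)),
    fun U V h x => ?_, fun U x => ?_⟩
  · refine tensor_ext fun c k => ?_
    refine (part_rTensor _ _ _ _).trans ?_
    refine (congrArg _ (GModule.part_regMap _ _ _ _ _)).trans
      (Eq.trans ?_ (GModule.part_regMap _ _ _ _ _).symm)
    refine (hl U V h _).trans (congrArg _ (((ρ.res_gmod h).1 k _).trans (congrArg _ ?_)))
    split_ifs
    · rfl
    · exact (ρ.res_gmod h).2 _
  · rw [app_eq]
    exact GModule.regMap_equivariant _ _ x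

section OpenSubscheme

variable {T : Scheme.{u}}

theorem restrict_smul (M : T.Modules) (U : T.Opens) (W : U.toScheme.Opens)
    (r : Γ(U.toScheme, W)) (x : Γ(M.restrict U.ι, W)) :
    r • x = HSMul.hSMul (α := Γ(T, U.ι ''ᵁ W)) (β := Γ(M, U.ι ''ᵁ W)) r x := by
  change HSMul.hSMul (α := Γ(T, U.ι ''ᵁ W)) (β := Γ(M, U.ι ''ᵁ W)) ((U.ι.appIso W).inv r) x = _
  rw [Scheme.Opens.ι_appIso]
  rfl

/-- A linear form on sections over an open subset of `U`, as a linear form on sections over an open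
subset of the open subscheme `U`. -/
noncomputable def restrictForm {M : T.Modules} {U : T.Opens} {W : U.toScheme.Opens}
    (l : Γ(M, U.ι ''ᵁ W) →ₗ[Γ(T, U.ι ''ᵁ W)] Γ(T, U.ι ''ᵁ W)) :
    Γ(M.restrict U.ι, W) →ₗ[Γ(U.toScheme, W)] Γ(U.toScheme, W) where
  toFun := l
  map_add' := map_add l
  map_smul' r x := (congrArg _ (restrict_smul M U W r x)).trans (map_smul l _ _)

theorem resO_restrictForm {M : T.Modules} {U : T.Opens} {W W' : U.toScheme.Opens} (h : W' ≤ W)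
    (l : Γ(M, U.ι ''ᵁ W) →ₗ[Γ(T, U.ι ''ᵁ W)] Γ(T, U.ι ''ᵁ W))
    (l' : Γ(M, U.ι ''ᵁ W') →ₗ[Γ(T, U.ι ''ᵁ W')] Γ(T, U.ι ''ᵁ W'))
    (H : ∀ x, resO (U.ι.image_mono h) (l x) = l' (res M (U.ι.image_mono h) x))
    (x : Γ(M.restrict U.ι, W)) :
    resO h (restrictForm l x) = restrictForm l' (res (M.restrict U.ι) h x) :=
  H x

/-- The restriction of a sheaf to an open subscheme. -/
noncomputable def restrictCart (M : T.Modules) (U : T.Opens) :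
    CartMap U.ι M (M.restrict U.ι) where
  hom := (Scheme.Modules.restrictAdjunction U.ι).unit.app M
  isLocalBasis V n b hb W hW := by
    have h : U.ι ''ᵁ W ≤ V := (U.ι.image_mono hW).trans (U.ι.image_preimage_le V)
    refine Eq.mp (congrArg Function.Bijective ?_) (hb (U.ι ''ᵁ W) h)
    funext c
    refine Finset.sum_congr rfl fun i _ => ?_
    refine Eq.trans ?_ (restrict_smul M U W _ _).symm
    exact congrArg _ (res_res M (U.ι.image_preimage_le V) (U.ι.image_mono hW) (b i)).symm

/-- The restriction of an action of `G` to an open subscheme. -/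
noncomputable def Coaction.restrictGMod {M : T.Modules} (ρ : Coaction M) (U : T.Opens)
    (W : U.toScheme.Opens) : GModule Γ(U.toScheme, W) Γ(M.restrict U.ι, W) where
  p k :=
    { toFun := fun x => (ρ.gmod (U.ι ''ᵁ W)).p k x
      map_add' := ((ρ.gmod (U.ι ''ᵁ W)).p k).map_add
      map_smul' := fun r x => by
        refine (congrArg _ (restrict_smul M U W r x)).trans
          ((((ρ.gmod (U.ι ''ᵁ W)).p k).map_smul _ _).trans (restrict_smul M U W r _).symm) }
  σ :=
    { toFun := fun x => (ρ.gmod (U.ι ''ᵁ W)).σ x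
      map_add' := ((ρ.gmod (U.ι ''ᵁ W)).σ).map_add
      map_smul' := fun r x => by
        refine (congrArg _ (restrict_smul M U W r x)).trans
          ((((ρ.gmod (U.ι ''ᵁ W)).σ).map_smul _ _).trans (restrict_smul M U W r _).symm) }
  p_p := (ρ.gmod (U.ι ''ᵁ W)).p_p
  sum_p := (ρ.gmod (U.ι ''ᵁ W)).sum_p
  σ_σ := (ρ.gmod (U.ι ''ᵁ W)).σ_σ
  p_σ := (ρ.gmod (U.ι ''ᵁ W)).p_σ

/-- The restriction of a coaction to an open subscheme. -/
noncomputable def Coaction.restrict {M : T.Modules} (ρ : Coaction M) (U : T.Opens) :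
    Coaction (M.restrict U.ι) :=
  .ofGMod (ρ.restrictGMod U)
    (fun _ _ h k x => (ρ.res_gmod (U.ι.image_mono h)).1 k x)
    (fun _ _ h x => (ρ.res_gmod (U.ι.image_mono h)).2 x)

theorem Coaction.gmod_restrict {M : T.Modules} (ρ : Coaction M) (U : T.Opens)
    (W : U.toScheme.Opens) : (ρ.restrict U).gmod W = ρ.restrictGMod U W :=
  gmod_ofGMod _ _ _ _

theorem Coaction.restrictCart_coaction {M : T.Modules} (ρ : Coaction M) (U V : T.Opens)
    (x : Γ(M, V)) : ((restrictCart M U).app V).rTensor CoordG (ρ.app V x) =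
      (ρ.restrict U).app (U.ι ⁻¹ᵁ V) ((restrictCart M U).app V x) := by
  rw [app_eq]
  refine ((ρ.gmod V).rTensor_coact_iff (ρ.restrictGMod U (U.ι ⁻¹ᵁ V)) _).2 ⟨?_, ?_⟩ x
  · exact (ρ.res_gmod (U.ι.image_preimage_le V)).1
  · exact (ρ.res_gmod (U.ι.image_preimage_le V)).2

end OpenSubscheme

namespace AlgebraPresentation

variable {T : Scheme.{u}} {χ : BuildingData T} {A : EquivariantAlgebra T}

/-- Over an open on which `L` and `F` have bases, a presented algebra is a regular representation.
-/
theorem isRegular_restrict [Fact (IsUnit (2 : Γ(T, ⊤)))] (P : AlgebraPresentation χ A)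
    {U : T.Opens} {t : Γ(χ.L, U)} {y z : Γ(χ.F, U)} (ht : IsLocalBasis χ.L fun _ : Fin 1 => t)
    (hb : IsLocalBasis χ.F ![y, z]) : (A.coaction.restrict U).IsRegular := by
  have hb' : ∀ V (h : V ≤ U), IsLocalBasis χ.F ![res χ.F h y, res χ.F h z] := fun V h =>
    (hb.restrict h).congr fun i => by fin_cases i <;> rfl
  have hr : ∀ (W W' : U.toScheme.Opens) (h : W' ≤ W) (x : Γ(A.sheaf, U.ι ''ᵁ W)),
      resO (U.ι.image_mono h)
        (P.form (ht.restrict (U.ι_image_le W)) (hb' _ (U.ι_image_le W)) x) =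
      P.form (ht.restrict (U.ι_image_le W')) (hb' _ (U.ι_image_le W'))
        (res A.sheaf (U.ι.image_mono h) x) := fun W W' h =>
    P.resO_form (U.ι.image_mono h) _ _ _ _ (res_res _ _ _ _) (res_res _ _ _ _) (res_res _ _ _ _)
  refine Coaction.isRegular_of_form _ (fun W =>
    restrictForm (P.form (ht.restrict (U.ι_image_le W)) (hb' _ (U.ι_image_le W))))
    (fun W W' h => resO_restrictForm h _ _ (hr W W' h)) fun W => ?_
  rw [Coaction.gmod_restrict]
  exact P.form_bijective (ht.restrict (U.ι_image_le W)) (hb' _ (U.ι_image_le W))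

/-- Over the opens on which `L` and `F` are trivial, `A` is a regular representation. So already a
Zariski cover suffices. -/
theorem isGCover [Fact (IsUnit (2 : Γ(T, ⊤)))] (P : AlgebraPresentation χ A)
    (h : χ.Relations) : A.IsGCover where
  mul_comm := P.comm_of_relations h
  mul_assoc := P.assoc_of_relations h
  exists_regular := by
    choose U hU t y z ht hb using χ.exists_bases
    have hc : IsOpenCover U := by
      refine eq_top_iff.2 fun x _ => Opens.mem_iSup.2 ⟨x, hU x⟩
    refine ⟨Precoverage.ZeroHypercover.weaken (T.openCoverOfIsOpenCover U hc)
      Scheme.zariskiPrecoverage_le_fppfPrecoverage, fun i => ?_⟩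
    exact ⟨_, A.coaction.restrict (U i), restrictCart A.sheaf (U i),
      A.coaction.restrictCart_coaction (U i), P.isRegular_restrict (ht i) (hb i)⟩

end AlgebraPresentation
end SThreeCover

/-! ### The morphism of stacks -/

namespace SThreeCover

theorem mapHom_ιL {T T' : Scheme.{u}} [Fact (IsUnit (2 : Γ(T, ⊤)))] {f : T' ⟶ T}
    {χ : BuildingData T} {χ' : BuildingData T'} {A : EquivariantAlgebra T}
    {A' : EquivariantAlgebra T'} (P : AlgebraPresentation χ A) (P' : AlgebraPresentation χ' A')
    (φ : BuildingData.Hom f χ' χ) (U : T.Opens) (s : Γ(χ.L, U)) :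
    (AlgebraPresentation.mapHom P P' φ).map.app U (P.ιL.app U s) =
      P'.ιL.app (f ⁻¹ᵁ U) (φ.mapL.app U s) :=
  AlgebraPresentation.mapFun_ιL P P' φ U s

theorem mapHom_ι₁ {T T' : Scheme.{u}} [Fact (IsUnit (2 : Γ(T, ⊤)))] {f : T' ⟶ T}
    {χ : BuildingData T} {χ' : BuildingData T'} {A : EquivariantAlgebra T}
    {A' : EquivariantAlgebra T'} (P : AlgebraPresentation χ A) (P' : AlgebraPresentation χ' A')
    (φ : BuildingData.Hom f χ' χ) (U : T.Opens) (u : Γ(χ.F, U)) :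
    (AlgebraPresentation.mapHom P P' φ).map.app U (P.ι₁.app U u) =
      P'.ι₁.app (f ⁻¹ᵁ U) (φ.mapF.app U u) :=
  AlgebraPresentation.mapFun_ι₁ P P' φ U u

theorem mapHom_ι₂ {T T' : Scheme.{u}} [Fact (IsUnit (2 : Γ(T, ⊤)))] {f : T' ⟶ T}
    {χ : BuildingData T} {χ' : BuildingData T'} {A : EquivariantAlgebra T}
    {A' : EquivariantAlgebra T'} (P : AlgebraPresentation χ A) (P' : AlgebraPresentation χ' A')
    (φ : BuildingData.Hom f χ' χ) (U : T.Opens) (u : Γ(χ.F, U)) :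
    (AlgebraPresentation.mapHom P P' φ).map.app U (P.ι₂.app U u) =
      P'.ι₂.app (f ⁻¹ᵁ U) (φ.mapF.app U u) :=
  AlgebraPresentation.mapFun_ι₂ P P' φ U u

namespace BuildingData.Hom

variable {T T' T'' : Scheme.{u}} {f : T' ⟶ T} {g : T'' ⟶ T'}

theorem ext_app {χ : BuildingData T} {χ' : BuildingData T'} {φ ψ : BuildingData.Hom f χ' χ}
    (hL : ∀ (U : T.Opens) (s : Γ(χ.L, U)), φ.mapL.app U s = ψ.mapL.app U s)
    (hF : ∀ (U : T.Opens) (u : Γ(χ.F, U)), φ.mapF.app U u = ψ.mapF.app U u) : φ = ψ :=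
  eq_of_heq (BuildingData.Hom.heq_of_eq rfl φ ψ (_root_.heq_of_eq (CartMap.ext_app hL))
    (_root_.heq_of_eq (CartMap.ext_app hF)))

end BuildingData.Hom

theorem mapHom_id {T : Scheme.{u}} [Fact (IsUnit (2 : Γ(T, ⊤)))] {χ : BuildingData T}
    {A : EquivariantAlgebra T} (P : AlgebraPresentation χ A) :
    AlgebraPresentation.mapHom P P (.id χ) = .id A :=
  AlgebraPresentation.hom_ext P (fun U s => mapHom_ιL P P (.id χ) U s)
    (fun U s => mapHom_ι₁ P P (.id χ) U s) (fun U s => mapHom_ι₂ P P (.id χ) U s)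

theorem mapHom_comp {T T' T'' : Scheme.{u}} [Fact (IsUnit (2 : Γ(T, ⊤)))]
    [Fact (IsUnit (2 : Γ(T', ⊤)))] {f : T' ⟶ T} {g : T'' ⟶ T'} {χ : BuildingData T}
    {χ' : BuildingData T'} {χ'' : BuildingData T''} {A : EquivariantAlgebra T}
    {A' : EquivariantAlgebra T'} {A'' : EquivariantAlgebra T''} (P : AlgebraPresentation χ A)
    (P' : AlgebraPresentation χ' A') (P'' : AlgebraPresentation χ'' A'')
    (ψ : BuildingData.Hom g χ'' χ') (φ : BuildingData.Hom f χ' χ) :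
    AlgebraPresentation.mapHom P P'' (.comp ψ φ) =
      .comp (AlgebraPresentation.mapHom P' P'' ψ) (AlgebraPresentation.mapHom P P' φ) := by
  refine EquivariantAlgebra.Hom.ext_map (CartMap.ext_app fun U x => ?_)
  have h : AlgebraPresentation.mapFun P' P'' ψ (f ⁻¹ᵁ U) (AlgebraPresentation.mapFun P P' φ U x) =
      g.app (f ⁻¹ᵁ U) (f.app U (P.coord U x).1) • A''.oneOn (g ⁻¹ᵁ f ⁻¹ᵁ U) +
      P''.ιL.app _ (ψ.mapL.app _ (φ.mapL.app U (P.coord U x).2.1)) +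
      P''.ι₁.app _ (ψ.mapF.app _ (φ.mapF.app U (P.coord U x).2.2.1)) +
      P''.ι₂.app _ (ψ.mapF.app _ (φ.mapF.app U (P.coord U x).2.2.2)) := by
    rw [AlgebraPresentation.mapFun_apply P' P'', AlgebraPresentation.mapFun_apply P P',
      P'.coord_eq]
  refine Eq.trans ?_ h.symm
  refine (AlgebraPresentation.mapFun_apply P P'' (.comp ψ φ) U x).trans ?_
  rw [Scheme.Hom.comp_app]
  rfl

/-- The morphism of stacks `χ ↦ A_χ`. -/
noncomputable def algebraStackMap : StackMap.{u} where
  obj X := X.data.algebra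
  map {X Y} φ := AlgebraPresentation.mapHom Y.data.presentation X.data.presentation
    (StackY.Hom.data φ)
  map_id X := mapHom_id X.data.presentation
  map_comp φ ψ := mapHom_comp _ _ _ (StackY.Hom.data φ) (StackY.Hom.data ψ)

/-- The algebras `A_χ` come with presentations. -/
noncomputable def algebraStackMapPresentation : algebraStackMap.{u}.Presentation where
  pres X := X.data.presentation
  map_L φ U s := mapHom_ιL _ _ (StackY.Hom.data φ) U s
  map_F₁ φ U s := mapHom_ι₁ _ _ (StackY.Hom.data φ) U s
  map_F₂ φ U s := mapHom_ι₂ _ _ (StackY.Hom.data φ) U s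

theorem algebraStackMap_full : algebraStackMap.{u}.toFunctor.Full where
  map_surjective {X Y} ψ := by
    obtain ⟨f, ψ⟩ : StackLRings.Hom _ _ := ψ
    let d := AlgebraPresentation.dataHom Y.data.presentation X.data.presentation ψ
    refine ⟨show StackY.Hom X Y from ⟨f, d⟩, StackLRings.Hom.ext rfl (heq_of_eq ?_)⟩
    refine AlgebraPresentation.hom_ext Y.data.presentation (fun U s => ?_) (fun U s => ?_)
      (fun U s => ?_)
    · exact (mapHom_ιL _ _ d U s).trans (AlgebraPresentation.ιL_cartL _ _ ψ U s)
    · exact (mapHom_ι₁ _ _ d U s).trans (AlgebraPresentation.ι₁_cartF _ _ ψ U s)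
    · exact (mapHom_ι₂ _ _ d U s).trans (AlgebraPresentation.ι₂_cartF _ _ ψ U s)

theorem algebraStackMap_faithful : algebraStackMap.{u}.toFunctor.Faithful where
  map_injective {X Y} φ ψ h := by
    obtain ⟨f, φ⟩ : StackY.Hom X Y := φ
    obtain ⟨g, ψ⟩ : StackY.Hom X Y := ψ
    obtain rfl : f = g := congrArg StackLRings.Hom.scheme h
    have h' : AlgebraPresentation.mapHom Y.data.presentation X.data.presentation φ =
        AlgebraPresentation.mapHom Y.data.presentation X.data.presentation ψ :=
      eq_of_heq (StackLRings.Hom.mk.inj h).2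
    have : φ = ψ := BuildingData.Hom.ext_app
      (fun U s => X.data.presentation.ιL_injective _ <| by
        rw [← mapHom_ιL Y.data.presentation, h', mapHom_ιL])
      (fun U s => X.data.presentation.ι₁_injective _ <| by
        rw [← mapHom_ι₁ Y.data.presentation, h', mapHom_ι₁])
    rw [this]

/-- Two algebras with presentations by the same building data are isomorphic. -/
theorem nonempty_iso_of_presentation {T : Over base.{u}} {χ : BuildingData T.left}
    {A A' : EquivariantAlgebra T.left} (P : AlgebraPresentation χ A)
    (P' : AlgebraPresentation χ A') :
    Nonempty ((⟨T, A⟩ : StackLRings.{u}) ≅ ⟨T, A'⟩) := by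
  let F : ∀ {A A' : EquivariantAlgebra T.left} (_ : AlgebraPresentation χ A)
      (_ : AlgebraPresentation χ A'), (⟨T, A⟩ : StackLRings.{u}) ⟶ ⟨T, A'⟩ := fun P P' =>
    show StackLRings.Hom _ _ from ⟨𝟙 T, AlgebraPresentation.mapHom P' P (.id χ)⟩
  have hF : ∀ {A A' : EquivariantAlgebra T.left} (P : AlgebraPresentation χ A)
      (P' : AlgebraPresentation χ A'), F P P' ≫ F P' P = 𝟙 _ := fun {A A'} P P' => by
    refine StackLRings.Hom.ext (Category.comp_id (𝟙 T)) ?_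
    refine EquivariantAlgebra.Hom.heq_of_eq
      (congrArg CommaMorphism.left (Category.comp_id (𝟙 T))) _ _ ?_
    refine CartMap.heq_of_app (congrArg CommaMorphism.left (Category.comp_id (𝟙 T))) _ _ ?_
    intro U V h₁ h₂ x
    have h := (mapHom_comp P P' P (.id χ) (.id χ)).symm.trans
      ((AlgebraPresentation.hom_ext P (fun U s => mapHom_ιL P P _ U s)
        (fun U s => mapHom_ι₁ P P _ U s) (fun U s => mapHom_ι₂ P P _ U s) :
          AlgebraPresentation.mapHom P P (.comp (.id χ) (.id χ)) = .comp (.id A) (.id A)))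
    exact congrArg (fun φ => res A.sheaf h₁ (φ.map.app U x)) h
  exact ⟨⟨F P P', F P' P, hF P P', hF P' P⟩⟩

/-- If every `G`-cover has a presentation, then `χ ↦ A_χ` induces an equivalence. -/
theorem algebraStackMap_inducesEquivalence
    (H : ∀ (T : Over base.{u}) (A : EquivariantAlgebra T.left), A.IsGCover →
      ∃ χ : BuildingData T.left, Nonempty (AlgebraPresentation χ A))
    (C : ObjectProperty StackY.{u}) (hC : ∀ X, C X ↔ X.data.Relations) :
    algebraStackMap.{u}.InducesEquivalence C (fun A => A.data.IsGCover) := by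
  have hfull := algebraStackMap_full.{u}
  have hfaithful := algebraStackMap_faithful.{u}
  have H' : ∀ (T : Over base.{u}) (A : EquivariantAlgebra T.left), A.IsGCover →
      ∃ χ : BuildingData T.left, C ⟨T, χ⟩ ∧ Nonempty (AlgebraPresentation χ A) :=
    fun T A hA => by
      obtain ⟨χ, ⟨P⟩⟩ := H T A hA
      exact ⟨χ, (hC _).2 (P.relations_of_comm_assoc hA.mul_comm hA.mul_assoc), ⟨P⟩⟩
  have hfull' : (C.ι ⋙ algebraStackMap.{u}.toFunctor).Full := inferInstance
  have hfaithful' : (C.ι ⋙ algebraStackMap.{u}.toFunctor).Faithful := inferInstance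
  refine ⟨⟨fun X => X.obj.data.presentation.isGCover ((hC _).1 X.property), ?_⟩, ?_⟩
  · refine { full := ?_, faithful := ?_, essSurj := ?_ }
    · exact Functor.Faithful.of_comp_iso (ObjectProperty.liftCompιIso _ (C.ι ⋙ _) _)
    · exact Functor.Full.of_comp_faithful_iso (ObjectProperty.liftCompιIso _ (C.ι ⋙ _) _)
    · refine ⟨fun Y => ?_⟩
      obtain ⟨χ, h, ⟨P⟩⟩ := H' Y.obj.scheme Y.obj.data Y.property
      obtain ⟨i⟩ := nonempty_iso_of_presentation χ.presentation P
      exact ⟨⟨⟨Y.obj.scheme, χ⟩, h⟩, ⟨ObjectProperty.isoMk _ i⟩⟩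
  · intro T A hA
    obtain ⟨χ, h, ⟨P⟩⟩ := H' T A hA
    exact ⟨χ, h, ⟨AlgebraPresentation.mapHom P χ.presentation (.id χ)⟩⟩

end SThreeCover

/-! ### Direct summands of locally free sheaves -/

namespace SThreeCover

/-- The columns of `P` and `1 - P` generate the space of all vectors, so that a basis can be
selected from them. -/
theorem exists_columns {K : Type*} [Field K] {n : ℕ} (P : Matrix (Fin n) (Fin n) K) :
    ∃ S : Fin n → Fin n ⊕ Fin n,
      (Matrix.of fun i j => Sum.elim (P i) ((1 - P) i) (S j)).det ≠ 0 := by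
  let W : Fin n ⊕ Fin n → Fin n → K := fun k i => Sum.elim (P i) ((1 - P) i) k
  obtain ⟨κ, a, -, hs, hl⟩ := exists_linearIndependent' K W
  have hW : Submodule.span K (Set.range W) = ⊤ := by
    rw [eq_top_iff, ← (Pi.basisFun K (Fin n)).span_eq, Submodule.span_le]
    rintro _ ⟨j, rfl⟩
    have : Pi.basisFun K (Fin n) j = W (Sum.inl j) + W (Sum.inr j) := by
      ext i
      simp [W, Matrix.one_apply, Pi.single_apply]
    rw [this]
    exact add_mem (Submodule.subset_span ⟨_, rfl⟩) (Submodule.subset_span ⟨_, rfl⟩)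
  rw [hW] at hs
  let B := Module.Basis.mk hl hs.ge
  let e : Fin n ≃ κ := (Pi.basisFun K (Fin n)).indexEquiv B
  refine ⟨a ∘ e, ?_⟩
  have hli : LinearIndependent K fun j => W (a (e j)) := hl.comp e e.injective
  have hu := (Matrix.isUnit_iff_isUnit_det _).1 ((Matrix.linearIndependent_cols_iff_isUnit
    (A := Matrix.of fun i j => Sum.elim (P i) ((1 - P) i) ((a ∘ e) j))).1 hli)
  exact hu.ne_zero

section

variable {T : Scheme.{u}}

/-- An invertible matrix maps a local basis to a local basis. -/
theorem IsLocalBasis.mul_matrix {M : T.Modules} {U : T.Opens} {ι : Type} [Fintype ι]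
    [DecidableEq ι] {b : ι → Γ(M, U)} (hb : IsLocalBasis M b) (C : Matrix ι ι Γ(T, U))
    (hC : IsUnit C.det) : IsLocalBasis M fun j => ∑ i, C i j • b i := by
  intro V h
  have hC' : IsUnit (C.map (resO h)).det := by
    rw [← RingHom.mapMatrix_apply, ← RingHom.map_det]
    exact hC.map _
  have h1 : Function.Bijective fun c : ι → Γ(T, V) => (C.map (resO h)).mulVec c := by
    refine Function.bijective_iff_has_inverse.2
      ⟨fun c => (C.map (resO h))⁻¹.mulVec c, fun c => ?_, fun c => ?_⟩
    · simp [Matrix.nonsing_inv_mul _ hC']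
    · simp [Matrix.mul_nonsing_inv _ hC']
  convert (hb V h).comp h1 using 1
  funext c
  simp only [Function.comp, Matrix.mulVec, dotProduct, map_sum, res_smul, Finset.smul_sum,
    Finset.sum_smul, Matrix.map_apply]
  rw [Finset.sum_comm]
  simp only [smul_smul, mul_comm]

/-- A direct summand of a locally free sheaf and a complement have local bases which together form a
local basis of the whole sheaf. They are chosen among the columns of the matrix of the projection
`q` and of `1 - q`, so that their determinant does not vanish at `t`. -/
theorem LocallyFree.exists_split {M N : T.Modules} (hM : LocallyFree M) (i : N ⟶ M) (e : M ⟶ N)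
    (hie : ∀ (U : T.Opens) (x : Γ(N, U)), e.app U (i.app U x) = x) (t : T) :
    ∃ V : T.Opens, t ∈ V ∧ ∃ (κ κ' : Type) (_ : Fintype κ) (_ : Fintype κ') (b : κ → Γ(N, V))
      (d : κ' → Γ(M, V)), (∀ k, e.app V (d k) = 0) ∧
        IsLocalBasis M (Sum.elim (fun k => i.app V (b k)) d) := by
  classical
  obtain ⟨U, htU, n, b, hb⟩ := hM t
  let q : Γ(M, U) →ₗ[Γ(T, U)] Γ(M, U) := appL i U ∘ₗ appL e U
  let P : Matrix (Fin n) (Fin n) Γ(T, U) := LinearMap.toMatrix hb.toBasis hb.toBasis q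
  have hP : ∀ j, q (b j) = ∑ i, P i j • b i := fun j => by
    conv_lhs => rw [← hb.toBasis.sum_repr (q (b j))]
    simp [P, LinearMap.toMatrix_apply, hb.toBasis_apply]
  obtain ⟨S, hS⟩ := exists_columns (P.map (T.evaluation U t htU).hom)
  let C : Matrix (Fin n) (Fin n) Γ(T, U) := Matrix.of fun i j => Sum.elim (P i) ((1 - P) i) (S j)
  have hC : ∀ j, ∑ i, C i j • b i = Sum.elim (fun k => q (b k)) (fun k => b k - q (b k)) (S j) := by
    intro j
    simp only [C, Matrix.of_apply]
    rcases S j with k | k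
    · simp [hP]
    · simp [hP, sub_smul, Matrix.one_apply]
  have hdet : (T.evaluation U t htU).hom C.det ≠ 0 := by
    rw [RingHom.map_det]
    have hCS : (T.evaluation U t htU).hom.mapMatrix C = Matrix.of fun i j =>
        Sum.elim (P.map (T.evaluation U t htU).hom i)
          ((1 - P.map (T.evaluation U t htU).hom) i) (S j) := Matrix.ext fun i j => ?_
    · rwa [hCS]
    simp only [C, RingHom.mapMatrix_apply, Matrix.map_apply, Matrix.of_apply]
    rcases S j with k | k
    · simp
    · simp [Matrix.one_apply, apply_ite]
  have htD : t ∈ T.basicOpen C.det := (T.evaluation_ne_zero_iff_mem_basicOpen t htU _).1 hdet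
  have hDU : T.basicOpen C.det ≤ U := T.basicOpen_le _
  have hunit : IsUnit (resO hDU C.det) := RingedSpace.isUnit_res_basicOpen _ _
  have hloc : IsLocalBasis M fun j =>
      res M hDU (Sum.elim (fun k => q (b k)) (fun k => b k - q (b k)) (S j)) := by
    have := (hb.restrict hDU).mul_matrix (C.map (resO hDU)) (by
      rwa [← RingHom.mapMatrix_apply, ← RingHom.map_det])
    refine this.congr fun j => ?_
    rw [← hC, map_sum]
    simp only [res_smul, Matrix.map_apply]
  refine ⟨_, htD, {j // (S j).isLeft}, {j // ¬ (S j).isLeft}, inferInstance, inferInstance,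
    fun k => e.app _ (res M hDU (Sum.elim (fun k => q (b k)) (fun k => b k - q (b k)) (S k))),
    fun k => res M hDU (Sum.elim (fun k => q (b k)) (fun k => b k - q (b k)) (S k)), ?_, ?_⟩
  · rintro ⟨j, hj⟩
    rcases hSj : S j with k | k
    · simp [hSj] at hj
    · simp only [hSj, Sum.elim_inr]
      rw [← res_hom_app, map_sub]
      change res N hDU (e.app U (b k) - e.app U (i.app U (e.app U (b k)))) = 0
      rw [hie, sub_self, map_zero]
  · refine (hloc.reindex (Equiv.sumCompl fun j => (S j).isLeft)).congr ?_
    rintro (⟨j, hj⟩ | ⟨j, hj⟩)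
    · rcases hSj : S j with k | k
      · simp only [Equiv.sumCompl_apply_inl, Sum.elim_inl, hSj]
        rw [← res_hom_app, ← res_hom_app]
        change res M hDU (i.app U (e.app U (b k))) = res M hDU (i.app U (e.app U (i.app U _)))
        rw [hie]
        rfl
      · simp [hSj] at hj
    · rfl

end

end SThreeCover

/-! ### Isotypic parts of the regular representation -/

namespace SThreeCover

open CoordG

section GModule

variable {R M : Type*} [CommRing R] [AddCommGroup M] [Module R M]

namespace GModule

/-- For `ε = ±1` the projection onto the part of degree `0` on which `σ` acts as `ε`, if `2` is
invertible. -/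
noncomputable def q (Q : GModule R M) (ε : ℤ) : M →ₗ[R] M :=
  (Ring.inverse 2 : R) • (Q.p 0 + ε • (Q.σ ∘ₗ Q.p 0))

theorem q_apply (Q : GModule R M) (ε : ℤ) (x : M) :
    Q.q ε x = (Ring.inverse 2 : R) • (Q.p 0 x + ε • Q.σ (Q.p 0 x)) := rfl

theorem inverse_two_smul (h2 : IsUnit (2 : R)) (x : M) : (Ring.inverse 2 : R) • (x + x) = x := by
  rw [← two_smul R x, smul_smul, Ring.inverse_mul_cancel _ h2, one_smul]

theorem p_p_self (Q : GModule R M) (k : ZMod 3) (x : M) : Q.p k (Q.p k x) = Q.p k x := by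
  rw [Q.p_p, if_pos rfl]

theorem p_zero_σ (Q : GModule R M) (x : M) : Q.p 0 (Q.σ x) = Q.σ (Q.p 0 x) := by
  rw [Q.p_σ, neg_zero]

/-- The image of `q ε` is the part of degree `0` on which `σ` acts as `ε`. -/
theorem q_eq_self_iff (h2 : IsUnit (2 : R)) (Q : GModule R M) {ε : ℤ} (hε : ε * ε = 1) (x : M) :
    Q.q ε x = x ↔ Q.p 0 x = x ∧ Q.σ x = ε • x := by
  constructor
  · intro h
    rw [← h]
    simp only [q_apply, map_smul, map_add, p_p_self, p_zero_σ, Q.σ_σ, map_zsmul, true_and]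
    rw [smul_comm ε, smul_add ε, smul_smul, hε, one_smul, add_comm]
  · rintro ⟨hp, hσ⟩
    rw [q_apply, hp, hσ, smul_smul, hε, one_smul, inverse_two_smul h2]

theorem p_q (h2 : IsUnit (2 : R)) (Q : GModule R M) {ε : ℤ} (hε : ε * ε = 1) (x : M) :
    Q.q ε (Q.q ε x) = Q.q ε x := by
  rw [q_eq_self_iff h2 Q hε]
  simp only [q_apply, map_smul, map_add, p_p_self, p_zero_σ, Q.σ_σ, map_zsmul, true_and]
  rw [smul_comm ε, smul_add ε, smul_smul, hε, one_smul, add_comm]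

theorem q_add_q (h2 : IsUnit (2 : R)) (Q : GModule R M) (x : M) :
    Q.q 1 x + Q.q (-1) x = Q.p 0 x := by
  rw [q_apply, q_apply, ← smul_add, one_smul, neg_smul, one_smul]
  convert inverse_two_smul h2 (Q.p 0 x) using 2
  abel

theorem map_q {S N : Type*} [CommRing S] [AddCommGroup N] [Module S N] (Q : GModule R M)
    (Q' : GModule S N) (g : R →+* S) (f : M →ₗ[ℤ] N) (h2 : IsUnit (2 : R))
    (hs : ∀ r x, f (r • x) = g r • f x) (hp : ∀ k x, f (Q.p k x) = Q'.p k (f x))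
    (hσ : ∀ x, f (Q.σ x) = Q'.σ (f x)) (ε : ℤ) (x : M) : f (Q.q ε x) = Q'.q ε (f x) := by
  rw [q_apply, q_apply, hs, map_inverse_two g h2, map_add, map_zsmul, hσ, hp]

section Regular

attribute [local instance 2000] TensorProduct.instModule

variable {Q : GModule R M} {e : M ≃ₗ[R] R ⊗[ℤ] CoordG}

/-- The action of `G` on the coefficients of elements of the regular representation. -/
theorem part_regular (he : ∀ x, TensorProduct.assoc ℤ R CoordG CoordG
      ((e.toLinearMap.restrictScalars ℤ).rTensor CoordG (Q.coact x)) =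
        Coalgebra.comul.lTensor R (e x)) (a b : ZMod 2) (k l : ZMod 3) (x : M) :
    part a k (e (Q.p l (if b = 0 then x else Q.σ x))) =
      if l = sgn a * k then part (a + b) k (e x) else 0 := by
  have h := congrArg (part a k ∘ part b l ∘ (TensorProduct.assoc ℤ R CoordG CoordG).symm) (he x)
  simp only [Function.comp, LinearEquiv.symm_apply_apply, part_rTensor, part_coact,
    LinearMap.restrictScalars_apply, part_part_comul] at h
  exact h

theorem part_p_regular (he : ∀ x, TensorProduct.assoc ℤ R CoordG CoordG
      ((e.toLinearMap.restrictScalars ℤ).rTensor CoordG (Q.coact x)) =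
        Coalgebra.comul.lTensor R (e x)) (a : ZMod 2) (k l : ZMod 3) (x : M) :
    part a k (e (Q.p l x)) = if l = sgn a * k then part a k (e x) else 0 := by
  have := part_regular he a 0 k l x
  rwa [if_pos rfl, add_zero] at this

theorem part_σ_regular (he : ∀ x, TensorProduct.assoc ℤ R CoordG CoordG
      ((e.toLinearMap.restrictScalars ℤ).rTensor CoordG (Q.coact x)) =
        Coalgebra.comul.lTensor R (e x)) (a : ZMod 2) (k : ZMod 3) (x : M) :
    part a k (e (Q.σ x)) = part (a + 1) k (e x) := by
  have := part_regular he a 1 k (sgn a * k) x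
  rwa [if_pos rfl, if_neg (by decide), part_p_regular he, if_pos rfl] at this

/-- If the vectors of coefficients of the elements fixed by `q` are the image of an injective linear
map, then so are the elements fixed by `q`. -/
theorem exists_of_parts {ι : Type} (e : M ≃ₗ[R] R ⊗[ℤ] CoordG) (q : M → M)
    (w : (ι → R) →ₗ[R] ZMod 2 → ZMod 3 → R) (hw : Function.Injective w)
    (hq : ∀ x, q x = x ↔ ∃ c, w c = fun a k => part a k (e x)) :
    ∃ g : (ι → R) →ₗ[R] M, Function.Injective g ∧ ∀ x, q x = x ↔ ∃ c, g c = x := by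
  let s : (ZMod 2 → ZMod 3 → R) →ₗ[R] R ⊗[ℤ] CoordG :=
    { toFun := fun z => ∑ a : ZMod 2, ∑ k : ZMod 3, z a k ⊗ₜ CoordG.e a k
      map_add' := fun z z' => by simp [TensorProduct.add_tmul, Finset.sum_add_distrib]
      map_smul' := fun r z => by
        simp only [Pi.smul_apply, RingHom.id_apply, Finset.smul_sum, TensorProduct.smul_tmul'] }
  have hs : ∀ z a k, part a k (s z) = z a k := fun z a k => part_sum a k z
  have hg : ∀ c x, e.symm (s (w c)) = x ↔ w c = fun a k => part a k (e x) := fun c x => by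
    constructor
    · rintro rfl
      funext a k
      rw [LinearEquiv.apply_symm_apply, hs]
    · intro h
      rw [LinearEquiv.symm_apply_eq]
      exact tensor_ext fun a k => by rw [hs, h]
  refine ⟨e.symm.toLinearMap ∘ₗ s ∘ₗ w, fun c c' h => hw ?_, fun x => ?_⟩
  · have h' := (hg c _).1 h
    exact h'.trans ((hg c' _).1 rfl).symm
  · rw [hq]
    exact exists_congr fun c => (hg c x).symm

theorem eq_iff_parts (e : M ≃ₗ[R] R ⊗[ℤ] CoordG) (x y : M) :
    x = y ↔ ∀ a k, part a k (e x) = part a k (e y) :=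
  ⟨fun h _ _ => h ▸ rfl, fun h => e.injective (tensor_ext h)⟩

/-- The part of degree `1` of the regular representation is free of rank two. -/
theorem exists_basis_p_one (he : ∀ x, TensorProduct.assoc ℤ R CoordG CoordG
      ((e.toLinearMap.restrictScalars ℤ).rTensor CoordG (Q.coact x)) =
        Coalgebra.comul.lTensor R (e x)) :
    ∃ g : (Fin 2 → R) →ₗ[R] M, Function.Injective g ∧ ∀ x, Q.p 1 x = x ↔ ∃ c, g c = x := by
  refine exists_of_parts e (Q.p 1)
    { toFun := fun c a k => if a = 0 ∧ k = 1 then c 0 else if a = 1 ∧ k = 2 then c 1 else 0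
      map_add' := fun c d => by ext a k; simp only [Pi.add_apply]; split_ifs <;> simp
      map_smul' := fun r c => by ext a k; simp } ?_ fun x => ?_
  · intro c c' h
    ext j
    have h0 := congrFun (congrFun h 0) 1
    have h1 := congrFun (congrFun h 1) 2
    fin_cases j
    · simpa using h0
    · simpa using h1
  · rw [eq_iff_parts e]
    simp only [part_p_regular he]
    generalize e x = z
    have hd : ∀ (a : ZMod 2) (k : ZMod 3), 1 = sgn a * k ↔ (a = 0 ∧ k = 1) ∨ (a = 1 ∧ k = 2) := by
      decide
    simp only [hd]
    constructor
    · intro h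
      refine ⟨![part 0 1 z, part 1 2 z], funext fun a => funext fun k => ?_⟩
      rw [← h a k]
      simp only [LinearMap.coe_mk, AddHom.coe_mk, Matrix.cons_val_zero, Matrix.cons_val_one]
      split_ifs with h1 h2 h3 h4 h5
      · rw [h1.1, h1.2]
      · exact absurd (Or.inl h1) h2
      · rw [h3.1, h3.2]
      · exact absurd (Or.inr h3) h4
      · exact (h5.elim h1 h3).elim
      · rfl
    · rintro ⟨c, hc⟩ a k
      have hc := congrFun (congrFun hc a) k
      simp only [LinearMap.coe_mk, AddHom.coe_mk] at hc
      split_ifs with h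
      · rfl
      · rw [← hc, if_neg fun h' => h (Or.inl h'), if_neg fun h' => h (Or.inr h')]

/-- The parts of degree `0` of the regular representation on which `σ` acts as `1` and as `-1` are
free of rank one. -/
theorem exists_basis_q (h2 : IsUnit (2 : R)) (he : ∀ x, TensorProduct.assoc ℤ R CoordG CoordG
      ((e.toLinearMap.restrictScalars ℤ).rTensor CoordG (Q.coact x)) =
        Coalgebra.comul.lTensor R (e x)) {ε : ℤ} (hε : ε * ε = 1) :
    ∃ g : (Fin 1 → R) →ₗ[R] M, Function.Injective g ∧ ∀ x, Q.q ε x = x ↔ ∃ c, g c = x := by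
  refine exists_of_parts e (Q.q ε)
    { toFun := fun c a k => if k = 0 then (if a = 0 then c 0 else ε • c 0) else 0
      map_add' := fun c d => by ext a k; simp only [Pi.add_apply]; split_ifs <;> simp
      map_smul' := fun r c => by
        ext a k
        simp only [Pi.smul_apply, RingHom.id_apply]
        split_ifs
        · rfl
        · exact smul_comm ..
        · exact (smul_zero r).symm } ?_ fun x => ?_
  · intro c c' h
    ext j
    rw [Subsingleton.elim j 0]
    simpa using congrFun (congrFun h 0) 0
  · rw [q_eq_self_iff h2 Q hε, eq_iff_parts e, eq_iff_parts e]
    simp only [part_p_regular he, part_σ_regular he, map_zsmul]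
    generalize e x = z
    have hd : ∀ (a : ZMod 2) (k : ZMod 3), 0 = sgn a * k ↔ k = 0 := by decide
    simp only [hd]
    constructor
    · rintro ⟨hp, hσ⟩
      refine ⟨fun _ => part 0 0 z, funext fun a => funext fun k => ?_⟩
      rw [← hp a k]
      simp only [LinearMap.coe_mk, AddHom.coe_mk]
      by_cases hk : k = 0
      · subst hk
        rw [if_pos rfl, if_pos rfl]
        split_ifs with ha
        · rw [ha]
        · have ha : a = 0 + 1 := by revert ha; decide +revert
          rw [ha, hσ]
      · rw [if_neg hk, if_neg hk]
    · rintro ⟨c, hc⟩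
      have hc : ∀ a k, (if k = 0 then (if a = 0 then c 0 else ε • c 0) else 0) = part a k z :=
        fun a k => congrFun (congrFun hc a) k
      constructor
      · intro a k
        split_ifs with h
        · rfl
        · rw [← hc, if_neg h]
      · intro a k
        rw [← hc, ← hc]
        by_cases hk : k = 0
        · rw [if_pos hk, if_pos hk]
          have ha : a = 0 ∨ a = 1 := by decide +revert
          rcases ha with rfl | rfl
          · rw [if_neg (by decide), if_pos rfl]
          · rw [if_pos (by decide), if_neg (by decide), smul_smul, hε, one_smul]
        · rw [if_neg hk, if_neg hk, smul_zero]

end Regular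

end GModule

/-- The number of elements of a basis of a direct summand is determined by the projection. -/
theorem card_eq_of_fixed [Nontrivial R] (q : M →ₗ[R] M) {κ κ' ι : Type} [Fintype κ] [Fintype κ']
    [Fintype ι] (b : κ → M) (d : κ' → M)
    (hb : Function.Bijective fun c : κ ⊕ κ' → R => ∑ k, c k • Sum.elim b d k)
    (hqb : ∀ k, q (b k) = b k) (hqd : ∀ k, q (d k) = 0) (g : (ι → R) →ₗ[R] M)
    (hg : Function.Injective g) (hgq : ∀ x, q x = x ↔ ∃ c, g c = x) :
    Fintype.card κ = Fintype.card ι := by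
  have hinj : Function.Injective (Fintype.linearCombination R b) := fun c c' h => by
    have := @hb.1 (Sum.elim c 0) (Sum.elim c' 0) (by
      simpa [Fintype.sum_sum_type, Fintype.linearCombination_apply] using h)
    exact funext fun k => congrFun this (Sum.inl k)
  have hr : LinearMap.range (Fintype.linearCombination R b) = LinearMap.range g := by
    ext x
    rw [LinearMap.mem_range, LinearMap.mem_range, ← hgq]
    constructor
    · rintro ⟨c, rfl⟩
      simp [Fintype.linearCombination_apply, hqb]
    · intro h
      obtain ⟨c, rfl⟩ := hb.2 x
      refine ⟨fun k => c (Sum.inl k), ?_⟩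
      rw [← h]
      simp [Fintype.sum_sum_type, Fintype.linearCombination_apply, hqb, hqd]
  exact card_eq_of_linearEquiv R ((LinearEquiv.ofInjective _ hinj).trans
    ((LinearEquiv.ofEq _ _ hr).trans (LinearEquiv.ofInjective g hg).symm))

end GModule

section Rank

variable {T : Scheme.{u}}

/-- The rank of a direct summand can be computed after a base change. -/
theorem locallyFreeOfRank_of_split {M N : T.Modules} (hM : LocallyFree M) (i : N ⟶ M) (e : M ⟶ N)
    (hie : ∀ (U : T.Opens) (x : Γ(N, U)), e.app U (i.app U x) = x) (n : ℕ)
    (H : ∀ t : T, ∃ (X : Scheme.{u}) (f : X ⟶ T) (x : X) (M' : X.Modules) (φ : CartMap f M M')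
      (q : ∀ W : X.Opens, Γ(M', W) →ₗ[Γ(X, W)] Γ(M', W)), f x = t ∧
      (∀ (U : T.Opens) (y : Γ(M, U)),
        q (f ⁻¹ᵁ U) (φ.app U y) = φ.app U (i.app U (e.app U y))) ∧
      ∀ W : X.Opens, ∃ g : (Fin n → Γ(X, W)) →ₗ[Γ(X, W)] Γ(M', W), Function.Injective g ∧
        ∀ y, q W y = y ↔ ∃ c, g c = y) : LocallyFreeOfRank N n := by
  intro t
  obtain ⟨V, htV, κ, κ', _, _, b, d, hd, hB⟩ := hM.exists_split i e hie t
  obtain ⟨X, f, x, M', φ, q, hx, hq, hg⟩ := H t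
  have hxV : x ∈ f ⁻¹ᵁ V := by
    change f x ∈ V
    rwa [hx]
  have : Nontrivial Γ(X, f ⁻¹ᵁ V) := by
    have : Nonempty (f ⁻¹ᵁ V) := ⟨⟨x, hxV⟩⟩
    infer_instance
  obtain ⟨g, hgi, hgq⟩ := hg (f ⁻¹ᵁ V)
  have hφ := φ.isLocalBasis' hB (f ⁻¹ᵁ V) le_rfl
  have hcard := card_eq_of_fixed (q (f ⁻¹ᵁ V)) (fun k => φ.app V (i.app V (b k)))
    (fun k => φ.app V (d k)) (by
      convert hφ using 5 with c k
      rw [res_refl]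
      rcases k with k | k <;> rfl)
    (fun k => by rw [hq, hie]) (fun k => by rw [hq, hd, map_zero, map_zero]) g hgi hgq
  rw [Fintype.card_fin] at hcard
  exact ⟨V, htV, _, (IsLocalBasis.retract i e hie hd hB).reindex
    (Fintype.equivFinOfCardEq hcard).symm⟩

end Rank

end SThreeCover

/-! ### Isotypic summands of a `G`-cover -/

namespace SThreeCover

section Idempotents

variable {T : Scheme.{u}}

/-- Idempotent endomorphisms of sheaves of modules split. -/
theorem exists_splitting {M : T.Modules} (q : ∀ U : T.Opens, Γ(M, U) →ₗ[Γ(T, U)] Γ(M, U))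
    (hq : ∀ (U V : T.Opens) (h : V ≤ U) (x : Γ(M, U)), res M h (q U x) = q V (res M h x))
    (hqq : ∀ (U : T.Opens) (x : Γ(M, U)), q U (q U x) = q U x) :
    ∃ (N : T.Modules) (i : N ⟶ M) (e : M ⟶ N),
      (∀ (U : T.Opens) (x : Γ(N, U)), e.app U (i.app U x) = x) ∧
      ∀ (U : T.Opens) (x : Γ(M, U)), i.app U (e.app U x) = q U x := by
  obtain ⟨N, i, e, h1, h2⟩ := IsIdempotentComplete.idempotents_split M (homMk q hq) (by
    ext U x
    exact hqq U x)
  refine ⟨N, i, e, fun U x => ?_, fun U x => ?_⟩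
  · change (i ≫ e).app U x = x
    rw [h1]
    rfl
  · change (e ≫ i).app U x = q U x
    rw [h2]
    rfl

end Idempotents

namespace EquivariantAlgebra

variable {T : Scheme.{u}} {A : EquivariantAlgebra T}

/-- The image of a natural projection of representations of `G` is, on a `G`-cover, locally free of
the rank which it has on the regular representation. -/
theorem IsGCover.exists_summand [Fact (IsUnit (2 : Γ(T, ⊤)))] (hA : A.IsGCover) (n : ℕ)
    (q : ∀ {R M : Type u} [CommRing R] [AddCommGroup M] [Module R M], GModule R M → M →ₗ[R] M)
    (hmap : ∀ {R M S N : Type u} [CommRing R] [AddCommGroup M] [Module R M] [CommRing S]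
      [AddCommGroup N] [Module S N] (Q : GModule R M) (Q' : GModule S N) (g : R →+* S)
      (f : M →ₗ[ℤ] N), IsUnit (2 : R) → (∀ r x, f (r • x) = g r • f x) →
      (∀ k x, f (Q.p k x) = Q'.p k (f x)) → (∀ x, f (Q.σ x) = Q'.σ (f x)) →
      ∀ x, f (q Q x) = q Q' (f x))
    (hqq : ∀ {R M : Type u} [CommRing R] [AddCommGroup M] [Module R M] (Q : GModule R M),
      IsUnit (2 : R) → ∀ x, q Q (q Q x) = q Q x)
    (hbasis : ∀ {R M : Type u} [CommRing R] [AddCommGroup M] [Module R M] (Q : GModule R M)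
      (e : M ≃ₗ[R] R ⊗[ℤ] CoordG), IsUnit (2 : R) →
      (∀ x, TensorProduct.assoc ℤ R CoordG CoordG
        ((e.toLinearMap.restrictScalars ℤ).rTensor CoordG (Q.coact x)) =
          Coalgebra.comul.lTensor R (e x)) →
      ∃ g : (Fin n → R) →ₗ[R] M, Function.Injective g ∧ ∀ x, q Q x = x ↔ ∃ c, g c = x) :
    ∃ (N : T.Modules) (i : N ⟶ A.sheaf) (e : A.sheaf ⟶ N), LocallyFreeOfRank N n ∧
      (∀ (U : T.Opens) (x : Γ(N, U)), e.app U (i.app U x) = x) ∧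
      ∀ (U : T.Opens) (x : Γ(A.sheaf, U)),
        i.app U (e.app U x) = q (A.coaction.gmod U) x := by
  obtain ⟨N, i, e, hie, hei⟩ := exists_splitting (fun U => q (A.coaction.gmod U))
    (fun U V h => hmap _ _ (resO h) (res A.sheaf h) (two_isUnit U) (res_smul _ h)
      (A.coaction.res_gmod h).1 (A.coaction.res_gmod h).2) (fun U => hqq _ (two_isUnit U))
  refine ⟨N, i, e, locallyFreeOfRank_of_split A.locallyFree i e hie n fun t => ?_, hie, hei⟩
  obtain ⟨𝒰, h𝒰⟩ := hA.exists_regular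
  have : Scheme.JointlySurjective Scheme.fppfPrecoverage.{u} :=
    inferInstanceAs (Scheme.JointlySurjective (Scheme.precoverage _))
  obtain ⟨j, x, hx⟩ := 𝒰.exists_eq t
  obtain ⟨M, ρ, φ, hφ, hρ⟩ := h𝒰 j
  obtain ⟨r, -, hr⟩ := hρ
  have : Fact (IsUnit (2 : Γ(𝒰.X j, ⊤))) := ⟨by
    have := (two_isUnit (T := T) ⊤).map ((𝒰.f j).app ⊤).hom
    rw [map_ofNat] at this
    exact this⟩
  refine ⟨𝒰.X j, 𝒰.f j, x, M, φ, fun W => q (ρ.gmod W), hx, fun U y => ?_, fun W => ?_⟩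
  · have h := ((A.coaction.gmod U).rTensor_coact_iff (ρ.gmod (𝒰.f j ⁻¹ᵁ U)) (φ.app U)).1
      fun x => by
        rw [← Coaction.app_eq, ← Coaction.app_eq]
        exact hφ U x
    rw [hei]
    exact (hmap _ _ ((𝒰.f j).app U).hom (φ.app U) (two_isUnit U) (φ.app_smul U) h.1 h.2 y).symm
  · refine hbasis (ρ.gmod W) (r W) (two_isUnit W) fun x => ?_
    rw [← Coaction.app_eq]
    exact hr W x

/-- The multiplication is additive in the degrees. -/
theorem mul_degree {U : T.Opens} {a b : ZMod 3} {x y : Γ(A.sheaf, U)}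
    (hx : (A.coaction.gmod U).p a x = x) (hy : (A.coaction.gmod U).p b y = y) :
    (A.coaction.gmod U).p (a + b) (A.mul.app U x y) = A.mul.app U x y := by
  rw [p_mul, Finset.sum_eq_single a]
  · rw [hx, add_sub_cancel_left, hy]
  · intro i _ hi
    rw [← hx, GModule.p_p, if_neg hi, map_zero, LinearMap.zero_apply]
  · simp

/-- The sheaves `L` and `F` of a `G`-cover, presented as direct summands: `L` is the part of degree
`0` of `A` on which `σ` acts as `-1`, and `F` is the part of degree `1`. The last condition says
that the invariants of `A` are the functions. -/
structure Summands (A : EquivariantAlgebra T) where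
  L : T.Modules
  F : T.Modules
  rank_L : LocallyFreeOfRank L 1
  rank_F : LocallyFreeOfRank F 2
  ιL : L ⟶ A.sheaf
  πL : A.sheaf ⟶ L
  ιF : F ⟶ A.sheaf
  πF : A.sheaf ⟶ F
  πL_ιL (U : T.Opens) (x : Γ(L, U)) : πL.app U (ιL.app U x) = x
  ιL_πL (U : T.Opens) (x : Γ(A.sheaf, U)) :
    ιL.app U (πL.app U x) = (A.coaction.gmod U).q (-1) x
  πF_ιF (U : T.Opens) (x : Γ(F, U)) : πF.app U (ιF.app U x) = x
  ιF_πF (U : T.Opens) (x : Γ(A.sheaf, U)) :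
    ιF.app U (πF.app U x) = (A.coaction.gmod U).p 1 x
  existsUnique_smul_one (U : T.Opens) (x : Γ(A.sheaf, U))
    (h : (A.coaction.gmod U).q 1 x = x) : ∃! r : Γ(T, U), r • A.oneOn U = x

/-- If the invariants of `A` form an invertible sheaf, it is generated by `1`. Indeed, a local
generator `c` satisfies `1 = r c` and `c² = s c` for functions `r` and `s`, so that
`c = r c² = r s c` and `r` is invertible. -/
theorem isLocalBasis_one [Fact (IsUnit (2 : Γ(T, ⊤)))] {N : T.Modules} (hN : LocallyFreeOfRank N 1)
    (i : N ⟶ A.sheaf) (e : A.sheaf ⟶ N)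
    (hie : ∀ (U : T.Opens) (x : Γ(N, U)), e.app U (i.app U x) = x)
    (hei : ∀ (U : T.Opens) (x : Γ(A.sheaf, U)),
      i.app U (e.app U x) = (A.coaction.gmod U).q 1 x) :
    IsLocalBasis N fun _ : Fin 1 => e.app ⊤ A.one := by
  refine isLocalBasis_of_cover _ fun t _ => ?_
  obtain ⟨V, htV, b, hb⟩ := hN t
  have hb' : IsLocalBasis N fun _ : Fin 1 => b 0 := hb.congr fun k => by rw [Subsingleton.elim k 0]
  refine ⟨V, le_top, htV, ?_⟩
  have hfix : ∀ x : Γ(N, V), (A.coaction.gmod V).p 0 (i.app V x) = i.app V x ∧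
      (A.coaction.gmod V).σ (i.app V x) = i.app V x := fun x => by
    have := (GModule.q_eq_self_iff (two_isUnit V) (A.coaction.gmod V) (ε := 1) (by norm_num)
      (i.app V x)).1 (by rw [← hei, hie])
    rwa [one_smul] at this
  have hrec : ∀ x : Γ(A.sheaf, V), (A.coaction.gmod V).p 0 x = x → (A.coaction.gmod V).σ x = x →
      i.app V (e.app V x) = x := fun x h0 hσ => by
    rw [hei, GModule.q_eq_self_iff (two_isUnit V) _ (by norm_num), one_smul]
    exact ⟨h0, hσ⟩
  have hone : e.app V (A.oneOn V) = res N le_top (e.app ⊤ A.one) := (res_hom_app e le_top _).symm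
  obtain ⟨r, hr⟩ := hb'.exists_smul (e.app V (A.oneOn V))
  obtain ⟨s, hs⟩ := hb'.exists_smul (e.app V (A.mul.app V (i.app V (b 0)) (i.app V (b 0))))
  have hr' : A.oneOn V = r • i.app V (b 0) := by
    rw [← hrec _ (A.p_σ_one V).1 (A.p_σ_one V).2, hr]
    exact i.app_smul r (b 0)
  have hs' : A.mul.app V (i.app V (b 0)) (i.app V (b 0)) = s • i.app V (b 0) := by
    have hdeg := mul_degree (hfix (b 0)).1 (hfix (b 0)).1
    rw [add_zero] at hdeg
    rw [← hrec _ hdeg (by rw [σ_mul, (hfix (b 0)).2]), hs]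
    exact i.app_smul s (b 0)
  have hrs : (r * s) • b 0 = (1 : Γ(T, V)) • b 0 := by
    have h := A.one_mul V (i.app V (b 0))
    change A.mul.app V (A.oneOn V) _ = _ at h
    rw [hr', map_smul, LinearMap.smul_apply, hs', smul_smul] at h
    rw [one_smul, ← hie V (b 0), ← h]
    refine (congrArg (fun y => (r * s) • e.app V y) h).trans ?_
    exact (e.app_smul (r * s) (i.app V (b 0))).symm
  have hru : IsUnit r := IsUnit.of_mul_eq_one s (hb'.smul_injective hrs)
  refine (hb'.mul_matrix (Matrix.of fun _ _ => r) (by simpa using hru)).congr fun _ => ?_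
  rw [← hone, hr]
  simp

/-- The invariants, the part `L` and the part `F` of a `G`-cover have ranks `1`, `1` and `2`,
because they do so on the regular representation. -/
theorem IsGCover.nonempty_summands [Fact (IsUnit (2 : Γ(T, ⊤)))] (hA : A.IsGCover) :
    Nonempty A.Summands := by
  obtain ⟨N, i, e, hN, hie, hei⟩ := hA.exists_summand 1 (fun Q => Q.q 1)
    (fun Q Q' g f h2 hs hp hσ => GModule.map_q Q Q' g f h2 hs hp hσ 1)
    (fun Q h2 => GModule.p_q h2 Q (by norm_num))
    (fun Q e h2 he => GModule.exists_basis_q h2 he (by norm_num))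
  obtain ⟨L, iL, eL, hL, hieL, heiL⟩ := hA.exists_summand 1 (fun Q => Q.q (-1))
    (fun Q Q' g f h2 hs hp hσ => GModule.map_q Q Q' g f h2 hs hp hσ (-1))
    (fun Q h2 => GModule.p_q h2 Q (by norm_num))
    (fun Q e h2 he => GModule.exists_basis_q h2 he (by norm_num))
  obtain ⟨F, iF, eF, hF, hieF, heiF⟩ := hA.exists_summand 2 (fun Q => Q.p 1)
    (fun Q Q' g f _ _ hp _ => hp 1) (fun Q _ => Q.p_p_self 1)
    (fun Q e _ he => GModule.exists_basis_p_one he)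
  refine ⟨⟨L, F, hL, hF, iL, eL, iF, eF, hieL, heiL, hieF, heiF, fun U x hx => ?_⟩⟩
  have hb := (isLocalBasis_one hN i e hie hei).restrict (le_top : U ≤ ⊤)
  have hone : e.app U (A.oneOn U) = res N le_top (e.app ⊤ A.one) := (res_hom_app e le_top _).symm
  rw [← hone] at hb
  have hi1 : i.app U (e.app U (A.oneOn U)) = A.oneOn U := by
    rw [hei, GModule.q_eq_self_iff (two_isUnit U) _ (by norm_num), one_smul]
    exact A.p_σ_one U
  obtain ⟨r, hr⟩ := hb.exists_smul (e.app U x)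
  refine ⟨r, ?_, fun r' hr' => hb.smul_injective ?_⟩
  · change r • A.oneOn U = x
    rw [← hx, ← hei, hr, ← hi1]
    refine (i.app_smul r _).symm.trans ?_
    rw [hi1]
  · rw [← hr, ← hr']
    exact (e.app_smul r' _).symm

end EquivariantAlgebra

end SThreeCover

/-! ### Building data of a `G`-cover -/

namespace SThreeCover

theorem GModule.q_neg_one_eq_zero {R M : Type*} [CommRing R] [AddCommGroup M] [Module R M]
    (Q : GModule R M) {x : M} (hx : Q.σ x = x) : Q.q (-1) x = 0 := by
  rw [q_apply, ← p_zero_σ, hx, neg_one_zsmul, add_neg_cancel, smul_zero]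

theorem GModule.p_eq_ite {R M : Type*} [CommRing R] [AddCommGroup M] [Module R M]
    (Q : GModule R M) {x : M} {a : ZMod 3} (hx : Q.p a x = x) (k : ZMod 3) :
    Q.p k x = if k = a then x else 0 := by
  rw [← hx, p_p]
  split_ifs with h
  · rw [h, hx]
  · rfl

namespace EquivariantAlgebra

namespace Summands

variable {T : Scheme.{u}} {A : EquivariantAlgebra T} (S : A.Summands)

section

variable [Fact (IsUnit (2 : Γ(T, ⊤)))] {U : T.Opens}

theorem degree_ιL (l : Γ(S.L, U)) : (A.coaction.gmod U).p 0 (S.ιL.app U l) = S.ιL.app U l ∧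
    (A.coaction.gmod U).σ (S.ιL.app U l) = -S.ιL.app U l := by
  have := (GModule.q_eq_self_iff (two_isUnit U) (A.coaction.gmod U) (ε := -1) (by norm_num)
    (S.ιL.app U l)).1 (by rw [← S.ιL_πL, S.πL_ιL])
  rwa [neg_one_zsmul] at this

theorem exists_smul_one_of_degree (S : A.Summands) {x : Γ(A.sheaf, U)}
    (hx : (A.coaction.gmod U).p 0 x = x)
    (hσ : (A.coaction.gmod U).σ x = x) : ∃ r : Γ(T, U), r • A.oneOn U = x :=
  (S.existsUnique_smul_one U x (by
    rw [GModule.q_eq_self_iff (two_isUnit U) _ (by norm_num), one_zsmul]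
    exact ⟨hx, hσ⟩)).exists

theorem smul_one_injective (S : A.Summands) {r r' : Γ(T, U)}
    (h : r • A.oneOn U = r' • A.oneOn U) : r = r' :=
  (S.existsUnique_smul_one U (r' • A.oneOn U) (by
    rw [map_smul, (GModule.q_eq_self_iff (two_isUnit U) _ (by norm_num) _).2]
    rw [one_zsmul]
    exact A.p_σ_one U)).unique h rfl

end

section

variable {U : T.Opens}

theorem degree_ιF (u : Γ(S.F, U)) :
    (A.coaction.gmod U).p 1 (S.ιF.app U u) = S.ιF.app U u := by
  rw [← S.ιF_πF, S.πF_ιF]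

theorem degree_σ_ιF (u : Γ(S.F, U)) :
    (A.coaction.gmod U).p 2 ((A.coaction.gmod U).σ (S.ιF.app U u)) =
      (A.coaction.gmod U).σ (S.ιF.app U u) := by
  have h : -(2 : ZMod 3) = 1 := by decide
  rw [GModule.p_σ, h, S.degree_ιF]

theorem ιF_πF_of_degree {x : Γ(A.sheaf, U)} (hx : (A.coaction.gmod U).p 1 x = x) :
    S.ιF.app U (S.πF.app U x) = x := by
  rw [S.ιF_πF, hx]

theorem ιF_injective : Function.Injective (S.ιF.app U) := fun x y h => by
  rw [← S.πF_ιF U x, h, S.πF_ιF]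

theorem ιL_injective : Function.Injective (S.ιL.app U) := fun x y h => by
  rw [← S.πL_ιL U x, h, S.πL_ιL]

end

/-- The building data of a `G`-cover: `α`, `β` and `⟨-,-⟩` are the components of the multiplication,
where the part of degree `2` is identified with the part of degree `1` by means of `σ`. -/
noncomputable def data (hA : A.IsGCover) : BuildingData T where
  L := S.L
  F := S.F
  rank_L := S.rank_L
  rank_F := S.rank_F
  α :=
    { app := fun U => ((A.mul.app U).compl₁₂ (appL S.ιL U) (appL S.ιF U)).compr₂ (appL S.πF U)
      res_app := fun U V h l u => by
        simp only [LinearMap.compr₂_apply, LinearMap.compl₁₂_apply, appL_apply, res_hom_app,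
          A.mul.res_app U V h] }
  β :=
    { app := fun U => ((A.mul.app U).compl₁₂ (appL S.ιF U) (appL S.ιF U)).compr₂
        (appL S.πF U ∘ₗ (A.coaction.gmod U).σ)
      res_app := fun U V h u v => by
        simp only [LinearMap.compr₂_apply, LinearMap.compl₁₂_apply, LinearMap.comp_apply,
          appL_apply, res_hom_app, A.mul.res_app U V h, (A.coaction.res_gmod h).2] }
  β_symm U u v := by
    change S.πF.app U ((A.coaction.gmod U).σ (A.mul.app U (S.ιF.app U u) (S.ιF.app U v))) =
      S.πF.app U ((A.coaction.gmod U).σ (A.mul.app U (S.ιF.app U v) (S.ιF.app U u)))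
    rw [hA.mul_comm]
  pairing :=
    { app := fun U => ((A.mul.app U).compl₁₂ (appL S.ιF U)
        ((A.coaction.gmod U).σ ∘ₗ appL S.ιF U)).compr₂ (appL S.πL U)
      res_app := fun U V h u v => by
        simp only [LinearMap.compr₂_apply, LinearMap.compl₁₂_apply, LinearMap.comp_apply,
          appL_apply, res_hom_app, A.mul.res_app U V h, (A.coaction.res_gmod h).2] }
  pairing_self U u := by
    change S.πL.app U (A.mul.app U (S.ιF.app U u) ((A.coaction.gmod U).σ (S.ιF.app U u))) = 0
    apply S.ιL_injective
    refine Eq.trans ?_ (map_zero (appL S.ιL U)).symm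
    rw [S.ιL_πL, GModule.q_neg_one_eq_zero]
    rw [σ_mul, GModule.σ_σ, hA.mul_comm]

section Data

variable (hA : A.IsGCover) {U : T.Opens}

theorem ιF_β (u v : Γ(S.F, U)) : S.ιF.app U ((S.data hA).β.app U u v) =
    (A.coaction.gmod U).σ (A.mul.app U (S.ιF.app U u) (S.ιF.app U v)) := by
  refine S.ιF_πF_of_degree ?_
  have h := mul_degree (S.degree_ιF u) (S.degree_ιF v)
  have h1 : (1 : ZMod 3) + 1 = -1 := by decide
  rw [h1] at h
  exact (GModule.p_σ _ _ _).trans (congrArg _ h)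

theorem ιF_mul_ιF (u v : Γ(S.F, U)) : A.mul.app U (S.ιF.app U u) (S.ιF.app U v) =
    (A.coaction.gmod U).σ (S.ιF.app U ((S.data hA).β.app U u v)) :=
  ((congrArg _ (S.ιF_β hA u v)).trans ((A.coaction.gmod U).σ_σ _)).symm

theorem ιL_pairing (u v : Γ(S.F, U)) : S.ιL.app U ((S.data hA).pairing.app U u v) =
    (A.coaction.gmod U).q (-1)
      (A.mul.app U (S.ιF.app U u) ((A.coaction.gmod U).σ (S.ιF.app U v))) :=
  S.ιL_πL U _

theorem degree_ιF_mul_σ_ιF (u v : Γ(S.F, U)) : (A.coaction.gmod U).p 0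
    (A.mul.app U (S.ιF.app U u) ((A.coaction.gmod U).σ (S.ιF.app U v))) =
      A.mul.app U (S.ιF.app U u) ((A.coaction.gmod U).σ (S.ιF.app U v)) := by
  have h := mul_degree (S.degree_ιF u) (S.degree_σ_ιF v)
  have h1 : (1 : ZMod 3) + 2 = 0 := by decide
  rwa [h1] at h

variable [Fact (IsUnit (2 : Γ(T, ⊤)))]

theorem ιF_α (l : Γ(S.L, U)) (u : Γ(S.F, U)) :
    S.ιF.app U ((S.data hA).α.app U l u) = A.mul.app U (S.ιL.app U l) (S.ιF.app U u) := by
  refine S.ιF_πF_of_degree ?_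
  have h := mul_degree (S.degree_ιL l).1 (S.degree_ιF u)
  rwa [zero_add] at h

theorem m_smul_one (s t : Γ(S.L, U)) : (S.data hA).m U s t • A.oneOn U =
    A.mul.app U (S.ιL.app U s) (S.ιL.app U t) := by
  have h := mul_degree (S.degree_ιL s).1 (S.degree_ιL t).1
  rw [add_zero] at h
  obtain ⟨a, ha⟩ := S.exists_smul_one_of_degree h (by
    rw [σ_mul, (S.degree_ιL s).2, (S.degree_ιL t).2, map_neg, map_neg, LinearMap.neg_apply,
      neg_neg])
  rw [← ha]
  congr 1
  refine (S.data hA).m_eq_of_smul U s t a fun V hV u => S.ιF_injective ?_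
  have ha' := congrArg (res A.sheaf hV) ha
  rw [res_smul, A.mul.res_app U V hV, res_hom_app, res_hom_app] at ha'
  refine (S.ιF_α hA _ _).trans ?_
  refine (congrArg _ (S.ιF_α hA _ _)).trans ?_
  rw [← hA.mul_assoc]
  refine (congrFun (congrArg DFunLike.coe (congrArg (A.mul.app V) ha'.symm)) _).trans ?_
  rw [map_smul, LinearMap.smul_apply]
  refine Eq.trans ?_ (S.ιF.app_smul (resO hV a) u).symm
  exact congrArg _ ((congrArg (fun y => A.mul.app V y _) (res_res A.sheaf le_top hV A.one)).trans
    (A.one_mul V _))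

/-- The product of the parts of degree `1` and `2` has components in the invariants and in `L`. -/
theorem ιF_mul_σ_ιF (u v : Γ(S.F, U)) :
    A.mul.app U (S.ιF.app U u) ((A.coaction.gmod U).σ (S.ιF.app U v)) =
      (A.coaction.gmod U).q 1
        (A.mul.app U (S.ιF.app U u) ((A.coaction.gmod U).σ (S.ιF.app U v))) +
      S.ιL.app U ((S.data hA).pairing.app U u v) := by
  rw [ιL_pairing, GModule.q_add_q (two_isUnit U), S.degree_ιF_mul_σ_ιF]

/-- The component of `u * σ v` in the invariants is `(u, v)`: multiplication of `σ (u * σ v)` by a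
section `l` of `L` shows that its product with `l` is `⟨α (l ⊗ v), u⟩`. -/
theorem bracket_smul_one (u v : Γ(S.F, U)) : (S.data hA).bracket U u v • A.oneOn U =
    (A.coaction.gmod U).q 1
      (A.mul.app U (S.ιF.app U u) ((A.coaction.gmod U).σ (S.ιF.app U v))) := by
  have hq := (GModule.q_eq_self_iff (two_isUnit U) _ (by norm_num) _).1
    ((A.coaction.gmod U).p_q (two_isUnit U) (ε := 1) (by norm_num)
      (A.mul.app U (S.ιF.app U u) ((A.coaction.gmod U).σ (S.ιF.app U v))))
  rw [one_zsmul] at hq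
  obtain ⟨c, hc⟩ := S.exists_smul_one_of_degree hq.1 hq.2
  rw [← hc]
  congr 1
  refine (S.data hA).functions_ext fun V hV l => S.ιL_injective ?_
  have hc' := congrArg (res A.sheaf hV) hc
  have h1 : res A.sheaf hV (A.oneOn U) = A.oneOn V := res_res A.sheaf le_top hV A.one
  rw [GModule.map_q _ _ (resO hV) (res A.sheaf hV) (two_isUnit U) (res_smul _ hV)
    (A.coaction.res_gmod hV).1 (A.coaction.res_gmod hV).2, A.mul.res_app U V hV,
    (A.coaction.res_gmod hV).2, res_hom_app, res_hom_app, res_smul, h1] at hc'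
  have hw := S.ιF_mul_σ_ιF hA (res S.F hV u) (res S.F hV v)
  rw [← hc'] at hw
  have hσw := congrArg (A.coaction.gmod V).σ hw
  have h2 : ∀ p : Γ(S.L, V), (A.coaction.gmod V).σ (S.ιL.app V p) = -S.ιL.app V p :=
    fun p => (S.degree_ιL p).2
  rw [map_add, map_smul, (A.p_σ_one V).2, σ_mul, GModule.σ_σ, hA.mul_comm] at hσw
  refine (congrArg (fun r => S.ιL.app V (r • l)) ((S.data hA).resO_bracket hV u v)).trans ?_
  refine (congrArg (S.ιL.app V) ((S.data hA).bracket_smul V _ _ l)).trans ?_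
  refine (S.ιL_pairing hA _ _).trans ?_
  refine (congrArg (fun y => (A.coaction.gmod V).q (-1) (A.mul.app V y _))
    (S.ιF_α hA _ _)).trans ?_
  rw [hA.mul_assoc]
  refine (congrArg (fun y => (A.coaction.gmod V).q (-1) (A.mul.app V _ y)) hσw).trans ?_
  have h3 : A.mul.app V (S.ιL.app V l) (A.oneOn V) = S.ιL.app V l := A.mul_one V _
  refine (congrArg (fun y => (A.coaction.gmod V).q (-1) (A.mul.app V _ (_ + y))) (h2 _)).trans ?_
  rw [map_add, map_add, map_smul, map_smul, h3, map_neg, GModule.q_neg_one_eq_zero _ (x := -_),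
    add_zero, ← S.ιL_πL]
  · exact (congrArg (resO hV c • S.ιL.app V ·) (S.πL_ιL V l)).trans (S.ιL.app_smul _ _).symm
  · rw [map_neg, σ_mul, h2 l]
    refine (congrArg (fun y => -A.mul.app V _ y) (h2 _)).trans ?_
    rw [map_neg, map_neg, LinearMap.neg_apply, neg_neg]

theorem ιF_mul_σ_ιF_eq (u v : Γ(S.F, U)) :
    A.mul.app U (S.ιF.app U u) ((A.coaction.gmod U).σ (S.ιF.app U v)) =
      (S.data hA).bracket U u v • A.oneOn U + S.ιL.app U ((S.data hA).pairing.app U u v) := by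
  rw [bracket_smul_one]
  exact S.ιF_mul_σ_ιF hA u v

theorem σ_ιF_mul_ιF_eq (u v : Γ(S.F, U)) :
    A.mul.app U ((A.coaction.gmod U).σ (S.ιF.app U u)) (S.ιF.app U v) =
      (S.data hA).bracket U u v • A.oneOn U - S.ιL.app U ((S.data hA).pairing.app U u v) := by
  have h := congrArg (A.coaction.gmod U).σ (S.ιF_mul_σ_ιF_eq hA u v)
  rw [map_add, map_smul, (A.p_σ_one U).2, σ_mul, GModule.σ_σ] at h
  rw [h, sub_eq_add_neg]
  exact congrArg _ (S.degree_ιL _).2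

theorem bijective_sum (U : T.Opens) : Function.Bijective
    fun x : Γ(T, U) × Γ(S.L, U) × Γ(S.F, U) × Γ(S.F, U) =>
      x.1 • A.oneOn U + S.ιL.app U x.2.1 + S.ιF.app U x.2.2.1 +
        (A.coaction.gmod U).σ (S.ιF.app U x.2.2.2) := by
  have h2 : -(2 : ZMod 3) = 1 := by decide
  have h1 : -(1 : ZMod 3) = 2 := by decide
  have h20 : (2 : ZMod 3) ≠ 0 := by decide
  have h21 : (2 : ZMod 3) ≠ 1 := by decide
  have h12 : (1 : ZMod 3) ≠ 2 := by decide
  have h10 : (1 : ZMod 3) ≠ 0 := by decide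
  have h02 : (0 : ZMod 3) ≠ 2 := by decide
  have hp := fun k => (A.coaction.gmod U).p_eq_ite (A.p_σ_one U).1 k
  have hpL := fun k l => (A.coaction.gmod U).p_eq_ite (S.degree_ιL (U := U) l).1 k
  have hpF := fun k l => (A.coaction.gmod U).p_eq_ite (S.degree_ιF (U := U) l) k
  have hpF' := fun k l => (A.coaction.gmod U).p_eq_ite (S.degree_σ_ιF (U := U) l) k
  constructor
  · rintro ⟨r, l, u, v⟩ ⟨r', l', u', v'⟩ h
    dsimp only at h
    have e1 := congrArg ((A.coaction.gmod U).p 1) h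
    have e2 := congrArg ((A.coaction.gmod U).p 2) h
    have e0 := congrArg ((A.coaction.gmod U).p 0) h
    simp only [map_add, map_smul, hp, hpL, hpF, hpF', if_neg h10, if_neg h20, if_neg h12,
      if_neg h21, if_neg h10.symm, if_neg h02, if_true, smul_zero, zero_add, add_zero] at e0 e1 e2
    have e3 := congrArg ((A.coaction.gmod U).q (-1)) e0
    have eL : S.ιL.app U l = S.ιL.app U l' := by
      rwa [map_add, map_add, map_smul, map_smul,
        GModule.q_neg_one_eq_zero _ (A.p_σ_one U).2, smul_zero, zero_add, smul_zero, zero_add,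
        ← S.ιL_πL, ← S.ιL_πL, S.πL_ιL, S.πL_ιL] at e3
    rw [eL] at e0
    rw [S.smul_one_injective (add_right_cancel e0), S.ιL_injective eL, S.ιF_injective e1,
      S.ιF_injective ((A.coaction.gmod U).σ_injective e2)]
  · intro z
    obtain ⟨r, hr, -⟩ := S.existsUnique_smul_one U _
      ((A.coaction.gmod U).p_q (two_isUnit U) (ε := 1) (by norm_num) z)
    refine ⟨⟨r, S.πL.app U z, S.πF.app U z, S.πF.app U ((A.coaction.gmod U).σ z)⟩, ?_⟩
    dsimp only at hr ⊢
    rw [hr, S.ιL_πL, S.ιF_πF, S.ιF_πF, GModule.q_add_q (two_isUnit U), GModule.p_σ, h1,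
      GModule.σ_σ, ← sum_zmod3 fun k => (A.coaction.gmod U).p k z, GModule.sum_p]

end Data

/-- The part of degree `2`, identified with `F` by means of `σ`. -/
noncomputable def ισF : S.F ⟶ A.sheaf :=
  homMk (fun U => (A.coaction.gmod U).σ ∘ₗ appL S.ιF U) fun U V h x => by
    simp only [LinearMap.comp_apply, appL_apply, (A.coaction.res_gmod h).2, res_hom_app]

theorem ισF_app (U : T.Opens) (u : Γ(S.F, U)) :
    S.ισF.app U u = (A.coaction.gmod U).σ (S.ιF.app U u) := rfl

theorem ιL_mul_ισF [Fact (IsUnit (2 : Γ(T, ⊤)))] (hA : A.IsGCover) (U : T.Opens) (s : Γ(S.L, U))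
    (u : Γ(S.F, U)) : A.mul.app U (S.ιL.app U s) (S.ισF.app U u) =
      S.ισF.app U (-(S.data hA).α.app U s u) := by
  have h : (A.coaction.gmod U).σ (S.ιF.app U ((S.data hA).α.app U s u)) =
      -A.mul.app U (S.ιL.app U s) (S.ισF.app U u) := by
    rw [ιF_α, σ_mul, (S.degree_ιL s).2, map_neg, LinearMap.neg_apply, ισF_app]
  rw [← neg_eq_iff_eq_neg.2 h]
  exact (map_neg (appL S.ισF U) _).symm

/-- The building data of a `G`-cover present it. -/
noncomputable def presentation (hA : A.IsGCover) [Fact (IsUnit (2 : Γ(T, ⊤)))] :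
    AlgebraPresentation (S.data hA) A where
  ιL := S.ιL
  ι₁ := S.ιF
  ι₂ := S.ισF
  bijective := S.bijective_sum
  mu_L U s := A.coaction.mu_eq_of_degree U _ 0 (S.degree_ιL s).1
  mu_F₁ U u := A.coaction.mu_eq_of_degree U _ 1 (S.degree_ιF u)
  mu_F₂ U u := A.coaction.mu_eq_of_degree U _ 2 (S.degree_σ_ιF u)
  sigma_L U s := (A.coaction.sigma_eq U _).trans (S.degree_ιL s).2
  sigma_F₁ U _ := A.coaction.sigma_eq U _
  sigma_F₂ U _ := (A.coaction.sigma_eq U _).trans ((A.coaction.gmod U).σ_σ _)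
  mul_L_L _ s t := (S.m_smul_one hA s t).symm
  mul_L_F₁ _ s u := (S.ιF_α hA s u).symm
  mul_L_F₂ U s u := S.ιL_mul_ισF hA U s u
  mul_F₁_L U u s := (hA.mul_comm U _ _).trans (S.ιF_α hA s u).symm
  mul_F₂_L U u s := (hA.mul_comm U _ _).trans (S.ιL_mul_ισF hA U s u)
  mul_F₁_F₁ _ u v := S.ιF_mul_ιF hA u v
  mul_F₂_F₂ U u v := (A.σ_mul U _ _).symm.trans (S.ιF_β hA u v).symm
  mul_F₁_F₂ _ u v := S.ιF_mul_σ_ιF_eq hA u v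
  mul_F₂_F₁ _ u v := S.σ_ιF_mul_ιF_eq hA u v

end Summands

end EquivariantAlgebra

/-- Every `G`-cover is the algebra of some building data. -/
theorem exists_presentation {T : Scheme.{u}} [Fact (IsUnit (2 : Γ(T, ⊤)))]
    (A : EquivariantAlgebra T) (hA : A.IsGCover) :
    ∃ χ : BuildingData T, Nonempty (AlgebraPresentation χ A) :=
  hA.nonempty_summands.elim fun S => ⟨S.data hA, ⟨S.presentation hA⟩⟩

end SThreeCover

/-! ### The equivalence with `G`-covers -/

theorem mainTheorem4 :
    ∃ Φ : SThreeCover.StackMap.{u}, Nonempty Φ.Presentation ∧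
      Φ.toFunctor.Full ∧ Φ.toFunctor.Faithful ∧
      Φ.InducesEquivalence (fun X => X.data.SatisfiesRelations) (fun A => A.data.IsGCover) ∧
      Φ.InducesEquivalence (fun X => X.data.SatisfiesDiagrams) (fun A => A.data.IsGCover) ∧
      ∀ X : SThreeCover.StackY.{u}, X.data.SatisfiesRelations ↔ X.data.SatisfiesDiagrams :=
  ⟨SThreeCover.algebraStackMap, ⟨SThreeCover.algebraStackMapPresentation⟩,
    SThreeCover.algebraStackMap_full, SThreeCover.algebraStackMap_faithful,
    SThreeCover.algebraStackMap_inducesEquivalence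
      (fun _ A hA => SThreeCover.exists_presentation A hA) _
      (fun X => X.data.satisfiesRelations_iff),
    SThreeCover.algebraStackMap_inducesEquivalence
      (fun _ A hA => SThreeCover.exists_presentation A hA) _
      (fun X => X.data.satisfiesDiagrams_iff),
    fun X => X.data.satisfiesRelations_iff.trans X.data.satisfiesDiagrams_iff.symm⟩
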